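/- Let $M$ be a finite-dimensional smooth manifold (Hausdorff, second countable, without boundary), $x_0\in M$, let $G$ be a finite-dimensional Lie group with Lie algebra $\mathfrak g$, and let $n\ge 1$. Let $\Omega^n(M,x_0)$ be the space of smooth maps $N:[0,1]^n\to M$ with $N|_{\partial[0,1]^n}=x_0$; a tangent vector at $N$ is a smooth vector field along $N$ that vanishes on $\partial[0,1]^n$. A connection on $\Omega^n(M,x_0)$ (on the trivial $G$-bundle) is a $\mathfrak g$-valued $1$-form $\mathcal A$: it is linear on tangent vectors, and its pull-back along every smooth family of $n$-loops parametrized by a cube $[0,1]^k$ is of class $C^1$. It is flat if $\mathcal F=d\mathcal A+\mathcal A\wedge\mathcal A$ vanishes on every smooth two-parameter family of $n$-loops. A smooth $\alpha:[0,1]^{n+1}\to M$ with $\alpha|_{\partial[0,1]^{n+1}}=x_0$ is viewed as a loop $\tau\mapsto\alpha_\tau=\alpha(\cdot,\tau)$ in $\Omega^n(M,x_0)$ based at the constant $n$-loop $x_0$. Its holonomy is $\mathrm{hol}(\alpha)=W(1)\in G$, where $W'(\tau)+\mathcal A(\alpha_\tau;\partial_\tau\alpha_\tau)\,W(\tau)=0$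 and $W(0)=1$. The holonomy group $H_{x_0}\subset G$ is the subgroup generated by all $\mathrm{hol}(\alpha)$. (i) Let $A$ be a connection on a smooth principal $G$-bundle $P\to M$, let $B$ be a smooth $(n+1)$-form on $M$ with values in the adjoint bundle of $P$, and let $p_0\in P_{x_0}$. Then $$\mathcal A(X)=\int_{[0,1]^n} W_\sigma^{-1}\,B\bigl(X,\partial_1N,\dots,\partial_nN\bigr)(\sigma)\,W_\sigma\,d\sigma ,$$ for $X$ tangent at $N$, is a connection on $\Omega^n(M,x_0)$. Here $W_\sigma$ is the $A$-parallel transport from $x_0$ to $N(\sigma)$ along $\lambda\mapsto N(\lambda\sigma)$, $\lambda\in[0,1]$, and the fibre $P_{x_0}$ is identified with $G$ by $p_0$. (ii) Let $\mathcal A$ be any flat connection on $\Omega^n(M,x_0)$, for instance a flat one as in (i). Then every smooth $\alpha$ as above has a unique holonomy; $H_{x_0}$ is exactly the set of all these holonomies; $H_{x_0}$ is abelian; and there is a unique group homomorphism $\rho:\pi_{n+1}(M,x_0)\to H_{x_0}$ with $\rho([\alpha])=\mathrm{hol}(\alpha)$ for every smooth $\alpha$. -/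

import Mathlib

open Set Topology
open scoped Manifold ContDiff unitInterval Topology.Homotopy

noncomputable section

namespace HigherLoop

/-! ### Lie groups

Throughout, `G` is a Lie group modelled on the finite-dimensional normed space `F`. The Lie algebra
`𝔤 = T₁G` is `TangentSpace 𝓘(ℝ, F) (1 : G)`, which is `F` by definition; we write it as `F`, so that
calculus with `𝔤`-valued functions is available. Its bracket is the bracket of left-invariant
vector fields, which for matrix groups is the commutator. -/

section LieGroup

variable {F : Type*} [NormedAddCommGroup F] [NormedSpace ℝ F]
  (G : Type*) [TopologicalSpace G] [ChartedSpace F G] [Group G]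

/-- The Lie bracket of `𝔤 = T₁G`. -/
def bracket (u v : F) : F :=
  (⁅(show GroupLieAlgebra 𝓘(ℝ, F) G from u), (show GroupLieAlgebra 𝓘(ℝ, F) G from v)⁆ :
    GroupLieAlgebra 𝓘(ℝ, F) G)

variable {G}

/-- The adjoint action `Ad g = d(h ↦ g h g⁻¹)₁` of `G` on `𝔤`. -/
def Ad (g : G) (ξ : F) : F :=
  mfderiv 𝓘(ℝ, F) 𝓘(ℝ, F) (fun h : G => g * h * g⁻¹) 1 ξ

/-- The right translate `ξ g ∈ T_g G` of `ξ ∈ 𝔤`. -/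
def rightTranslate (g : G) (ξ : F) : TangentSpace 𝓘(ℝ, F) g :=
  (mfderiv 𝓘(ℝ, F) 𝓘(ℝ, F) (fun h : G => h * g) 1 ξ : F)

end LieGroup

/-! ### The loop spaces `Ωⁿ(M, x₀)`

Mathlib's `Ω^ (Fin n) M x₀` is the space of continuous maps from the cube `[0,1]ⁿ` to `M` that send
the boundary to `x₀`. -/

/-- The retraction of `ℝⁿ` onto the unit cube; it serves to write a map on the cube as a map on
`Icc 0 1 ⊆ ℝⁿ`. -/
def toCube {n : ℕ} (s : Fin n → ℝ) : Fin n → I := fun i => projIcc 0 1 zero_le_one (s i)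

section Loops

variable {E : Type*} [NormedAddCommGroup E] [NormedSpace ℝ E]
  {M : Type*} [TopologicalSpace M] [ChartedSpace E M] {x₀ : M} {n : ℕ}

variable (E) in
/-- A smooth `n`-loop: smooth on the closed cube (up to the boundary). -/
def IsSmoothLoop (N : Ω^ (Fin n) M x₀) : Prop :=
  ContMDiffOn 𝓘(ℝ, Fin n → ℝ) 𝓘(ℝ, E) ∞ (fun s : Fin n → ℝ => N (toCube s)) (Icc 0 1)

variable (E) in
/-- A vector field along the `n`-loop `N` (not necessarily tangential to its image). -/
abbrev FieldAlong (N : Ω^ (Fin n) M x₀) : Type _ :=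
  ∀ s : Fin n → I, TangentSpace 𝓘(ℝ, E) (N s)

/-- Tangent vectors to `Ωⁿ(M, x₀)` at `N`: the smooth vector fields along `N` that vanish on the
boundary of the cube. -/
def IsTangentVector [IsManifold 𝓘(ℝ, E) ∞ M] (N : Ω^ (Fin n) M x₀) (X : FieldAlong E N) : Prop :=
  ContMDiffOn 𝓘(ℝ, Fin n → ℝ) (𝓘(ℝ, E)).tangent ∞
    (fun s : Fin n → ℝ => (⟨N (toCube s), X (toCube s)⟩ : TangentBundle 𝓘(ℝ, E) M)) (Icc 0 1) ∧
  ∀ s ∈ Cube.boundary (Fin n), X s = 0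

variable (E) in
/-- A smooth family of `n`-loops with parameters in `S ⊆ V`: jointly smooth on `S × [0,1]ⁿ`. -/
def IsSmoothFamily {V : Type*} [NormedAddCommGroup V] [NormedSpace ℝ V] (S : Set V)
    (x : V → Ω^ (Fin n) M x₀) : Prop :=
  ContMDiffOn 𝓘(ℝ, V × (Fin n → ℝ)) 𝓘(ℝ, E) ∞
    (fun z : V × (Fin n → ℝ) => x z.1 (toCube z.2)) (S ×ˢ Icc 0 1)

variable (E) in
/-- The derivative `∂_v x` of a family of `n`-loops at the parameter `q`, a vector field along
the `n`-loop `x q`. -/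
def velocity {V : Type*} [NormedAddCommGroup V] [NormedSpace ℝ V] (S : Set V)
    (x : V → Ω^ (Fin n) M x₀) (q v : V) : FieldAlong E (x q) :=
  fun s => mfderivWithin 𝓘(ℝ, V) 𝓘(ℝ, E) (fun q' => x q' s) S q v

/-- The loop `τ ↦ α(·, τ)` in `Ωⁿ(M, x₀)`, based at the constant loop, that an `(n+1)`-loop `α`
describes. -/
def slice (α : Ω^ (Fin (n + 1)) M x₀) (τ : I) : Ω^ (Fin n) M x₀ :=
  ⟨⟨fun s => α (Fin.snoc (α := fun _ => I) s τ), by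
      refine (map_continuous α.1).comp (continuous_pi fun i => ?_)
      refine Fin.lastCases ?_ (fun j => ?_) i
      · simpa using continuous_const
      · simpa using continuous_apply j⟩, by
    rintro s ⟨i, hi⟩
    exact α.2 _ ⟨i.castSucc, by simpa using hi⟩⟩

/-! ### Connections on `Ωⁿ(M, x₀)` and their holonomy -/

variable {F : Type*} [NormedAddCommGroup F] [NormedSpace ℝ F]

variable (E F M x₀ n) in
/-- A function that assigns an element of `𝔤` to an `n`-loop and a vector field along it. -/
abbrev FormData : Type _ := ∀ N : Ω^ (Fin n) M x₀, FieldAlong E N → F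

/-- The coefficient `q ↦ 𝒜(x_q; ∂_v x_q)` of the pull-back of `𝒜` to the parameter space of a
family `x`. -/
def FormData.pullback (𝒜 : FormData E M x₀ n F) {V : Type*} [NormedAddCommGroup V]
    [NormedSpace ℝ V] (S : Set V) (x : V → Ω^ (Fin n) M x₀) (v q : V) : F :=
  𝒜 (x q) (velocity E S x q v)

/-- `𝒜` is (the `𝔤`-valued `1`-form of) a connection on `Ωⁿ(M, x₀)`: it is linear on tangent
vectors, and its pull-back along every smooth finite-parameter family of `n`-loops is a `1`-form of
class `C¹`, the regularity at which curvature makes sense. -/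
structure FormData.IsConnection [IsManifold 𝓘(ℝ, E) ∞ M] (𝒜 : FormData E M x₀ n F) : Prop where
  linear : ∀ N : Ω^ (Fin n) M x₀, IsSmoothLoop E N → ∀ X Y : FieldAlong E N,
    IsTangentVector N X → IsTangentVector N Y → ∀ a b : ℝ,
      𝒜 N (fun s => a • X s + b • Y s) = a • 𝒜 N X + b • 𝒜 N Y
  contDiff : ∀ (k : ℕ) (x : (Fin k → ℝ) → Ω^ (Fin n) M x₀), IsSmoothFamily E (Icc 0 1) x →
    ∀ v : Fin k → ℝ, ContDiffOn ℝ 1 (𝒜.pullback (Icc 0 1) x v) (Icc 0 1)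

variable (G : Type*) [TopologicalSpace G] [ChartedSpace F G] [Group G]

/-- The curvature `d𝒜 + 𝒜 ∧ 𝒜` vanishes on every smooth two-parameter family of `n`-loops. -/
def FormData.IsFlat (𝒜 : FormData E M x₀ n F) : Prop :=
  ∀ x : (Fin 2 → ℝ) → Ω^ (Fin n) M x₀, IsSmoothFamily E (Icc 0 1) x →
    ∀ q ∈ Icc (0 : Fin 2 → ℝ) 1, ∀ u v : Fin 2 → ℝ,
      fderivWithin ℝ (𝒜.pullback (Icc 0 1) x v) (Icc 0 1) q u
        - fderivWithin ℝ (𝒜.pullback (Icc 0 1) x u) (Icc 0 1) q v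
        + bracket G (𝒜.pullback (Icc 0 1) x u q) (𝒜.pullback (Icc 0 1) x v q) = 0

variable {G}

/-- `h` is the holonomy of `𝒜` along the loop `τ ↦ α_τ` in `Ωⁿ(M, x₀)`: the value at the final time
of a solution of the parallel transport equation `W' + 𝒜(α_τ; ∂_τ α_τ) W = 0`, `W(0) = 1`. -/
def FormData.IsHolonomy (𝒜 : FormData E M x₀ n F) (α : Ω^ (Fin (n + 1)) M x₀) (h : G) : Prop :=
  ∃ W : ℝ → G, W 0 = 1 ∧ W 1 = h ∧ ∀ τ ∈ Icc (0 : ℝ) 1,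
    HasMFDerivWithinAt 𝓘(ℝ, ℝ) 𝓘(ℝ, F) W (Icc 0 1) τ
      (ContinuousLinearMap.toSpanSingleton ℝ (rightTranslate (W τ)
        (-(𝒜.pullback (Icc 0 1) (fun t : ℝ => slice α (projIcc 0 1 zero_le_one t)) 1 τ))))

variable (G) in
/-- The holonomies of all smooth loops in `Ωⁿ(M, x₀)` based at the constant `n`-loop. -/
def FormData.holonomies (𝒜 : FormData E M x₀ n F) : Set G :=
  {h | ∃ α : Ω^ (Fin (n + 1)) M x₀, IsSmoothLoop E α ∧ 𝒜.IsHolonomy α h}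

variable (G) in
/-- The holonomy group `H_{x₀} ⊆ G`. -/
def FormData.holonomyGroup (𝒜 : FormData E M x₀ n F) : Subgroup G :=
  Subgroup.closure (𝒜.holonomies G)

end Loops

/-! ### Principal bundles, and the connection on `Ωⁿ(M, x₀)` built from `A` and `B` -/

section Bundle

variable {E : Type*} [NormedAddCommGroup E] [NormedSpace ℝ E]
  {M : Type*} [TopologicalSpace M] [ChartedSpace E M]
  {F : Type*} [NormedAddCommGroup F] [NormedSpace ℝ F]
  {G : Type*} [TopologicalSpace G] [ChartedSpace F G] [Group G]
  {Q : Type*} [NormedAddCommGroup Q] [NormedSpace ℝ Q]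
  {P : Type*} [TopologicalSpace P] [ChartedSpace Q P]

variable (E M F G Q P) in
/-- A smooth principal `G`-bundle `P → M`. -/
structure PrincipalBundle where
  /-- The projection. -/
  proj : P → M
  /-- The right action of `G`. -/
  act : P → G → P
  smooth_proj : ContMDiff 𝓘(ℝ, Q) 𝓘(ℝ, E) ∞ proj
  smooth_act : ContMDiff ((𝓘(ℝ, Q)).prod 𝓘(ℝ, F)) 𝓘(ℝ, Q) ∞ (fun z : P × G => act z.1 z.2)
  act_one : ∀ p, act p 1 = p
  act_mul : ∀ p g h, act p (g * h) = act (act p g) h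
  proj_act : ∀ p g, proj (act p g) = proj p
  /-- Local triviality: over a neighbourhood `U` of `y`, the map `(z, g) ↦ s(z) g` is a
  diffeomorphism from `U × G` onto `π⁻¹(U)`, with inverse `p ↦ (π(p), t(p))`. -/
  locally_trivial : ∀ y : M, ∃ U : Set M, IsOpen U ∧ y ∈ U ∧ ∃ (s : M → P) (t : P → G),
    ContMDiffOn 𝓘(ℝ, E) 𝓘(ℝ, Q) ∞ s U ∧ ContMDiffOn 𝓘(ℝ, Q) 𝓘(ℝ, F) ∞ t (proj ⁻¹' U) ∧
    (∀ z ∈ U, proj (s z) = z) ∧ (∀ p ∈ proj ⁻¹' U, act (s (proj p)) (t p) = p) ∧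
    (∀ z ∈ U, ∀ g : G, t (act (s z) g) = g)

/-- A connection `A` on a principal bundle: a `𝔤`-valued `1`-form on `P` that restricts to the
Maurer-Cartan form on the fibres and transforms under `G` by the adjoint representation. -/
structure PrincipalBundle.Connection [IsManifold 𝓘(ℝ, Q) ∞ P]
    (π : PrincipalBundle E M F G Q P) where
  /-- The `1`-form. -/
  form : ∀ p : P, TangentSpace 𝓘(ℝ, Q) p →L[ℝ] F
  smooth : ContMDiff (𝓘(ℝ, Q)).tangent 𝓘(ℝ, F) ∞
    (fun v : TangentBundle 𝓘(ℝ, Q) P => form v.1 v.2)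
  vertical : ∀ (p : P) (ξ : F),
    form p (mfderiv 𝓘(ℝ, F) 𝓘(ℝ, Q) (fun g : G => π.act p g) 1 ξ : Q) = ξ
  equivariant : ∀ (p : P) (g : G) (v : TangentSpace 𝓘(ℝ, Q) p),
    form (π.act p g) (mfderiv 𝓘(ℝ, Q) 𝓘(ℝ, Q) (fun p' : P => π.act p' g) p v) =
      Ad g⁻¹ (form p v)

/-- A `𝔤`-valued `k`-form `B` on `M` that transforms by the adjoint representation under gauge
transformations, that is, a smooth `k`-form on `M` with values in the adjoint bundle of `P`. It is
given by its value in each frame `p ∈ P`, an alternating form on the tangent space at `π(p)`. -/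
structure PrincipalBundle.AdjointForm [IsManifold 𝓘(ℝ, E) ∞ M]
    (π : PrincipalBundle E M F G Q P) (k : ℕ) where
  /-- The value of the form in the frame `p`. -/
  form : ∀ p : P, TangentSpace 𝓘(ℝ, E) (π.proj p) [⋀^Fin k]→L[ℝ] F
  equivariant : ∀ (p : P) (g : G) (v : Fin k → TangentSpace 𝓘(ℝ, E) (π.proj p)),
    form (π.act p g) v = Ad g⁻¹ (form p v)
  smooth : ∀ (m : ℕ) (f : (Fin m → ℝ) → P)
    (X : Fin k → ∀ q : Fin m → ℝ, TangentSpace 𝓘(ℝ, E) (π.proj (f q))),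
    ContMDiff 𝓘(ℝ, Fin m → ℝ) 𝓘(ℝ, Q) ∞ f →
    (∀ i, ContMDiff 𝓘(ℝ, Fin m → ℝ) (𝓘(ℝ, E)).tangent ∞
      (fun q => (⟨π.proj (f q), X i q⟩ : TangentBundle 𝓘(ℝ, E) M))) →
    ContDiff ℝ ∞ (fun q => form (f q) (fun i => X i q))

variable [IsManifold 𝓘(ℝ, E) ∞ M] [IsManifold 𝓘(ℝ, Q) ∞ P]
  {π : PrincipalBundle E M F G Q P}

/-- `c'` is the horizontal lift through `p₀` of the curve `c : [0,1] → M`. -/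
def PrincipalBundle.Connection.IsHorizontalLift (A : π.Connection) (c : ℝ → M) (p₀ : P)
    (c' : ℝ → P) : Prop :=
  c' 0 = p₀ ∧ ∀ t ∈ Icc (0 : ℝ) 1, π.proj (c' t) = c t ∧
    MDifferentiableWithinAt 𝓘(ℝ, ℝ) 𝓘(ℝ, Q) c' (Icc 0 1) t ∧
    A.form (c' t) (mfderivWithin 𝓘(ℝ, ℝ) 𝓘(ℝ, Q) c' (Icc 0 1) t (1 : ℝ)) = 0

open Classical in
/-- Parallel transport of `p₀` along `c : [0,1] → M` (with value `p₀` if there is no horizontal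
lift, which does not happen for smooth curves that start at the base point of `p₀`). -/
def PrincipalBundle.Connection.transport (A : π.Connection) (c : ℝ → M) (p₀ : P) : P :=
  if h : ∃ c', A.IsHorizontalLift c p₀ c' then h.choose 1 else p₀

/-- The connection `𝒜(X) = ∫_N ι_X B^W` on `Ωⁿ(M, x₀)` built from `A` and `B`. The integrand at
`σ ∈ [0,1]ⁿ` is `B(X, ∂₁N, …, ∂ₙN)`, pulled back to the fibre over `x₀` by parallel transport along
the path `λ ↦ N(λσ)` from `x₀` to `N(σ)`; it is read in the frame `p₀` of that fibre. For
`n = 1` the path is the loop itself. -/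
def PrincipalBundle.Connection.loopForm (A : π.Connection) {n : ℕ} (B : π.AdjointForm (n + 1))
    (p₀ : P) (x₀ : M) : FormData E M x₀ n F :=
  fun N X => ∫ s in Icc (0 : Fin n → ℝ) 1,
    B.form (A.transport (fun l : ℝ => N (toCube (l • s))) p₀)
      (Fin.cons (α := fun _ => E) (X (toCube s)) fun i : Fin n =>
        (mfderivWithin 𝓘(ℝ, Fin n → ℝ) 𝓘(ℝ, E) (fun s' : Fin n → ℝ => N (toCube s')) (Icc 0 1) s
          (Pi.single i (1 : ℝ)) : E))

end Bundle

end HigherLoop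

end

/-! Flatness makes holonomy a homotopy invariant. A smooth homotopy of `(n+1)`-loops is a map of the
square, with homotopy parameter `s` and loop time `t`, into `Ωⁿ(M, x₀)`. The connection pulls back
to `q ds + p dt`, and `q` vanishes for `t = 0` and `t = 1`, where every `n`-loop is constant. Let
`W_s` be the transport in `t`. The curve `V = W_{s₀}⁻¹ W_s` satisfies `V' = b V` with `b =
-Ad(W_{s₀}⁻¹)(p_s - p_{s₀})`, so that in a chart its end point differs from the identity by `∫ b`,
up to `O(|s - s₀|²)`. To first order `∫ b` is `-(s - s₀) ∫ Ad(W_{s₀}⁻¹) ∂ₛp dt`. Zero curvature says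
that this integrand is the `t`-derivative of `Ad(W_{s₀}⁻¹) q`, so the integral vanishes and `s ↦
W_s(1)` has derivative zero (`transport_eq_of_flat`). The argument rests on solving `W' = a W` in
`G` with a second order estimate (`exists_local_solution`) and on the fact that the derivative of
`Ad` is the Lie bracket (`adL_eq_bracket`).

Continuous classes are reached by smoothing inside charts, relative to the boundary
(`exists_smooth_homotopicRel`): every loop is homotopic to a smooth one, and homotopic smooth loops
are smoothly homotopic after a reparametrization. Concatenation in the last variable multiplies
holonomies (`FormData.IsConnection.isHolonomy_concat`). Hence holonomy is a homomorphism from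
`π_{n+1}(M, x₀)` to `G`. Its range is the set of all holonomies, which is therefore already a
subgroup, and it is abelian because `π_{n+1}` is abelian for `n ≥ 1`.

For the connection built from `A` and `B` the point is `C¹` dependence on parameters. In a local
frame the integrand is `Ad(g⁻¹)` applied to a smooth function, where `g` is the group coordinate of
the transported frame. Only `Ad(g⁻¹)` is needed, not `g`, and along a path inside one trivialization
it satisfies a linear equation in `F →L[ℝ] F`. Duhamel's formula gives `C¹` dependence for such
equations (`contDiffOn_one_of_linearODE`), smooth transition functions join the trivializations met
along a ray, and differentiation under the integral sign finishes the proof. -/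

set_option linter.unusedSectionVars false

noncomputable section

namespace HigherLoop

/-! ### Derivatives of maps of manifolds as linear maps of the model spaces -/

section ModelDerivative

variable {H₁ : Type*} [NormedAddCommGroup H₁] [NormedSpace ℝ H₁]
  {X : Type*} [TopologicalSpace X] [ChartedSpace H₁ X]
  {H₂ : Type*} [NormedAddCommGroup H₂] [NormedSpace ℝ H₂]
  {Y : Type*} [TopologicalSpace Y] [ChartedSpace H₂ Y]
  {H₃ : Type*} [NormedAddCommGroup H₃] [NormedSpace ℝ H₃]
  {Z : Type*} [TopologicalSpace Z] [ChartedSpace H₃ Z]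

/-- The derivative of a map of manifolds, as a linear map of the model spaces. -/
def tderiv (f : X → Y) (x : X) : H₁ →L[ℝ] H₂ :=
  (mfderiv 𝓘(ℝ, H₁) 𝓘(ℝ, H₂) f x : H₁ →L[ℝ] H₂)

/-- The base point `y` equals `f x` only through `e`, so group identities such as `one_mul g` can be
supplied without rewriting inside dependent types. -/
theorem tderiv_comp {f : X → Y} {g : Y → Z} {x : X} {y : Y} (e : f x = y)
    (hg : MDifferentiableAt 𝓘(ℝ, H₂) 𝓘(ℝ, H₃) g y)
    (hf : MDifferentiableAt 𝓘(ℝ, H₁) 𝓘(ℝ, H₂) f x) :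
    (tderiv (fun z => g (f z)) x : H₁ →L[ℝ] H₃) = (tderiv g y).comp (tderiv f x : H₁ →L[ℝ] H₂) := by
  subst e
  exact mfderiv_comp x hg hf

theorem tderiv_id (x : X) : tderiv (fun z : X => z) x = ContinuousLinearMap.id ℝ H₁ :=
  mfderiv_id

/-- `f` has derivative `L` at `x` within `S`, where `L` is a linear map of the model spaces. -/
def HasTDerivWithinAt (f : X → Y) (L : H₁ →L[ℝ] H₂) (S : Set X) (x : X) : Prop :=
  HasMFDerivWithinAt 𝓘(ℝ, H₁) 𝓘(ℝ, H₂) f S x L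

theorem hasTDerivWithinAt_tderiv {f : X → Y} {x : X}
    (hf : MDifferentiableAt 𝓘(ℝ, H₁) 𝓘(ℝ, H₂) f x) (S : Set X) :
    HasTDerivWithinAt f (tderiv f x : H₁ →L[ℝ] H₂) S x := hf.hasMFDerivAt.hasMFDerivWithinAt

theorem hasTDerivWithinAt_const (y : Y) (S : Set X) (x : X) :
    HasTDerivWithinAt (fun _ : X => y) (0 : H₁ →L[ℝ] H₂) S x := hasMFDerivWithinAt_const _ _ _

namespace HasTDerivWithinAt

variable {S T : Set X} {f : X → Y} {g : Y → Z} {x : X} {L L' : H₁ →L[ℝ] H₂}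

theorem mono (h : HasTDerivWithinAt f L S x) (hT : T ⊆ S) : HasTDerivWithinAt f L T x :=
  HasMFDerivWithinAt.mono h hT

theorem union (h : HasTDerivWithinAt f L S x) (h' : HasTDerivWithinAt f L T x) :
    HasTDerivWithinAt f L (S ∪ T) x := HasMFDerivWithinAt.union h h'

theorem continuousWithinAt (h : HasTDerivWithinAt f L S x) : ContinuousWithinAt f S x :=
  HasMFDerivWithinAt.continuousWithinAt h

theorem mdifferentiableWithinAt (h : HasTDerivWithinAt f L S x) :
    MDifferentiableWithinAt 𝓘(ℝ, H₁) 𝓘(ℝ, H₂) f S x :=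
  HasMFDerivWithinAt.mdifferentiableWithinAt h

theorem congr_of_eventuallyEq {f' : X → Y} (h : HasTDerivWithinAt f L S x) (e : f' =ᶠ[𝓝[S] x] f)
    (ex : f' x = f x) : HasTDerivWithinAt f' L S x :=
  HasMFDerivWithinAt.congr_of_eventuallyEq h e ex

theorem congr {f' : X → Y} (h : HasTDerivWithinAt f L S x) (e : ∀ s ∈ S, f' s = f s)
    (ex : f' x = f x) : HasTDerivWithinAt f' L S x :=
  h.congr_of_eventuallyEq (by filter_upwards [self_mem_nhdsWithin] with s hs using e s hs) ex

theorem tderiv_comp (hf : HasTDerivWithinAt f L S x)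
    (hg : MDifferentiableAt 𝓘(ℝ, H₂) 𝓘(ℝ, H₃) g (f x)) :
    HasTDerivWithinAt (fun z => g (f z)) ((tderiv g (f x) : H₂ →L[ℝ] H₃).comp L) S x :=
  HasMFDerivAt.comp_hasMFDerivWithinAt (x := x) (g := g) (f := f) hg.hasMFDerivAt hf

theorem comp {T : Set Y} {K : H₂ →L[ℝ] H₃} (hg : HasTDerivWithinAt g K T (f x))
    (hf : HasTDerivWithinAt f L S x) (hST : MapsTo f S T) :
    HasTDerivWithinAt (fun z => g (f z)) (K.comp L) S x :=
  HasMFDerivWithinAt.comp (x := x) (g := g) (f := f) hg hf hST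

theorem unique {H : Type*} [NormedAddCommGroup H] [NormedSpace ℝ H] {S : Set H} {x : H}
    {f : H → Y} {L L' : H →L[ℝ] H₂} (h : HasTDerivWithinAt f L S x)
    (h' : HasTDerivWithinAt f L' S x) (hS : UniqueDiffWithinAt ℝ S x) : L = L' :=
  UniqueMDiffWithinAt.eq (uniqueMDiffWithinAt_iff_uniqueDiffWithinAt.2 hS) h h'

theorem unique_univ (h : HasTDerivWithinAt f L univ x) (h' : HasTDerivWithinAt f L' univ x) :
    L = L' :=
  UniqueMDiffWithinAt.eq (uniqueMDiffWithinAt_univ _) h h'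

/-- The derivative of a map of two variables along a pair of maps. -/
theorem tderiv_comp₂ {H₀ : Type*} [NormedAddCommGroup H₀]
    [NormedSpace ℝ H₀] {X₀ : Type*} [TopologicalSpace X₀] [ChartedSpace H₀ X₀]
    {S : Set X₀} {f₁ : X₀ → X} {f₂ : X₀ → Y} {g : X × Y → Z} {x : X₀}
    {L₁ : H₀ →L[ℝ] H₁} {L₂ : H₀ →L[ℝ] H₂}
    (hf₁ : HasTDerivWithinAt f₁ L₁ S x) (hf₂ : HasTDerivWithinAt f₂ L₂ S x)
    (hg : MDifferentiableAt ((𝓘(ℝ, H₁)).prod 𝓘(ℝ, H₂)) 𝓘(ℝ, H₃) g (f₁ x, f₂ x)) :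
    HasTDerivWithinAt (fun z => g (f₁ z, f₂ z))
      ((tderiv (fun y => g (y, f₂ x)) (f₁ x) : H₁ →L[ℝ] H₃).comp L₁ +
        (tderiv (fun y => g (f₁ x, y)) (f₂ x) : H₂ →L[ℝ] H₃).comp L₂) S x := by
  have := HasMFDerivAt.comp_hasMFDerivWithinAt (x := x) (g := g) (f := fun z => (f₁ z, f₂ z))
    hg.hasMFDerivAt (HasMFDerivWithinAt.prodMk hf₁ hf₂)
  have h := fun v => mfderiv_prod_eq_add_apply (v := v) hg
  have e : (tderiv (fun y => g (y, f₂ x)) (f₁ x) : H₁ →L[ℝ] H₃).comp L₁ +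
      (tderiv (fun y => g (f₁ x, y)) (f₂ x) : H₂ →L[ℝ] H₃).comp L₂ =
      (show H₁ × H₂ →L[ℝ] H₃ from mfderiv ((𝓘(ℝ, H₁)).prod 𝓘(ℝ, H₂)) 𝓘(ℝ, H₃) g
        (f₁ x, f₂ x)).comp (L₁.prod L₂) := by
    ext v
    exact (h (show H₁ × H₂ from (L₁ v, L₂ v))).symm
  rw [e]
  exact this

end HasTDerivWithinAt

theorem hasTDerivWithinAt_iff_hasFDerivWithinAt {f : H₁ → H₂} {L : H₁ →L[ℝ] H₂} {S : Set H₁}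
    {x : H₁} : HasTDerivWithinAt f L S x ↔ HasFDerivWithinAt f L S x :=
  hasMFDerivWithinAt_iff_hasFDerivWithinAt

end ModelDerivative

/-! ### Calculus of curves in a Lie group, in the right trivialization -/

section LieCalculus

variable {F : Type*} [NormedAddCommGroup F] [NormedSpace ℝ F]
  {G : Type*} [TopologicalSpace G] [ChartedSpace F G] [Group G]

/-- The adjoint action as a continuous linear map. -/
def AdL (g : G) : F →L[ℝ] F := tderiv (fun h : G => g * h * g⁻¹) 1

/-- Right translation of tangent vectors at the identity, as a continuous linear map. -/
def rightTranslateL (g : G) : F →L[ℝ] F := tderiv (fun h : G => h * g) 1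

theorem rightTranslateL_one : rightTranslateL (1 : G) = ContinuousLinearMap.id ℝ F := by
  have : (fun h : G => h * 1) = fun h => h := by funext x; simp
  rw [rightTranslateL, this, tderiv_id]

theorem AdL_one : (AdL (1 : G) : F →L[ℝ] F) = ContinuousLinearMap.id ℝ F := by
  have : (fun h : G => 1 * h * 1⁻¹) = fun h => h := by funext x; simp
  rw [AdL, this, tderiv_id]

variable [LieGroup 𝓘(ℝ, F) ∞ G]

variable (F) in
theorem mdifferentiable_mul_left (g : G) :
    MDifferentiable 𝓘(ℝ, F) 𝓘(ℝ, F) (fun h : G => g * h) := by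
  have : ContMDiff 𝓘(ℝ, F) 𝓘(ℝ, F) ∞ (fun h : G => g * h) := contMDiff_mul_left
  exact this.mdifferentiable (by simp)

variable (F) in
theorem mdifferentiable_mul_right (g : G) :
    MDifferentiable 𝓘(ℝ, F) 𝓘(ℝ, F) (fun h : G => h * g) := by
  have : ContMDiff 𝓘(ℝ, F) 𝓘(ℝ, F) ∞ (fun h : G => h * g) := contMDiff_mul_right
  exact this.mdifferentiable (by simp)

variable (F) in
theorem mdifferentiable_conj (g : G) :
    MDifferentiable 𝓘(ℝ, F) 𝓘(ℝ, F) (fun h : G => g * h * g⁻¹) :=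
  (mdifferentiable_mul_right F g⁻¹).comp (mdifferentiable_mul_left F g)

/-- Chain rule for `(x * g) * h = x * (g * h)` at `x = 1`. -/
theorem tderiv_mul_right_comp (g h : G) :
    (tderiv (fun x : G => x * h) g : F →L[ℝ] F).comp (rightTranslateL g) =
      rightTranslateL (g * h) := by
  have := tderiv_comp (f := fun x : G => x * g) (x := 1) (one_mul g)
    (mdifferentiable_mul_right F h g) (mdifferentiable_mul_right F g 1)
  rw [rightTranslateL, rightTranslateL, ← this]
  simp_rw [mul_assoc]

/-- Both sides are the derivative at `x = 1` of `g * (x * h) = (g * x * g⁻¹) * (g * h)`. This is how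
`Ad` enters once tangent vectors are written as right translates. -/
theorem tderiv_mul_left_comp (g h : G) :
    (tderiv (fun x : G => g * x) h : F →L[ℝ] F).comp (rightTranslateL h) =
      (rightTranslateL (g * h)).comp (AdL g) := by
  have h1 := tderiv_comp (f := fun x : G => x * h) (x := 1) (one_mul h)
    (mdifferentiable_mul_left F g h) (mdifferentiable_mul_right F h 1)
  have h2 := tderiv_comp (f := fun x : G => g * x * g⁻¹) (x := 1) (by simp : g * 1 * g⁻¹ = 1)
    (mdifferentiable_mul_right F (g * h) 1) (mdifferentiable_conj F g 1)
  rw [rightTranslateL, rightTranslateL, AdL, ← h1, ← h2]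
  congr 1
  funext x
  group

theorem AdL_mul (g h : G) : (AdL (g * h) : F →L[ℝ] F) = (AdL g).comp (AdL h) := by
  have := tderiv_comp (f := fun x : G => h * x * h⁻¹) (x := 1) (by simp : h * 1 * h⁻¹ = 1)
    (mdifferentiable_conj F g 1) (mdifferentiable_conj F h 1)
  rw [AdL, AdL, AdL, ← this]
  congr 1
  funext x
  group

/-- Every tangent vector at `g` is a right translate of a tangent vector at the identity. -/
theorem exists_rightTranslateL_eq (g : G) (v : F) : ∃ ξ : F, rightTranslateL g ξ = v := by
  refine ⟨tderiv (fun x : G => x * g⁻¹) g v, ?_⟩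
  have h := tderiv_comp (f := fun x : G => x * g⁻¹) (x := g) (mul_inv_cancel g)
    (mdifferentiable_mul_right F g 1) (mdifferentiable_mul_right F g⁻¹ g)
  simp only [inv_mul_cancel_right, tderiv_id] at h
  exact (DFunLike.congr_fun h v).symm

/-- The derivative `W'` of the curve `W` in `G` is the right translate of `a`. -/
def HasRightLogDeriv (W : ℝ → G) (a : F) (S : Set ℝ) (t : ℝ) : Prop :=
  HasTDerivWithinAt W (ContinuousLinearMap.toSpanSingleton ℝ (rightTranslateL (W t) a)) S t

theorem hasRightLogDeriv_of_hasTDerivWithinAt {W : ℝ → G} {a : F} {S : Set ℝ} {t : ℝ}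
    {L : ℝ →L[ℝ] F} (h : HasTDerivWithinAt W L S t) (e : L 1 = rightTranslateL (W t) a) :
    HasRightLogDeriv W a S t := by
  have : (ContinuousLinearMap.toSpanSingleton ℝ (rightTranslateL (W t) a) : ℝ →L[ℝ] F) = L := by
    rw [← e]; ext; simp
  rwa [HasRightLogDeriv, this]

theorem exists_hasRightLogDeriv {W : ℝ → G} {S : Set ℝ} {t : ℝ}
    {L : ℝ →L[ℝ] F} (h : HasTDerivWithinAt W L S t) : ∃ a : F, HasRightLogDeriv W a S t :=
  let ⟨a, ha⟩ := exists_rightTranslateL_eq (W t) (L 1)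
  ⟨a, hasRightLogDeriv_of_hasTDerivWithinAt h ha.symm⟩

theorem hasRightLogDeriv_const (g : G) (S : Set ℝ) (t : ℝ) :
    HasRightLogDeriv (fun _ => g) (0 : F) S t :=
  hasRightLogDeriv_of_hasTDerivWithinAt (hasTDerivWithinAt_const g S t) (by simp)

variable (F) in
theorem mdifferentiable_mul :
    MDifferentiable ((𝓘(ℝ, F)).prod 𝓘(ℝ, F)) 𝓘(ℝ, F) (fun z : G × G => z.1 * z.2) := by
  have : ContMDiff ((𝓘(ℝ, F)).prod 𝓘(ℝ, F)) 𝓘(ℝ, F) ∞ (fun z : G × G => z.1 * z.2) :=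
    contMDiff_mul _ _
  exact this.mdifferentiable (by simp)

variable (F) in
theorem mdifferentiable_inv :
    MDifferentiable 𝓘(ℝ, F) 𝓘(ℝ, F) (fun g : G => g⁻¹) := by
  have : ContMDiff 𝓘(ℝ, F) 𝓘(ℝ, F) ∞ (fun g : G => g⁻¹) := contMDiff_inv _ _
  exact this.mdifferentiable (by simp)

/-- The unknown derivative is the right translate of some `b`. Differentiating `g * g⁻¹ = 1` gives
`a + Ad g b = 0`, which is solved for `b`. -/
theorem tderiv_inv_rightTranslateL (g : G) (a : F) :
    tderiv (fun g : G => g⁻¹) g (rightTranslateL g a) = rightTranslateL g⁻¹ (-AdL g⁻¹ a) := by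
  obtain ⟨b, hb⟩ := exists_rightTranslateL_eq g⁻¹
    (tderiv (fun g : G => g⁻¹) g (rightTranslateL g a) : F)
  have h0 := HasTDerivWithinAt.tderiv_comp₂ (S := univ) (g := fun z : G × G => z.1 * z.2)
    (hasTDerivWithinAt_tderiv (f := fun h : G => h) (x := g) mdifferentiableAt_id _)
    (hasTDerivWithinAt_tderiv (mdifferentiable_inv F g) _) (mdifferentiable_mul F _)
  simp only [mul_inv_cancel] at h0
  have h3 := DFunLike.congr_fun (h0.unique_univ (hasTDerivWithinAt_const (1 : G) _ g))
    (rightTranslateL g a)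
  have h1 := DFunLike.congr_fun (tderiv_mul_right_comp g g⁻¹) a
  have h2 := DFunLike.congr_fun (tderiv_mul_left_comp g g⁻¹) b
  simp only [ContinuousLinearMap.comp_apply] at h1 h2
  simp only [add_apply, ContinuousLinearMap.comp_apply, tderiv_id,
    ContinuousLinearMap.id_apply, h1, ← hb, h2, mul_inv_cancel, rightTranslateL_one,
    zero_apply] at h3
  have h5 : AdL g⁻¹ (AdL g b) = AdL g⁻¹ (-a) := by rw [eq_neg_of_add_eq_zero_right h3]
  rw [← ContinuousLinearMap.comp_apply, ← AdL_mul, inv_mul_cancel, AdL_one] at h5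
  rw [← hb, ← map_neg, ← h5, ContinuousLinearMap.id_apply]

namespace HasRightLogDeriv

variable {W V : ℝ → G} {a b : F} {S T : Set ℝ} {t : ℝ}

/-- Product rule `(W V)' = W' V + W V'`; the left factor in the second term passes to the right of
`b` as `Ad (W t)`. -/
theorem mul (hW : HasRightLogDeriv W a S t) (hV : HasRightLogDeriv V b S t) :
    HasRightLogDeriv (fun s => W s * V s) (a + AdL (W t) b) S t := by
  refine hasRightLogDeriv_of_hasTDerivWithinAt
    (HasTDerivWithinAt.tderiv_comp₂ hW hV (mdifferentiable_mul F _)) ?_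
  have h1 := DFunLike.congr_fun (tderiv_mul_right_comp (W t) (V t)) a
  have h2 := DFunLike.congr_fun (tderiv_mul_left_comp (W t) (V t)) b
  simp only [ContinuousLinearMap.comp_apply] at h1 h2
  simp [h1, h2]

theorem mul_const (hW : HasRightLogDeriv W a S t) (g : G) :
    HasRightLogDeriv (fun s => W s * g) a S t := by
  simpa using hW.mul (hasRightLogDeriv_const g S t)

theorem inv (hW : HasRightLogDeriv W a S t) :
    HasRightLogDeriv (fun s => (W s)⁻¹) (-AdL (W t)⁻¹ a) S t := by
  refine hasRightLogDeriv_of_hasTDerivWithinAt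
    (HasTDerivWithinAt.tderiv_comp hW (mdifferentiable_inv F (W t))) ?_
  simp [tderiv_inv_rightTranslateL]

/-- Reparametrization of a curve in `G`. -/
theorem comp {f : ℝ → ℝ} {c : ℝ} (hW : HasRightLogDeriv W a T (f t))
    (hf : HasDerivWithinAt f c S t) (hST : MapsTo f S T) :
    HasRightLogDeriv (fun s => W (f s)) (c • a) S t := by
  refine hasRightLogDeriv_of_hasTDerivWithinAt (HasTDerivWithinAt.comp hW
    (hasTDerivWithinAt_iff_hasFDerivWithinAt.2 hf.hasFDerivWithinAt) hST) ?_
  simp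

end HasRightLogDeriv

end LieCalculus

/-! ### Derivatives of charts and their inverses -/

section Charts

variable {H : Type*} [NormedAddCommGroup H] [NormedSpace ℝ H]
  {X : Type*} [TopologicalSpace X] [ChartedSpace H X] [IsManifold 𝓘(ℝ, H) ∞ X]

theorem extChartAt_self_mem_target (x : X) :
    extChartAt 𝓘(ℝ, H) x x ∈ (extChartAt 𝓘(ℝ, H) x).target := mem_extChartAt_target x

theorem mdifferentiableAt_extChartAt_of_mem {x y : X} (h : y ∈ (extChartAt 𝓘(ℝ, H) x).source) :
    MDifferentiableAt 𝓘(ℝ, H) 𝓘(ℝ, H) (extChartAt 𝓘(ℝ, H) x) y :=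
  mdifferentiableAt_extChartAt (by simpa using h)

theorem mdifferentiableAt_extChartAt_symm_of_mem {x : X} {y : H}
    (h : y ∈ (extChartAt 𝓘(ℝ, H) x).target) :
    MDifferentiableAt 𝓘(ℝ, H) 𝓘(ℝ, H) (extChartAt 𝓘(ℝ, H) x).symm y := by
  have := mdifferentiableWithinAt_extChartAt_symm h
  rwa [modelWithCornersSelf_coe, range_id, mdifferentiableWithinAt_univ] at this

theorem tderiv_extChartAt_self (x : X) :
    tderiv (extChartAt 𝓘(ℝ, H) x) x = ContinuousLinearMap.id ℝ H :=
  mfderiv_extChartAt_self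

theorem tderiv_extChartAt_comp_symm {x : X} {y : H} (h : y ∈ (extChartAt 𝓘(ℝ, H) x).target) :
    (tderiv (extChartAt 𝓘(ℝ, H) x) ((extChartAt 𝓘(ℝ, H) x).symm y) : H →L[ℝ] H).comp
      (tderiv (extChartAt 𝓘(ℝ, H) x).symm y) = ContinuousLinearMap.id ℝ H := by
  have := mfderiv_extChartAt_comp_mfderivWithin_extChartAt_symm h
  simp only [modelWithCornersSelf_coe, range_id, mfderivWithin_univ] at this
  exact this

theorem tderiv_extChartAt_symm_comp {x : X} {y : H} (h : y ∈ (extChartAt 𝓘(ℝ, H) x).target) :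
    (tderiv (extChartAt 𝓘(ℝ, H) x).symm y : H →L[ℝ] H).comp
      (tderiv (extChartAt 𝓘(ℝ, H) x) ((extChartAt 𝓘(ℝ, H) x).symm y)) =
        ContinuousLinearMap.id ℝ H := by
  have := mfderivWithin_extChartAt_symm_comp_mfderiv_extChartAt h
  simp only [modelWithCornersSelf_coe, range_id, mfderivWithin_univ] at this
  exact this

theorem tderiv_extChartAt_symm_self (x : X) :
    tderiv (extChartAt 𝓘(ℝ, H) x).symm (extChartAt 𝓘(ℝ, H) x x) = ContinuousLinearMap.id ℝ H := by
  have := tderiv_extChartAt_symm_comp (extChartAt_self_mem_target (H := H) x)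
  rwa [extChartAt_to_inv, tderiv_extChartAt_self, ContinuousLinearMap.comp_id] at this

theorem mpullbackWithin_univ_apply {H' : Type*} [NormedAddCommGroup H'] [NormedSpace ℝ H']
    {Y : Type*} [TopologicalSpace Y] [ChartedSpace H' Y] (f : X → Y) (V : Y → H') (x : X) :
    (VectorField.mpullbackWithin 𝓘(ℝ, H) 𝓘(ℝ, H') f V univ x : H) =
      (tderiv f x : H →L[ℝ] H').inverse (V (f x)) := by
  unfold tderiv VectorField.mpullbackWithin
  rw [← mfderivWithin_univ]
  rfl

theorem two_le_infty : (2 : WithTop ℕ∞) ≤ ∞ := by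
  exact ENat.LEInfty.out

theorem tderiv_eq_fderiv {H' : Type*} [NormedAddCommGroup H'] [NormedSpace ℝ H'] (f : H → H')
    (x : H) : tderiv f x = fderiv ℝ f x := mfderiv_eq_fderiv

end Charts

/-! ### The adjoint representation and its derivative -/

section Adjoint

variable {F : Type*} [NormedAddCommGroup F] [NormedSpace ℝ F]
  {G : Type*} [TopologicalSpace G] [ChartedSpace F G] [Group G] [LieGroup 𝓘(ℝ, F) ∞ G]

/-- Source and target points are all `1`, so the coordinate changes are derivatives of the chart at
`1` and of its inverse at the centre, both the identity. Smoothness of a derivative in tangent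
coordinates thereby becomes smoothness of `AdL` itself. -/
theorem inTangentCoordinates_one {u : G → G} (hu : ∀ g, u g = 1)
    (φ : G → F →L[ℝ] F) (g₀ : G) :
    inTangentCoordinates 𝓘(ℝ, F) 𝓘(ℝ, F) (fun _ : G => (1 : G)) u φ g₀ = φ := by
  obtain rfl : u = fun _ => 1 := funext hu
  funext g
  have h : inTangentCoordinates 𝓘(ℝ, F) 𝓘(ℝ, F) (fun _ : G => (1 : G)) (fun _ : G => (1 : G)) φ g₀ g = _ :=
    inTangentCoordinates_eq_mfderiv_comp (mem_chart_source F (1 : G)) (mem_chart_source F (1 : G))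
  have key : (tderiv (extChartAt 𝓘(ℝ, F) (1 : G)) (1 : G) : F →L[ℝ] F).comp ((φ g).comp
      (tderiv (Y := G) (extChartAt 𝓘(ℝ, F) (1 : G)).symm
        (show F from extChartAt 𝓘(ℝ, F) (1 : G) 1) : F →L[ℝ] F)) = φ g := by
    rw [tderiv_extChartAt_self, tderiv_extChartAt_symm_self]
    rfl
  rw [h]
  simp only [modelWithCornersSelf_coe, range_id, mfderivWithin_univ]
  exact key

-- `AdL g` is the partial derivative at `h = 1` of the jointly smooth map `(g, h) ↦ g * h * g⁻¹`.
variable (F G) in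
theorem contMDiff_AdL : ContMDiff 𝓘(ℝ, F) 𝓘(ℝ, F →L[ℝ] F) ∞ (AdL : G → F →L[ℝ] F) := by
  intro g₀
  have hm : ContMDiff ((𝓘(ℝ, F)).prod 𝓘(ℝ, F)) 𝓘(ℝ, F) ∞
      (Function.uncurry fun g h : G => g * h * g⁻¹) := by
    have h1 : ContMDiff ((𝓘(ℝ, F)).prod 𝓘(ℝ, F)) 𝓘(ℝ, F) ∞ (fun z : G × G => z.1) := contMDiff_fst
    have h2 : ContMDiff ((𝓘(ℝ, F)).prod 𝓘(ℝ, F)) 𝓘(ℝ, F) ∞ (fun z : G × G => z.2) := contMDiff_snd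
    exact (h1.mul h2).mul h1.inv
  have hone : ContMDiffAt 𝓘(ℝ, F) 𝓘(ℝ, F) ∞ (fun _ : G => (1 : G)) g₀ := contMDiffAt_const
  have := (hm (g₀, 1)).mfderiv (m := ∞) (fun g h : G => g * h * g⁻¹)
    (fun _ : G => (1 : G)) hone (by simp)
  have e := inTangentCoordinates_one (u := fun g : G => g * 1 * g⁻¹) (by simp)
    (AdL : G → F →L[ℝ] F) g₀
  rw [← e]
  exact this

variable (G) in
/-- The derivative of the adjoint action at the identity. -/
def adL : F →L[ℝ] F →L[ℝ] F := tderiv (AdL : G → F →L[ℝ] F) 1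

/-- Differentiate `Ad (h * g) = Ad h ∘ Ad g` at `h = 1`; composition with the fixed map `Ad g` is
the linear map `K`. -/
theorem tderiv_AdL_rightTranslateL (g : G) (a : F) :
    (tderiv (AdL : G → F →L[ℝ] F) g (rightTranslateL g a) : F →L[ℝ] F) =
      (adL G a).comp (AdL g) := by
  have hA := (contMDiff_AdL F G).mdifferentiable (by simp)
  have h1 := tderiv_comp (f := fun h : G => h * g) (x := 1) (one_mul g) (hA g)
    (mdifferentiable_mul_right F g 1)
  simp only [AdL_mul] at h1
  let K : (F →L[ℝ] F) →L[ℝ] (F →L[ℝ] F) := (ContinuousLinearMap.compL ℝ F F F).flip (AdL g)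
  have h2 := tderiv_comp (f := fun h : G => (AdL h : F →L[ℝ] F)) (x := (1 : G)) (g := K) rfl
    K.differentiableAt.mdifferentiableAt (hA 1)
  have h4 := DFunLike.congr_fun (h1.symm.trans h2) a
  rw [tderiv_eq_fderiv, K.hasFDerivAt.fderiv] at h4
  exact h4

theorem HasRightLogDeriv.AdL {W : ℝ → G} {a : F} {S : Set ℝ} {t : ℝ}
    (h : HasRightLogDeriv W a S t) :
    HasDerivWithinAt (fun s => (AdL (W s) : F →L[ℝ] F)) ((adL G a).comp (AdL (W t))) S t := by
  have := HasTDerivWithinAt.tderiv_comp h ((contMDiff_AdL F G).mdifferentiable (by simp) (W t))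
  rw [hasTDerivWithinAt_iff_hasFDerivWithinAt] at this
  rw [← tderiv_AdL_rightTranslateL]
  simpa using this.hasDerivWithinAt

theorem AdL_inv_comp (g : G) : (AdL g⁻¹ : F →L[ℝ] F).comp (AdL g) = ContinuousLinearMap.id ℝ F := by
  rw [← AdL_mul, inv_mul_cancel, AdL_one]

theorem AdL_comp_inv (g : G) : (AdL g : F →L[ℝ] F).comp (AdL g⁻¹) = ContinuousLinearMap.id ℝ F := by
  rw [← AdL_mul, mul_inv_cancel, AdL_one]

/-- Differentiate `Ad (g * h * g⁻¹) = Ad g ∘ Ad h ∘ Ad g⁻¹` at `h = 1`. -/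
theorem AdL_comp_adL (g : G) (a : F) :
    (AdL g).comp (adL G a) = (adL G (AdL g a)).comp (AdL g) := by
  have hA := (contMDiff_AdL F G).mdifferentiable (by simp)
  have h1 := tderiv_comp (f := fun h : G => g * h * g⁻¹) (x := 1) (by simp : g * 1 * g⁻¹ = 1)
    (hA 1) (mdifferentiable_conj F g 1)
  simp only [AdL_mul] at h1
  let K : (F →L[ℝ] F) →L[ℝ] (F →L[ℝ] F) :=
    ((ContinuousLinearMap.compL ℝ F F F).flip (AdL g⁻¹)).comp
      (ContinuousLinearMap.compL ℝ F F F (AdL g))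
  have h2 := tderiv_comp (f := fun h : G => (AdL h : F →L[ℝ] F)) (x := (1 : G)) (g := K) rfl
    K.differentiableAt.mdifferentiableAt (hA 1)
  have h4 := DFunLike.congr_fun (h1.symm.trans h2) a
  rw [tderiv_eq_fderiv, K.hasFDerivAt.fderiv] at h4
  have h5 : adL G (AdL g a) = ((AdL g).comp (adL G a)).comp (AdL g⁻¹) := h4
  rw [h5, ContinuousLinearMap.comp_assoc, AdL_inv_comp, ContinuousLinearMap.comp_id]

/-- Turns an equation in the group into a linear equation in `F →L[ℝ] F`. It serves both the
homotopy invariance of holonomy and the parameter dependence of parallel transport. -/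
theorem HasRightLogDeriv.AdL_inv {W : ℝ → G} {a : F} {S : Set ℝ} {t : ℝ}
    (h : HasRightLogDeriv W a S t) :
    HasDerivWithinAt (fun s => (HigherLoop.AdL (W s)⁻¹ : F →L[ℝ] F))
      (-(HigherLoop.AdL (W t)⁻¹).comp (adL G a)) S t := by
  have := h.inv.AdL
  rwa [map_neg, ContinuousLinearMap.neg_comp, ← AdL_comp_adL] at this

/-! ### The Lie bracket as the antisymmetrized second derivative of the multiplication -/

section Bracket

variable (F G) in
/-- The multiplication of `G` in the chart at the identity. -/
def chartMul (z : F × F) : F :=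
  extChartAt 𝓘(ℝ, F) (1 : G)
    ((extChartAt 𝓘(ℝ, F) (1 : G)).symm z.1 * (extChartAt 𝓘(ℝ, F) (1 : G)).symm z.2)

variable (F G) in
/-- The identity in the chart at the identity. -/
def chartOne : F := extChartAt 𝓘(ℝ, F) (1 : G) 1

variable (F G) in
theorem contDiffAt_chartMul : ContDiffAt ℝ ∞ (chartMul F G) (chartOne F G, chartOne F G) := by
  rw [← contMDiffAt_iff_contDiffAt]
  have hs : ContMDiffAt 𝓘(ℝ, F) 𝓘(ℝ, F) ∞ (extChartAt 𝓘(ℝ, F) (1 : G)).symm (chartOne F G) :=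
    contMDiffOn_extChartAt_symm (1 : G) |>.contMDiffAt
      (extChartAt_target_mem_nhds (1 : G))
  have hc : ContMDiffAt 𝓘(ℝ, F) 𝓘(ℝ, F) ∞ (extChartAt 𝓘(ℝ, F) (1 : G)) (1 : G) :=
    contMDiffAt_extChartAt
  have f1 : ContMDiffAt 𝓘(ℝ, F × F) 𝓘(ℝ, F) ∞
      (fun z : F × F => (extChartAt 𝓘(ℝ, F) (1 : G)).symm z.1) (chartOne F G, chartOne F G) :=
    hs.comp (chartOne F G, chartOne F G) contDiff_fst.contMDiff.contMDiffAt
  have f2 : ContMDiffAt 𝓘(ℝ, F × F) 𝓘(ℝ, F) ∞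
      (fun z : F × F => (extChartAt 𝓘(ℝ, F) (1 : G)).symm z.2) (chartOne F G, chartOne F G) :=
    hs.comp (chartOne F G, chartOne F G) contDiff_snd.contMDiff.contMDiffAt
  have e : (extChartAt 𝓘(ℝ, F) (1 : G)).symm (chartOne F G) = 1 := extChartAt_to_inv _
  refine ContMDiffAt.comp_of_eq hc (f1.mul f2) ?_
  rw [e, mul_one]

theorem tderiv_extChartAt_conj {u : G → G} (hu : MDifferentiableAt 𝓘(ℝ, F) 𝓘(ℝ, F) u 1)
    (hs : u 1 ∈ (extChartAt 𝓘(ℝ, F) (1 : G)).source) :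
    fderiv ℝ (fun x => extChartAt 𝓘(ℝ, F) (1 : G) (u ((extChartAt 𝓘(ℝ, F) (1 : G)).symm x)))
        (chartOne F G) =
      (tderiv (extChartAt 𝓘(ℝ, F) (1 : G)) (u 1) : F →L[ℝ] F).comp (tderiv u 1) := by
  have e : (extChartAt 𝓘(ℝ, F) (1 : G)).symm (chartOne F G) = 1 := extChartAt_to_inv _
  have h1 := mdifferentiableAt_extChartAt_symm_of_mem (extChartAt_self_mem_target (H := F) (1 : G))
  have h2 := mdifferentiableAt_extChartAt_of_mem hs
  rw [← tderiv_eq_fderiv,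
    tderiv_comp (f := (extChartAt 𝓘(ℝ, F) (1 : G)).symm) (x := chartOne F G)
      (g := fun x => extChartAt 𝓘(ℝ, F) (1 : G) (u x)) e (h2.comp 1 hu) h1,
    tderiv_comp (f := u) rfl h2 hu, chartOne, tderiv_extChartAt_symm_self,
    ContinuousLinearMap.comp_id]

/-- With one factor frozen at `y`, differentiation in the other factor at the identity yields the
left-invariant fields (first identity) and the right-invariant fields (second identity), both read
in the chart. -/
theorem eventually_chartMul_fderiv : ∀ᶠ y in 𝓝 (chartOne F G), ∀ ξ : F,
    fderiv ℝ (chartMul F G) (y, chartOne F G) (0, ξ) =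
      tderiv (extChartAt 𝓘(ℝ, F) (1 : G)) ((extChartAt 𝓘(ℝ, F) (1 : G)).symm y)
        (tderiv (fun h : G => (extChartAt 𝓘(ℝ, F) (1 : G)).symm y * h) 1 ξ : F) ∧
    fderiv ℝ (chartMul F G) (chartOne F G, y) (ξ, 0) =
      tderiv (extChartAt 𝓘(ℝ, F) (1 : G)) ((extChartAt 𝓘(ℝ, F) (1 : G)).symm y)
        (rightTranslateL ((extChartAt 𝓘(ℝ, F) (1 : G)).symm y) ξ : F) := by
  have hd : ∀ᶠ z in 𝓝 (chartOne F G, chartOne F G), DifferentiableAt ℝ (chartMul F G) z :=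
    ((contDiffAt_chartMul F G).of_le (m := 1) (by simp)).eventually (by simp) |>.mono
      fun z hz => hz.differentiableAt (by simp)
  have hc : ContinuousAt (fun y : F => (y, chartOne F G)) (chartOne F G) := by fun_prop
  have hc' : ContinuousAt (fun y : F => (chartOne F G, y)) (chartOne F G) := by fun_prop
  have e : (extChartAt 𝓘(ℝ, F) (1 : G)).symm (chartOne F G) = 1 := extChartAt_to_inv _
  have ht : ∀ᶠ y in 𝓝 (chartOne F G), y ∈ (extChartAt 𝓘(ℝ, F) (1 : G)).target :=
    extChartAt_target_mem_nhds _
  filter_upwards [hc.eventually hd, hc'.eventually hd, ht] with y hy hy' hyt ξ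
  have hs := (extChartAt 𝓘(ℝ, F) (1 : G)).map_target hyt
  constructor
  · have h1 := tderiv_extChartAt_conj (F := F)
      (u := fun h : G => (extChartAt 𝓘(ℝ, F) (1 : G)).symm y * h)
      (mdifferentiable_mul_left F _ 1) (by rwa [mul_one])
    have h2 := (hy.hasFDerivAt.comp (chartOne F G)
      (hasFDerivAt_prodMk_right y (chartOne F G))).fderiv
    rw [mul_one] at h1
    exact (DFunLike.congr_fun h2 ξ).symm.trans (DFunLike.congr_fun h1 ξ)
  · have h1 := tderiv_extChartAt_conj (F := F)
      (u := fun h : G => h * (extChartAt 𝓘(ℝ, F) (1 : G)).symm y)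
      (mdifferentiable_mul_right F _ 1) (by rwa [one_mul])
    have h2 := (HasFDerivAt.comp (𝕜 := ℝ) (chartOne F G) hy'.hasFDerivAt
      (hasFDerivAt_prodMk_left (chartOne F G) y)).fderiv
    rw [one_mul] at h1
    exact (DFunLike.congr_fun h2 ξ).symm.trans (DFunLike.congr_fun h1 ξ)

/-- In the chart the left-invariant field of `v` is `y ↦ ∂₂m(y, e) v`, with `m` the multiplication.
Its derivative at `e` is a mixed second derivative of `m`, and the bracket of two fields `X`, `Y` is
`DY(X) - DX(Y)`. -/
theorem bracket_eq_fderiv (a b : F) :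
    bracket G a b =
      fderiv ℝ (fderiv ℝ (chartMul F G)) (chartOne F G, chartOne F G) (a, 0) (0, b) -
        fderiv ℝ (fderiv ℝ (chartMul F G)) (chartOne F G, chartOne F G) (b, 0) (0, a) := by
  set φ := extChartAt 𝓘(ℝ, F) (1 : G) with hφ
  set e := chartOne F G with he
  have ht : ∀ᶠ y in 𝓝 (chartOne F G), y ∈ φ.target := extChartAt_target_mem_nhds _
  -- the left-invariant fields in the chart
  have hX : ∀ v : F, VectorField.mpullbackWithin 𝓘(ℝ, F) 𝓘(ℝ, F) φ.symm
      (fun g : G => (tderiv (fun h : G => g * h) 1 v : F)) univ =ᶠ[𝓝 e]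
        fun y => fderiv ℝ (chartMul F G) (y, e) (0, v) := by
    intro v
    filter_upwards [eventually_chartMul_fderiv (F := F) (G := G), ht] with y hy hyt
    refine Eq.trans ?_ (hy v).1.symm
    refine (mpullbackWithin_univ_apply _ _ _).trans ?_
    have h1 := tderiv_extChartAt_symm_comp hyt
    have h2 := tderiv_extChartAt_comp_symm hyt
    have h3 := ContinuousLinearMap.inverse_eq h1 h2
    exact DFunLike.congr_fun h3 (tderiv (fun h : G => φ.symm y * h) 1 v)
  have hD : DifferentiableAt ℝ (fderiv ℝ (chartMul F G)) (e, e) :=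
    ((contDiffAt_chartMul F G).fderiv_right (m := ∞) (by simp)).differentiableAt (by simp)
  have hd : ∀ v w : F, fderiv ℝ (fun y => fderiv ℝ (chartMul F G) (y, e) (0, v)) e w =
      fderiv ℝ (fderiv ℝ (chartMul F G)) (e, e) (w, 0) (0, v) := by
    intro v w
    have h1 := HasFDerivAt.comp (𝕜 := ℝ) (f := fun y => (y, e)) e hD.hasFDerivAt
      (hasFDerivAt_prodMk_left e e)
    have h2 := h1.clm_apply (hasFDerivAt_const ((0 : F), v) e)
    exact (DFunLike.congr_fun h2.fderiv w).trans (by simp)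
  have he' : ∀ v : F, fderiv ℝ (chartMul F G) (e, e) (0, v) = v := by
    intro v
    have h1 := (eventually_chartMul_fderiv (F := F) (G := G)).self_of_nhds v
    have h2 : (extChartAt 𝓘(ℝ, F) (1 : G)).symm (chartOne F G) = 1 := extChartAt_to_inv _
    rw [h2] at h1
    simp only [one_mul, tderiv_id, tderiv_extChartAt_self] at h1
    exact h1.1
  have h1 : bracket G a b = VectorField.lieBracket ℝ
      (fun y => fderiv ℝ (chartMul F G) (y, e) (0, a))
      (fun y => fderiv ℝ (chartMul F G) (y, e) (0, b)) e := by
    have h2 := Filter.EventuallyEq.lieBracketWithin_vectorField_eq_nhds (𝕜 := ℝ) (hX a) (hX b)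
      (s := univ)
    have h3 : bracket G a b =
        (tderiv (extChartAt 𝓘(ℝ, F) (1 : G)) (1 : G) : F →L[ℝ] F).inverse
          (VectorField.lieBracketWithin ℝ
            (VectorField.mpullbackWithin 𝓘(ℝ, F) 𝓘(ℝ, F) φ.symm
              (fun g : G => (tderiv (fun h : G => g * h) 1 a : F)) (range 𝓘(ℝ, F)))
            (VectorField.mpullbackWithin 𝓘(ℝ, F) 𝓘(ℝ, F) φ.symm
              (fun g : G => (tderiv (fun h : G => g * h) 1 b : F)) (range 𝓘(ℝ, F)))
            (φ.symm ⁻¹' univ ∩ range 𝓘(ℝ, F)) e) := VectorField.mlieBracketWithin_apply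
    -- The chart has the identity as derivative at its centre, so the transfer of the bracket back
    -- to the group disappears.
    rw [tderiv_extChartAt_self] at h3
    simp only [modelWithCornersSelf_coe, range_id, preimage_univ, inter_univ] at h3
    rw [h3, ← VectorField.lieBracketWithin_univ, ← h2]
    simp only [ContinuousLinearMap.inverse_id]
    rfl
  rw [h1, VectorField.lieBracket, hd, hd, he', he']

/-- The derivative of the adjoint action is the bracket of the Lie algebra. -/
theorem adL_eq_bracket (a b : F) : adL G a b = bracket G a b := by
  set e := chartOne F G with he
  have e1 : (extChartAt 𝓘(ℝ, F) (1 : G)).symm e = 1 := extChartAt_to_inv _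
  set D := fderiv ℝ (fderiv ℝ (chartMul F G)) (e, e) with hDdef
  have hD : HasFDerivAt (fderiv ℝ (chartMul F G)) D (e, e) :=
    (((contDiffAt_chartMul F G).fderiv_right (m := ∞) (by simp)).differentiableAt
      (by simp)).hasFDerivAt
  have hsymm : D (a, 0) (0, b) = D (0, b) (a, 0) :=
    ((contDiffAt_chartMul F G).isSymmSndFDerivAt (by simpa using two_le_infty)) _ _
  have hsymm' : D (b, 0) (0, a) = D (0, a) (b, 0) :=
    ((contDiffAt_chartMul F G).isSymmSndFDerivAt (by simpa using two_le_infty)) _ _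
  have hA := (contMDiff_AdL F G).mdifferentiable (by simp)
  have hs := mdifferentiableAt_extChartAt_symm_of_mem (extChartAt_self_mem_target (H := F) (1 : G))
  have hAe : HasFDerivAt (fun y : F => (AdL ((extChartAt 𝓘(ℝ, F) (1 : G)).symm y) : F →L[ℝ] F))
      (adL G) e := by
    have h := tderiv_comp (f := (extChartAt 𝓘(ℝ, F) (1 : G)).symm) e1 (hA 1) hs
    have h' := tderiv_extChartAt_symm_self (H := F) (1 : G)
    have h2 : MDifferentiableAt 𝓘(ℝ, F) 𝓘(ℝ, F →L[ℝ] F)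
      (fun y : F => (AdL ((extChartAt 𝓘(ℝ, F) (1 : G)).symm y) : F →L[ℝ] F)) e :=
      MDifferentiableAt.comp e (hA _) hs
    have h3 := (mdifferentiableAt_iff_differentiableAt.1 h2).hasFDerivAt
    rw [← tderiv_eq_fderiv, h] at h3
    rwa [show tderiv (extChartAt 𝓘(ℝ, F) (1 : G)).symm e = ContinuousLinearMap.id ℝ F from h',
      ContinuousLinearMap.comp_id] at h3
  -- The identity `g h = (g h g⁻¹) g`: the left-invariant field of `b` at `g` is the right-invariant
  -- field of `Ad g b`. Its derivative at `e` along `a` reads `D (0, a) (b, 0) + ad a b = D (a, 0)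
  -- (0, b)`, and the symmetry of `D` turns this into the bracket.
  have hid : (fun y => fderiv ℝ (chartMul F G) (e, y)
      (AdL ((extChartAt 𝓘(ℝ, F) (1 : G)).symm y) b, 0)) =ᶠ[𝓝 e]
      fun y => fderiv ℝ (chartMul F G) (y, e) (0, b) := by
    filter_upwards [eventually_chartMul_fderiv (F := F) (G := G)] with y hy
    rw [(hy _).1, (hy _).2]
    have := DFunLike.congr_fun (tderiv_mul_left_comp ((extChartAt 𝓘(ℝ, F) (1 : G)).symm y) 1) b
    simp only [rightTranslateL_one, ContinuousLinearMap.comp_id, mul_one] at this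
    rw [this]
    rfl
  have hl : HasFDerivAt (fun y => fderiv ℝ (chartMul F G) (y, e) (0, b)) _ e :=
    (HasFDerivAt.comp (𝕜 := ℝ) (f := fun y => (y, e)) e hD (hasFDerivAt_prodMk_left e e)).clm_apply
      (hasFDerivAt_const ((0 : F), b) e)
  have hr : HasFDerivAt (fun y => fderiv ℝ (chartMul F G) (e, y)
      (AdL ((extChartAt 𝓘(ℝ, F) (1 : G)).symm y) b, 0)) _ e :=
    (HasFDerivAt.comp (𝕜 := ℝ) e hD (hasFDerivAt_prodMk_right e e)).clm_apply
      ((hAe.clm_apply (hasFDerivAt_const b e)).prodMk (hasFDerivAt_const (0 : F) e))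
  have h := DFunLike.congr_fun (hr.unique (hl.congr_of_eventuallyEq hid)) a
  have hone : ∀ v : F, fderiv ℝ (chartMul F G) (e, e) (v, 0) = v := by
    intro v
    have h1 := (eventually_chartMul_fderiv (F := F) (G := G)).self_of_nhds v
    rw [← he, e1] at h1
    simp only [rightTranslateL_one, tderiv_extChartAt_self] at h1
    exact h1.2
  rw [e1, AdL_one] at h
  simp [hone] at h
  rw [bracket_eq_fderiv, ← he, ← hDdef, hsymm', ← h]
  abel

end Bracket

end Adjoint

/-! ### Curves with vanishing derivative, and gluing of curves -/

section ZeroDerivative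

variable {H : Type*} [NormedAddCommGroup H] [NormedSpace ℝ H]
  {Y : Type*} [TopologicalSpace Y] [ChartedSpace H Y] [IsManifold 𝓘(ℝ, H) ∞ Y]

/-- A curve in a manifold with vanishing derivative on an interval is constant there. -/
theorem eq_of_hasTDerivWithinAt_zero {a b : ℝ} {f : ℝ → Y}
    (h : ∀ t ∈ Icc a b, HasTDerivWithinAt f (0 : ℝ →L[ℝ] H) (Icc a b) t)
    {s t : ℝ} (hs : s ∈ Icc a b) (ht : t ∈ Icc a b) : f s = f t := by
  -- By connectedness local constancy suffices. Near `x` the curve stays in one chart, where the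
  -- mean value inequality applies with constant `0`.
  refine isPreconnected_Icc.induction₂ (fun s t => f s = f t) ?_
    (fun x y z _ _ _ h1 h2 => h1.trans h2) (fun x y _ _ h1 => h1.symm) hs ht
  intro x hx
  have hc : ∀ᶠ y in 𝓝[Icc a b] x, f y ∈ (extChartAt 𝓘(ℝ, H) (f x)).source :=
    (h x hx).continuousWithinAt (extChartAt_source_mem_nhds (f x))
  obtain ⟨δ, hδ, hball⟩ := Metric.mem_nhdsWithin_iff.1 hc
  have hd : ∀ y ∈ Metric.ball x δ ∩ Icc a b, HasFDerivWithinAt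
      (fun y => extChartAt 𝓘(ℝ, H) (f x) (f y)) (0 : ℝ →L[ℝ] H) (Metric.ball x δ ∩ Icc a b) y := by
    intro y hy
    have h1 := ((h y hy.2).mono (show Metric.ball x δ ∩ Icc a b ⊆ Icc a b from inter_subset_right)).tderiv_comp
      (mdifferentiableAt_extChartAt_of_mem (x := f x) (hball hy))
    rw [ContinuousLinearMap.comp_zero] at h1
    exact hasTDerivWithinAt_iff_hasFDerivWithinAt.1 h1
  have hconv : Convex ℝ (Metric.ball x δ ∩ Icc a b) := (convex_ball x δ).inter (convex_Icc a b)
  filter_upwards [Metric.mem_nhdsWithin_iff.2 ⟨δ, hδ, Subset.rfl⟩] with y hy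
  have h2 := hconv.norm_image_sub_le_of_norm_hasFDerivWithin_le (C := 0)
    hd (fun _ _ => by simp) ⟨Metric.mem_ball_self hδ, hx⟩ hy
  rw [zero_mul] at h2
  have h3 := sub_eq_zero.1 (norm_le_zero_iff.1 h2)
  exact ((extChartAt 𝓘(ℝ, H) (f x)).injOn (hball hy) (hball ⟨Metric.mem_ball_self hδ, hx⟩) h3).symm

/-- Gluing of two curves at a common end point. -/
theorem hasTDerivWithinAt_glue {a b c : ℝ} (hab : a ≤ b) (hbc : b ≤ c) {f₁ f₂ : ℝ → Y}
    {L : ℝ →L[ℝ] H} {t : ℝ} (h₁ : t ∈ Icc a b → HasTDerivWithinAt f₁ L (Icc a b) t)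
    (h₂ : t ∈ Icc b c → HasTDerivWithinAt f₂ L (Icc b c) t) (e : f₁ b = f₂ b)
    (ht : t ∈ Icc a c) :
    HasTDerivWithinAt (fun t => if t ≤ b then f₁ t else f₂ t) L (Icc a c) t := by
  have h₁' : t ∈ Icc a b → HasTDerivWithinAt (fun t => if t ≤ b then f₁ t else f₂ t) L
      (Icc a b) t := fun ht =>
    (h₁ ht).congr (fun s hs => if_pos hs.2) (if_pos ht.2)
  have h₂' : t ∈ Icc b c → HasTDerivWithinAt (fun t => if t ≤ b then f₁ t else f₂ t) L
      (Icc b c) t := by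
    have : ∀ s ∈ Icc b c, (if s ≤ b then f₁ s else f₂ s) = f₂ s := by
      intro s hs
      split_ifs with h
      · rw [le_antisymm h hs.1, e]
      · rfl
    exact fun ht => (h₂ ht).congr this (this t ht)
  rcases lt_trichotomy t b with h | rfl | h
  · refine HasMFDerivWithinAt.mono_of_mem_nhdsWithin (h₁' ⟨ht.1, h.le⟩) ?_
    filter_upwards [self_mem_nhdsWithin, mem_nhdsWithin_of_mem_nhds (Iio_mem_nhds h)] with s hs hs'
      using ⟨hs.1, hs'.le⟩
  · rw [← Icc_union_Icc_eq_Icc hab hbc]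
    exact (h₁' ⟨hab, le_rfl⟩).union (h₂' ⟨le_rfl, hbc⟩)
  · refine HasMFDerivWithinAt.mono_of_mem_nhdsWithin (h₂' ⟨h.le, ht.2⟩) ?_
    filter_upwards [self_mem_nhdsWithin, mem_nhdsWithin_of_mem_nhds (Ioi_mem_nhds h)] with s hs hs'
      using ⟨hs'.le, hs.2⟩

end ZeroDerivative

/-! ### The equation `W' = a W` in a Lie group -/

section ODE

variable {F : Type*} [NormedAddCommGroup F] [NormedSpace ℝ F]

/-- Picard-Lindelöf for `v' = R(v) b(t)`. The speed is at most `C * B`, so `hsmall` keeps the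
solution in the ball on which `R` is controlled. -/
theorem exists_hasDerivWithinAt_clm [CompleteSpace F] {R : F → F →L[ℝ] F} {e : F} {r C : ℝ}
    {K : NNReal} (hr : 0 ≤ r) (hC : 0 ≤ C) (hR : LipschitzOnWith K R (Metric.closedBall e r))
    (hRC : ∀ y ∈ Metric.closedBall e r, ‖R y‖ ≤ C) {t₀ t₁ B : ℝ} (ht : t₀ ≤ t₁) {b : ℝ → F}
    (hb : ContinuousOn b (Icc t₀ t₁)) (hB : ∀ t ∈ Icc t₀ t₁, ‖b t‖ ≤ B)
    (hsmall : C * B * (t₁ - t₀) ≤ r) :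
    ∃ v : ℝ → F, v t₀ = e ∧ (∀ t, v t ∈ Metric.closedBall e r) ∧
      ∀ t ∈ Icc t₀ t₁, HasDerivWithinAt v (R (v t) (b t)) (Icc t₀ t₁) t := by
  have hB0 : 0 ≤ B := (norm_nonneg _).trans (hB t₀ ⟨le_rfl, ht⟩)
  lift r to NNReal using hr
  lift B to NNReal using hB0
  lift C to NNReal using hC
  set τ₀ : Icc t₀ t₁ := ⟨t₀, left_mem_Icc.2 ht⟩ with hτ₀
  have hf : IsPicardLindelof (fun t y => R y (b t)) τ₀ e r 0 (C * B) (K * B) := by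
    refine ⟨fun t ht => ?_, fun y _ => ?_, fun t ht y hy => ?_, ?_⟩
    · refine LipschitzOnWith.of_dist_le_mul fun x hx y hy => ?_
      rw [dist_eq_norm, ← sub_apply]
      have h1 := hR.dist_le_mul x hx y hy
      rw [dist_eq_norm] at h1
      calc ‖(R x - R y) (b t)‖ ≤ ‖R x - R y‖ * ‖b t‖ := ContinuousLinearMap.le_opNorm _ _
        _ ≤ (K * dist x y) * B := by gcongr; exact hB t ht
        _ = _ := by push_cast; ring
    · exact (R y).continuous.comp_continuousOn hb
    · calc ‖R y (b t)‖ ≤ ‖R y‖ * ‖b t‖ := ContinuousLinearMap.le_opNorm _ _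
        _ ≤ C * B := by gcongr; exacts [hRC y hy, hB t ht]
    · have : max (t₁ - (τ₀ : ℝ)) (τ₀ - t₀) = t₁ - t₀ := by
        rw [hτ₀]; simpa using ht
      rw [this]
      simpa using hsmall
  have hx : e ∈ Metric.closedBall e ((0 : NNReal) : ℝ) := by simp
  -- The fixed point of the Picard iteration is used directly, since membership in `ODE.FunSpace`
  -- keeps its values in the ball for all `t`.
  obtain ⟨α, hα⟩ := ODE.FunSpace.exists_isFixedPt_next hf hx
  have hv : ∀ t ∈ Icc t₀ t₁,
      α.compProj t = ODE.picard (fun t y => R y (b t)) t₀ e α.compProj t := fun t ht' => by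
    have h1 := ODE.FunSpace.next_apply hf hx α (t := ⟨t, ht'⟩)
    rw [hα] at h1
    rw [ODE.FunSpace.compProj_apply, projIcc_of_mem _ ht', h1]
  have hmem : ∀ t, α.compProj t ∈ Metric.closedBall e r := fun t =>
    α.compProj_mem_closedBall hf.mul_max_le
  refine ⟨α.compProj, ?_, hmem, fun t ht' => ?_⟩
  · rw [hv t₀ ⟨le_rfl, ht⟩, ODE.picard_apply₀]
  · have hcont : ContinuousOn (Function.uncurry fun t y => R y (b t))
        (Icc t₀ t₁ ×ˢ Metric.closedBall e r) := by
      have h1 : ContinuousOn (fun z : ℝ × F => R z.2) (Icc t₀ t₁ ×ˢ Metric.closedBall e r) :=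
        hR.continuousOn.comp continuousOn_snd fun z hz => hz.2
      have h2 : ContinuousOn (fun z : ℝ × F => b z.1) (Icc t₀ t₁ ×ˢ Metric.closedBall e r) :=
        hb.comp continuousOn_fst fun z hz => hz.1
      exact h1.clm_apply h2
    exact (ODE.hasDerivWithinAt_picard_Icc ⟨le_rfl, ht⟩ hcont
      α.continuous_compProj.continuousOn (fun t _ => hmem t) e ht').congr hv (hv t ht')

/-- Since `R e = id`, the difference `v' - b` is `(R v - R e) b`. It is at most `K * ‖v - e‖ * B`,
and `‖v - e‖` is itself at most `C * B * (t₁ - t₀)`; integration gives an error quadratic in `B *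
(t₁ - t₀)`. -/
theorem norm_sub_integral_le [CompleteSpace F] {R : F → F →L[ℝ] F} {e : F} {r C : ℝ}
    {K : NNReal} (hR : LipschitzOnWith K R (Metric.closedBall e r)) (hC : 0 ≤ C)
    (hr : 0 ≤ r) (hRC : ∀ y ∈ Metric.closedBall e r, ‖R y‖ ≤ C)
    (hRe : R e = ContinuousLinearMap.id ℝ F) {t₀ t₁ B : ℝ} (ht : t₀ ≤ t₁) {b v : ℝ → F}
    (hb : ContinuousOn b (Icc t₀ t₁)) (hB : ∀ t ∈ Icc t₀ t₁, ‖b t‖ ≤ B)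
    (hv0 : v t₀ = e) (hvr : ∀ t, v t ∈ Metric.closedBall e r)
    (hv : ∀ t ∈ Icc t₀ t₁, HasDerivWithinAt v (R (v t) (b t)) (Icc t₀ t₁) t) :
    ‖v t₁ - e - ∫ t in t₀..t₁, b t‖ ≤ K * C * (B * (t₁ - t₀)) ^ 2 := by
  have hB0 : 0 ≤ B := (norm_nonneg _).trans (hB t₀ ⟨le_rfl, ht⟩)
  have hvd : ∀ t ∈ Icc t₀ t₁, ‖v t - e‖ ≤ C * B * (t₁ - t₀) := by
    intro t ht'
    rw [← hv0]
    refine ((convex_Icc t₀ t₁).norm_image_sub_le_of_norm_hasDerivWithin_le (C := C * B) hv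
      (fun t ht => ?_) ⟨le_rfl, ht⟩ ht').trans ?_
    · calc ‖R (v t) (b t)‖ ≤ ‖R (v t)‖ * ‖b t‖ := ContinuousLinearMap.le_opNorm _ _
        _ ≤ C * B := by gcongr; exacts [hRC _ (hvr t), hB t ht]
    · rw [Real.norm_of_nonneg (sub_nonneg.2 ht'.1)]
      gcongr
      exact ht'.2
  have hvc : ContinuousOn v (Icc t₀ t₁) := fun t ht => (hv t ht).continuousWithinAt
  have hRv : ContinuousOn (fun t => R (v t) (b t)) (Icc t₀ t₁) :=
    (hR.continuousOn.comp hvc fun t _ => hvr t).clm_apply hb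
  have hi : ∫ t in t₀..t₁, R (v t) (b t) = v t₁ - v t₀ :=
    intervalIntegral.integral_eq_sub_of_hasDerivAt_of_le ht hvc
      (fun t ht => (hv t ⟨ht.1.le, ht.2.le⟩).hasDerivAt (Icc_mem_nhds ht.1 ht.2))
      (hRv.intervalIntegrable_of_Icc ht)
  rw [← hv0, ← hi, ← intervalIntegral.integral_sub (hRv.intervalIntegrable_of_Icc ht)
    (hb.intervalIntegrable_of_Icc ht)]
  refine (intervalIntegral.norm_integral_le_of_norm_le_const
    (C := K * (C * B * (t₁ - t₀)) * B) fun t ht' => ?_).trans (le_of_eq ?_)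
  · rw [uIoc_of_le ht] at ht'
    have ht'' : t ∈ Icc t₀ t₁ := ⟨ht'.1.le, ht'.2⟩
    have h1 : R (v t) (b t) - b t = (R (v t) - R e) (b t) := by rw [hRe]; simp
    have h2 := hR.dist_le_mul (v t) (hvr t) e (Metric.mem_closedBall_self hr)
    rw [dist_eq_norm, dist_eq_norm] at h2
    rw [h1]
    calc ‖(R (v t) - R e) (b t)‖ ≤ ‖R (v t) - R e‖ * ‖b t‖ := ContinuousLinearMap.le_opNorm _ _
      _ ≤ (K * (C * B * (t₁ - t₀))) * B := by
        have h3 : 0 ≤ t₁ - t₀ := sub_nonneg.2 ht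
        refine mul_le_mul (h2.trans ?_) (hB t ht'') (norm_nonneg _) (by positivity)
        exact mul_le_mul_of_nonneg_left (hvd t ht'') K.2
  · rw [abs_of_nonneg (sub_nonneg.2 ht)]
    ring

variable {G : Type*} [TopologicalSpace G] [ChartedSpace F G] [Group G] [LieGroup 𝓘(ℝ, F) ∞ G]

variable (G) in
/-- The right-invariant fields of `G` in the chart at the identity. -/
def chartField (y : F) : F →L[ℝ] F :=
  (fderiv ℝ (chartMul F G) (chartOne F G, y)).comp (ContinuousLinearMap.inl ℝ F F)

theorem contDiffAt_chartField : ContDiffAt ℝ ∞ (chartField G) (chartOne F G) := by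
  have h1 : ContDiffAt ℝ ∞ (fun y => fderiv ℝ (chartMul F G) (chartOne F G, y)) (chartOne F G) :=
    ContDiffAt.comp (chartOne F G)
      ((contDiffAt_chartMul F G).fderiv_right (m := ∞) (by simp))
      (contDiffAt_const.prodMk contDiffAt_id)
  exact h1.clm_comp contDiffAt_const

/-- Defining `chartField` by a derivative of the multiplication makes its smoothness immediate; here
it is recognized, near the identity, as right translation read in the chart. -/
theorem chartField_eventually : ∀ᶠ y in 𝓝 (chartOne F G), chartField G y =
    (tderiv (extChartAt 𝓘(ℝ, F) (1 : G)) ((extChartAt 𝓘(ℝ, F) (1 : G)).symm y) : F →L[ℝ] F).comp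
      (rightTranslateL ((extChartAt 𝓘(ℝ, F) (1 : G)).symm y)) := by
  filter_upwards [eventually_chartMul_fderiv (F := F) (G := G)] with y hy
  ext ξ
  exact (hy ξ).2

theorem chartField_one : chartField G (chartOne F G) = ContinuousLinearMap.id ℝ F := by
  rw [(chartField_eventually (F := F) (G := G)).self_of_nhds,
    show (extChartAt 𝓘(ℝ, F) (1 : G)).symm (chartOne F G) = 1 from extChartAt_to_inv _,
    rightTranslateL_one, tderiv_extChartAt_self]
  rfl

theorem HasRightLogDeriv.glue {a b c : ℝ} (hab : a ≤ b) (hbc : b ≤ c) {W V : ℝ → G} {p : ℝ → F}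
    (hW : ∀ t ∈ Icc a b, HasRightLogDeriv W (p t) (Icc a b) t)
    (hV : ∀ t ∈ Icc b c, HasRightLogDeriv V (p t) (Icc b c) t) (e : W b = V b)
    {t : ℝ} (ht : t ∈ Icc a c) :
    HasRightLogDeriv (fun t => if t ≤ b then W t else V t) (p t) (Icc a c) t := by
  refine hasTDerivWithinAt_glue (f₁ := W) (f₂ := V) hab hbc (fun ht => ?_) (fun ht => ?_) e ht
  · simp only [ht.2, if_true]; exact hW t ht
  · have : (if t ≤ b then W t else V t) = V t := by
      split_ifs with h
      · rw [le_antisymm h ht.1, ← e]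
      · rfl
    simp only [this]; exact hV t ht

variable [CompleteSpace F]

variable (F G) in
/-- Local solutions of `V' = b V`, with an estimate to second order. -/
theorem exists_local_solution : ∃ ρ > (0 : ℝ), ∃ C : ℝ, 0 ≤ C ∧ ∀ (t₀ t₁ B : ℝ) (b : ℝ → F),
    t₀ ≤ t₁ → ContinuousOn b (Icc t₀ t₁) → (∀ t ∈ Icc t₀ t₁, ‖b t‖ ≤ B) → B * (t₁ - t₀) ≤ ρ →
    ∃ V : ℝ → G, V t₀ = 1 ∧ (∀ t ∈ Icc t₀ t₁, HasRightLogDeriv V (b t) (Icc t₀ t₁) t) ∧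
      V t₁ ∈ (extChartAt 𝓘(ℝ, F) (1 : G)).source ∧
      ‖extChartAt 𝓘(ℝ, F) (1 : G) (V t₁) - chartOne F G - ∫ t in t₀..t₁, b t‖ ≤
        C * (B * (t₁ - t₀)) ^ 2 := by
  obtain ⟨K, T, hT, hK⟩ :=
    ((contDiffAt_chartField (F := F) (G := G)).of_le (m := 1) (by simp)).exists_lipschitzOnWith
  have ht : ∀ᶠ y in 𝓝 (chartOne F G), y ∈ (extChartAt 𝓘(ℝ, F) (1 : G)).target :=
    extChartAt_target_mem_nhds _
  obtain ⟨r, hr, hball⟩ := Metric.nhds_basis_closedBall.mem_iff.1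
    (Filter.inter_mem hT (ht.and (chartField_eventually (F := F) (G := G))))
  have hR : LipschitzOnWith K (chartField G) (Metric.closedBall (chartOne F G) r) :=
    hK.mono fun y hy => (hball hy).1
  -- The field is the identity at the centre and `K`-Lipschitz on a ball of radius `r`, which bounds
  -- it by `K * r + 1`.
  set C : ℝ := K * r + 1 with hCdef
  have hC : 0 < C := by positivity
  have hRC : ∀ y ∈ Metric.closedBall (chartOne F G) r, ‖chartField G y‖ ≤ C := by
    intro y hy
    have h1 := hR.dist_le_mul y hy _ (Metric.mem_closedBall_self hr.le)
    rw [dist_eq_norm, chartField_one] at h1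
    calc ‖chartField G y‖ ≤ ‖chartField G y - ContinuousLinearMap.id ℝ F‖ +
          ‖ContinuousLinearMap.id ℝ F‖ := by
          simpa using norm_add_le (chartField G y - ContinuousLinearMap.id ℝ F)
            (ContinuousLinearMap.id ℝ F)
      _ ≤ K * r + 1 := add_le_add (h1.trans (by gcongr; exact hy))
          ContinuousLinearMap.norm_id_le
  -- With `ρ = r / C`, the hypothesis `B * (t₁ - t₀) ≤ ρ` says exactly that the solution cannot
  -- leave the ball.
  refine ⟨r / C, by positivity, K * C, by positivity, fun t₀ t₁ B b h01 hb hB hs => ?_⟩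
  obtain ⟨v, hv0, hvr, hv⟩ := exists_hasDerivWithinAt_clm hr.le hC.le hR hRC h01 hb hB
    (by rw [le_div_iff₀ hC] at hs; linarith)
  have hve := norm_sub_integral_le hR hC.le hr.le hRC chartField_one h01 hb hB hv0 hvr hv
  have htar : ∀ t, v t ∈ (extChartAt 𝓘(ℝ, F) (1 : G)).target := fun t => (hball (hvr t)).2.1
  refine ⟨fun t => (extChartAt 𝓘(ℝ, F) (1 : G)).symm (v t), ?_, fun t ht' => ?_, ?_, ?_⟩
  · simp only [hv0]
    exact extChartAt_to_inv _
  · refine hasRightLogDeriv_of_hasTDerivWithinAt (HasTDerivWithinAt.tderiv_comp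
      (hasTDerivWithinAt_iff_hasFDerivWithinAt.2 (hv t ht').hasFDerivWithinAt)
      (mdifferentiableAt_extChartAt_symm_of_mem (htar t))) ?_
    have h1 := DFunLike.congr_fun (tderiv_extChartAt_symm_comp (htar t))
      (rightTranslateL ((extChartAt 𝓘(ℝ, F) (1 : G)).symm (v t)) (b t))
    have h2 : chartField G (v t) = _ := (hball (hvr t)).2.2
    simp only [ContinuousLinearMap.comp_apply, h2]
    simpa using h1
  · exact (extChartAt 𝓘(ℝ, F) (1 : G)).map_target (htar _)
  · rwa [(extChartAt 𝓘(ℝ, F) (1 : G)).right_inv (htar _)]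

/-- Existence of solutions of `W' = a W` on a compact interval. -/
theorem exists_hasRightLogDeriv_Icc {t₀ t₁ : ℝ} (h01 : t₀ ≤ t₁) {a : ℝ → F}
    (ha : ContinuousOn a (Icc t₀ t₁)) (g₀ : G) :
    ∃ W : ℝ → G, W t₀ = g₀ ∧ ∀ t ∈ Icc t₀ t₁, HasRightLogDeriv W (a t) (Icc t₀ t₁) t := by
  obtain ⟨ρ, hρ, C, hC, hloc⟩ := exists_local_solution F G
  obtain ⟨B, hB⟩ := isCompact_Icc.exists_bound_of_continuousOn ha
  -- Right translates of solutions are solutions, so the admissible step length does not depend on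
  -- the point reached and finitely many steps cover the interval.
  have key : ∀ n : ℕ, ∀ t₁' ∈ Icc t₀ t₁, B * (t₁' - t₀) ≤ n * ρ →
      ∃ W : ℝ → G, W t₀ = g₀ ∧ ∀ t ∈ Icc t₀ t₁', HasRightLogDeriv W (a t) (Icc t₀ t₁') t := by
    intro n
    induction n with
    | zero =>
      intro t' ht' hn
      obtain ⟨V, hV0, hV, -⟩ := hloc t₀ t' B a ht'.1 (ha.mono (Icc_subset_Icc_right ht'.2))
        (fun t ht => hB t ⟨ht.1, ht.2.trans ht'.2⟩) (by push_cast at hn; linarith)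
      exact ⟨fun t => V t * g₀, by simp [hV0], fun t ht => (hV t ht).mul_const g₀⟩
    | succ n ih =>
      intro t' ht' hn
      -- The fraction `n / (n + 1)` is chosen so that `B` times the length is at most `n * ρ` on the
      -- first part and at most `ρ` on the last.
      set s := t₀ + (n / (n + 1) : ℝ) * (t' - t₀) with hs
      have hq : (n / (n + 1) : ℝ) ∈ Icc (0 : ℝ) 1 :=
        ⟨by positivity, by rw [div_le_one (by positivity)]; linarith⟩
      have h1 : t₀ ≤ s := by
        have := mul_nonneg hq.1 (sub_nonneg.2 ht'.1); linarith
      have h2 : s ≤ t' := by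
        have := mul_le_mul_of_nonneg_right hq.2 (sub_nonneg.2 ht'.1); linarith
      push_cast at hn
      have hn' : B * (t' - t₀) / (n + 1) ≤ ρ := by
        rw [div_le_iff₀ (by positivity)]; linarith
      obtain ⟨W, hW0, hW⟩ := ih s ⟨h1, h2.trans ht'.2⟩ (by
        have : B * (s - t₀) = n * (B * (t' - t₀) / (n + 1)) := by rw [hs]; ring
        rw [this]; gcongr)
      obtain ⟨V, hV0, hV, -⟩ := hloc s t' B a h2
        (ha.mono (Icc_subset_Icc h1 ht'.2))
        (fun t ht => hB t ⟨h1.trans ht.1, ht.2.trans ht'.2⟩) (by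
          have : B * (t' - s) = B * (t' - t₀) / (n + 1) := by rw [hs]; field_simp; ring
          rwa [this])
      refine ⟨fun t => if t ≤ s then W t else V t * W s, by simp [h1, hW0], fun t ht => ?_⟩
      have hV' : ∀ t ∈ Icc s t', HasRightLogDeriv (fun t => V t * W s) (a t) (Icc s t') t :=
        fun t ht => (hV t ht).mul_const _
      have e : W s = V s * W s := by simp [hV0]
      exact HasRightLogDeriv.glue h1 h2 hW hV' e ht
  obtain ⟨n, hn⟩ := exists_nat_ge (B * (t₁ - t₀) / ρ)
  exact key n t₁ ⟨h01, le_rfl⟩ (by rwa [div_le_iff₀ hρ] at hn)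

/-- Uniqueness of solutions of `W' = a W`. -/
theorem HasRightLogDeriv.eqOn {t₀ t₁ : ℝ} {W V : ℝ → G} {a : ℝ → F}
    (hW : ∀ t ∈ Icc t₀ t₁, HasRightLogDeriv W (a t) (Icc t₀ t₁) t)
    (hV : ∀ t ∈ Icc t₀ t₁, HasRightLogDeriv V (a t) (Icc t₀ t₁) t) (h0 : W t₀ = V t₀)
    {t : ℝ} (ht : t ∈ Icc t₀ t₁) : W t = V t := by
  have h : ∀ t ∈ Icc t₀ t₁,
      HasTDerivWithinAt (fun t => (W t)⁻¹ * V t) (0 : ℝ →L[ℝ] F) (Icc t₀ t₁) t := by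
    intro t ht
    -- In `W⁻¹ V` the contributions `∓ Ad(W⁻¹) a` of the two factors cancel.
    have h1 := (hW t ht).inv.mul (hV t ht)
    rw [neg_add_cancel] at h1
    have h2 : HasTDerivWithinAt _ _ _ _ := h1
    rwa [map_zero, ContinuousLinearMap.toSpanSingleton_zero] at h2
  have h1 := eq_of_hasTDerivWithinAt_zero h ht ⟨le_rfl, ht.1.trans ht.2⟩
  rw [h0, inv_mul_cancel] at h1
  exact inv_mul_eq_one.1 h1

end ODE

/-! ### Integrals depending on a parameter -/

section Parametric

variable {R T F : Type*} [NormedAddCommGroup R] [NormedSpace ℝ R] [TopologicalSpace T]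
  [NormedAddCommGroup F] [NormedSpace ℝ F]

/-- First order expansion in a parameter, uniformly in a variable of a compact set. -/
theorem eventually_norm_sub_fderiv_le {S : Set R} (hS : Convex ℝ S) {K : Set T} (hK : IsCompact K)
    {f : R → T → F} {f' : R → T → R →L[ℝ] F}
    (hf' : ContinuousOn (fun z : R × T => f' z.1 z.2) (S ×ˢ K))
    (hd : ∀ r ∈ S, ∀ t ∈ K, HasFDerivWithinAt (fun r => f r t) (f' r t) S r)
    {r₀ : R} (hr₀ : r₀ ∈ S) {ε : ℝ} (hε : 0 < ε) :
    ∀ᶠ r in 𝓝[S] r₀, ∀ t ∈ K, ‖f r t - f r₀ t - f' r₀ t (r - r₀)‖ ≤ ε * ‖r - r₀‖ := by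
  obtain ⟨v, hv, hvK⟩ := hK.mem_uniformity_of_prod hf' hr₀ (Metric.dist_mem_uniformity hε)
  obtain ⟨δ, hδ, hball⟩ := Metric.mem_nhdsWithin_iff.1 hv
  filter_upwards [Metric.mem_nhdsWithin_iff.2 ⟨δ, hδ, Subset.rfl⟩] with r hr t ht
  refine Convex.norm_image_sub_le_of_norm_hasFDerivWithin_le' (f := fun r => f r t)
    (f' := fun r => f' r t) (s := Metric.ball r₀ δ ∩ S)
    (fun x hx => (hd x hx.2 t ht).mono inter_subset_right) (fun x hx => ?_)
    ((convex_ball r₀ δ).inter hS) ⟨Metric.mem_ball_self hδ, hr₀⟩ hr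
  have h1 : dist (f' x t) (f' r₀ t) < ε := hvK x (hball hx) t ht
  rw [← dist_eq_norm]
  exact h1.le

-- Compactness of `K` makes joint continuity uniform in `t` near each parameter, so the integrands
-- converge uniformly; no compactness of `S` is required.
open MeasureTheory in
theorem continuousOn_setIntegral [CompleteSpace F] [MeasurableSpace T] [OpensMeasurableSpace T]
    {μ : Measure T} [IsFiniteMeasureOnCompacts μ] [SecondCountableTopologyEither T F]
    {S : Set R} {K : Set T} (hK : IsCompact K) (hKm : MeasurableSet K) {f : R → T → F}
    (hf : ContinuousOn (fun z : R × T => f z.1 z.2) (S ×ˢ K)) :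
    ContinuousOn (fun r => ∫ t in K, f r t ∂μ) S := by
  have hi : ∀ r ∈ S, IntegrableOn (f r) K μ := fun r hr =>
    (hf.comp (f := fun t => (r, t)) (continuousOn_const.prodMk continuousOn_id)
      fun t ht => ⟨hr, ht⟩).integrableOn_of_subset_isCompact hK hKm Subset.rfl hK.measure_lt_top.ne
  set m : ℝ := (μ K).toReal with hm
  have hm0 : 0 ≤ m := ENNReal.toReal_nonneg
  intro r₀ hr₀
  rw [ContinuousWithinAt, Metric.tendsto_nhds]
  intro ε hε
  -- The summand `1` avoids division by zero when `K` has measure zero.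
  have hε' : 0 < ε / (m + 1) := by positivity
  obtain ⟨v, hv, hvK⟩ := hK.mem_uniformity_of_prod hf hr₀ (Metric.dist_mem_uniformity hε')
  filter_upwards [hv, self_mem_nhdsWithin] with r hr hrS
  rw [dist_eq_norm, ← integral_sub (hi r hrS) (hi r₀ hr₀)]
  have h1 := norm_setIntegral_le_of_norm_le_const (f := fun t => f r t - f r₀ t) (μ := μ)
    hK.measure_lt_top (C := ε / (m + 1)) fun t ht => by
      have h1 : dist (f r t) (f r₀ t) < _ := hvK r hr t ht
      rw [← dist_eq_norm]; exact h1.le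
  refine h1.trans_lt ?_
  change ε / (m + 1) * m < ε
  rw [div_mul_eq_mul_div, div_lt_iff₀ (by positivity)]
  nlinarith

open MeasureTheory in
/-- Parametric integrals over a compact set are of class `C¹`. -/
theorem contDiffOn_one_setIntegral [CompleteSpace F] [MeasurableSpace T] [OpensMeasurableSpace T]
    {μ : Measure T}
    [IsFiniteMeasureOnCompacts μ] [SecondCountableTopologyEither T F]
    [SecondCountableTopologyEither T (R →L[ℝ] F)]
    {S : Set R} (hS : Convex ℝ S) (hSu : UniqueDiffOn ℝ S)
    {K : Set T} (hK : IsCompact K) (hKm : MeasurableSet K) {f : R → T → F} {f' : R → T → R →L[ℝ] F}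
    (hf : ∀ r ∈ S, ContinuousOn (f r) K)
    (hf' : ContinuousOn (fun z : R × T => f' z.1 z.2) (S ×ˢ K))
    (hd : ∀ r ∈ S, ∀ t ∈ K, HasFDerivWithinAt (fun r => f r t) (f' r t) S r) :
    ContDiffOn ℝ 1 (fun r => ∫ t in K, f r t ∂μ) S := by
  have hf'r : ∀ r ∈ S, ContinuousOn (f' r) K := fun r hr =>
    hf'.comp (continuousOn_const.prodMk continuousOn_id) fun t ht => ⟨hr, ht⟩
  have hi : ∀ r ∈ S, IntegrableOn (f r) K μ := fun r hr =>
    (hf r hr).integrableOn_of_subset_isCompact hK hKm Subset.rfl hK.measure_lt_top.ne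
  have hi' : ∀ r ∈ S, IntegrableOn (f' r) K μ := fun r hr =>
    (hf'r r hr).integrableOn_of_subset_isCompact hK hKm Subset.rfl hK.measure_lt_top.ne
  set m : ℝ := (μ K).toReal with hm
  have hm0 : 0 ≤ m := ENNReal.toReal_nonneg
  rw [show (1 : WithTop ℕ∞) = 0 + 1 by simp, contDiffOn_succ_iff_hasFDerivWithinAt_of_uniqueDiffOn hSu]
  refine ⟨by simp, fun r => ∫ t in K, f' r t ∂μ, ?_, fun r₀ hr₀ => ?_⟩
  · exact contDiffOn_zero.2 (continuousOn_setIntegral hK hKm hf')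
  · rw [hasFDerivWithinAt_iff_isLittleO, Asymptotics.isLittleO_iff]
    intro ε hε
    have hε' : 0 < ε / (m + 1) := by positivity
    filter_upwards [eventually_norm_sub_fderiv_le hS hK hf' hd hr₀ hε', self_mem_nhdsWithin]
      with r hr hrS
    have hi3 : IntegrableOn (fun t => f' r₀ t (r - r₀)) K μ :=
      (ContinuousLinearMap.apply ℝ F (r - r₀)).integrable_comp (hi' r₀ hr₀)
    have hi4 : IntegrableOn (fun t => f r t - f r₀ t) K μ := (hi r hrS).sub (hi r₀ hr₀)
    rw [ContinuousLinearMap.integral_apply (hi' r₀ hr₀), ← integral_sub (hi r hrS) (hi r₀ hr₀),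
      ← integral_sub hi4 hi3]
    have h1 := norm_setIntegral_le_of_norm_le_const (μ := μ)
      (f := fun t => f r t - f r₀ t - f' r₀ t (r - r₀))
      hK.measure_lt_top (C := ε / (m + 1) * ‖r - r₀‖) hr
    refine h1.trans ?_
    change ε / (m + 1) * ‖r - r₀‖ * m ≤ _
    rw [div_mul_eq_mul_div, div_mul_eq_mul_div, div_le_iff₀ (by positivity)]
    nlinarith [mul_nonneg hε.le (norm_nonneg (r - r₀))]

end Parametric

/-! ### Parallel transport of a flat connection on the square -/

section Flat

variable {F : Type*} [NormedAddCommGroup F] [NormedSpace ℝ F] [CompleteSpace F]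
  {G : Type*} [TopologicalSpace G] [ChartedSpace F G] [Group G] [LieGroup 𝓘(ℝ, F) ∞ G]

theorem bracket_antisymm (a b : F) : bracket G a b = -bracket G b a := by
  rw [bracket_eq_fderiv, bracket_eq_fderiv, neg_sub]

theorem uniqueDiffOn_unitSquare : UniqueDiffOn ℝ (Icc (0 : ℝ) 1 ×ˢ Icc (0 : ℝ) 1) :=
  (uniqueDiffOn_Icc zero_lt_one).prod (uniqueDiffOn_Icc zero_lt_one)

/-- Partial derivatives of a `C¹` function on the closed unit square. -/
theorem hasFDerivWithinAt_fst {H : Type*} [NormedAddCommGroup H] [NormedSpace ℝ H]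
    {A B : Set ℝ} {p : ℝ × ℝ → H} {s t : ℝ}
    (hp : DifferentiableWithinAt ℝ p (A ×ˢ B) (s, t)) (ht : t ∈ B) :
    HasFDerivWithinAt (fun s => p (s, t))
      ((fderivWithin ℝ p (A ×ˢ B) (s, t)).comp (ContinuousLinearMap.inl ℝ ℝ ℝ)) A s :=
  HasFDerivWithinAt.comp s (g := p) (f := fun s => (s, t)) hp.hasFDerivWithinAt
    (hasFDerivAt_prodMk_left s t).hasFDerivWithinAt fun _ hx => ⟨hx, ht⟩

theorem hasFDerivWithinAt_snd {H : Type*} [NormedAddCommGroup H] [NormedSpace ℝ H]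
    {A B : Set ℝ} {p : ℝ × ℝ → H} {s t : ℝ}
    (hp : DifferentiableWithinAt ℝ p (A ×ˢ B) (s, t)) (hs : s ∈ A) :
    HasFDerivWithinAt (fun t => p (s, t))
      ((fderivWithin ℝ p (A ×ˢ B) (s, t)).comp (ContinuousLinearMap.inr ℝ ℝ ℝ)) B t :=
  HasFDerivWithinAt.comp t (g := p) (f := fun t => (s, t)) hp.hasFDerivWithinAt
    (hasFDerivAt_prodMk_right s t).hasFDerivWithinAt fun _ hx => ⟨hs, hx⟩

/-- For a flat connection `q ds + p dt` on the unit square whose coefficient `q` vanishes on the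
edges `t = 0` and `t = 1`, parallel transport along `t` does not depend on `s`. -/
theorem transport_eq_of_flat {p q : ℝ × ℝ → F}
    (hp : ContDiffOn ℝ 1 p (Icc 0 1 ×ˢ Icc 0 1)) (hq : ContDiffOn ℝ 1 q (Icc 0 1 ×ˢ Icc 0 1))
    (hflat : ∀ z ∈ Icc (0 : ℝ) 1 ×ˢ Icc (0 : ℝ) 1,
      fderivWithin ℝ p (Icc 0 1 ×ˢ Icc 0 1) z (1, 0) - fderivWithin ℝ q (Icc 0 1 ×ˢ Icc 0 1) z (0, 1)
        + bracket G (q z) (p z) = 0)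
    (hq0 : ∀ s ∈ Icc (0 : ℝ) 1, q (s, 0) = 0) (hq1 : ∀ s ∈ Icc (0 : ℝ) 1, q (s, 1) = 0)
    {W : ℝ → ℝ → G} (hW0 : ∀ s ∈ Icc (0 : ℝ) 1, W s 0 = 1)
    (hW : ∀ s ∈ Icc (0 : ℝ) 1, ∀ t ∈ Icc (0 : ℝ) 1,
      HasRightLogDeriv (W s) (-p (s, t)) (Icc 0 1) t)
    {s s' : ℝ} (hs : s ∈ Icc (0 : ℝ) 1) (hs' : s' ∈ Icc (0 : ℝ) 1) : W s 1 = W s' 1 := by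
  -- It suffices that `s ↦ W s 1` has derivative zero at each `s₀`.
  refine eq_of_hasTDerivWithinAt_zero (H := F) (f := fun s => W s 1) (fun s₀ hs₀ => ?_) hs hs'
  clear hs hs' s s'
  set J := Icc (0 : ℝ) 1 with hJ
  have h0J : (0 : ℝ) ∈ J := by simp [hJ]
  have h1J : (1 : ℝ) ∈ J := by simp [hJ]
  set p' := fderivWithin ℝ p (J ×ˢ J) with hp'
  have hp'c : ContinuousOn p' (J ×ˢ J) :=
    hp.continuousOn_fderivWithin uniqueDiffOn_unitSquare le_rfl
  have hpd : ∀ z ∈ J ×ˢ J, DifferentiableWithinAt ℝ p (J ×ˢ J) z :=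
    hp.differentiableOn (by simp)
  have hqd : ∀ z ∈ J ×ˢ J, DifferentiableWithinAt ℝ q (J ×ˢ J) z :=
    hq.differentiableOn (by simp)
  have hpt : ∀ s ∈ J, ContinuousOn (fun t => p (s, t)) J := fun s hs =>
    hp.continuousOn.comp (continuousOn_const.prodMk continuousOn_id) fun t ht => ⟨hs, ht⟩
  set M : ℝ → F →L[ℝ] F := fun t => AdL (W s₀ t)⁻¹ with hM
  have hMd : ∀ t ∈ J, HasDerivWithinAt M ((AdL (W s₀ t)⁻¹).comp (adL G (p (s₀, t)))) J t := by
    intro t ht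
    have h1 := (hW s₀ hs₀ t ht).AdL_inv
    rwa [map_neg, ContinuousLinearMap.comp_neg, neg_neg] at h1
  have hMc : ContinuousOn M J := fun t ht => (hMd t ht).continuousWithinAt
  obtain ⟨c, hc⟩ := isCompact_Icc.exists_bound_of_continuousOn hMc
  have hc0 : 0 ≤ c := (norm_nonneg _).trans (hc 0 h0J)
  -- the integral of the derivative of the coefficient
  have hint : ∫ t in (0:ℝ)..1, M t (p' (s₀, t) (1, 0)) = 0 := by
    -- Since `M' = M ∘ ad p`, the derivative of `M q` is `M (∂ₜq + [p, q])`, which flatness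
    -- identifies with `M (∂ₛp)`. The boundary values of `q` then kill the integral.
    have hd : ∀ t ∈ J, HasDerivWithinAt (fun t => M t (q (s₀, t))) (M t (p' (s₀, t) (1, 0))) J t := by
      intro t ht
      have h1 := (hasFDerivWithinAt_snd (hqd (s₀, t) ⟨hs₀, ht⟩) hs₀).hasDerivWithinAt
      have h2 := (hMd t ht).clm_apply h1
      refine h2.congr_deriv ?_
      have h3 := hflat (s₀, t) ⟨hs₀, ht⟩
      rw [bracket_antisymm, ← adL_eq_bracket] at h3
      have h4 : p' (s₀, t) (1, 0) = fderivWithin ℝ q (J ×ˢ J) (s₀, t) (0, 1) +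
          adL G (p (s₀, t)) (q (s₀, t)) := by
        rw [← sub_eq_zero, ← h3]; abel
      rw [h4, map_add]
      simp [hM, add_comm]
    have hcont : ContinuousOn (fun t => M t (p' (s₀, t) (1, 0))) J := by
      refine hMc.clm_apply (ContinuousOn.clm_apply ?_ continuousOn_const)
      exact hp'c.comp (continuousOn_const.prodMk continuousOn_id) fun t ht => ⟨hs₀, ht⟩
    rw [intervalIntegral.integral_eq_sub_of_hasDerivAt_of_le zero_le_one
      (fun t ht => (hd t ht).continuousWithinAt)
      (fun t ht => (hd t ⟨ht.1.le, ht.2.le⟩).hasDerivAt (Icc_mem_nhds ht.1 ht.2))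
      (hcont.intervalIntegrable_of_Icc zero_le_one)]
    simp [hq0 s₀ hs₀, hq1 s₀ hs₀]
  -- the comparison curve
  set b : ℝ → ℝ → F := fun s t => -M t (p (s, t) - p (s₀, t)) with hb
  have hbc : ∀ s ∈ J, ContinuousOn (b s) J := fun s hs =>
    (hMc.clm_apply ((hpt s hs).sub (hpt s₀ hs₀))).neg
  -- The quotient of the two transports starts at `1` and solves an equation whose coefficient is of
  -- order `|s - s₀|`. The quadratic error in `exists_local_solution` therefore does not affect the
  -- first derivative in `s`.
  have hV : ∀ s ∈ J, ∀ t ∈ J, HasRightLogDeriv (fun t => (W s₀ t)⁻¹ * W s t) (b s t) J t := by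
    intro s hs t ht
    have h1 := (hW s₀ hs₀ t ht).inv.mul (hW s hs t ht)
    have e : -(AdL (W s₀ t)⁻¹ (-p (s₀, t)) : F) + AdL (W s₀ t)⁻¹ (-p (s, t)) = b s t := by
      simp only [hb, hM, map_neg, map_sub]; abel
    rwa [e] at h1
  have hunif : ∀ ε : ℝ, 0 < ε → ∀ᶠ s in 𝓝[J] s₀, ∀ t ∈ J,
      ‖p (s, t) - p (s₀, t) - (s - s₀) • p' (s₀, t) (1, 0)‖ ≤ ε * ‖s - s₀‖ := by
    intro ε hε
    have := eventually_norm_sub_fderiv_le (f := fun s t => p (s, t)) (convex_Icc (0 : ℝ) 1)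
      (isCompact_Icc (a := (0 : ℝ)) (b := 1))
      (f' := fun s t => (p' (s, t)).comp (ContinuousLinearMap.inl ℝ ℝ ℝ))
      (hp'c.clm_comp continuousOn_const) (fun s hs t ht => hasFDerivWithinAt_fst (hpd _ ⟨hs, ht⟩) ht)
      hs₀ hε
    filter_upwards [this] with s hs t ht
    have h1 := hs t ht
    rwa [← mul_one (s - s₀), ← smul_eq_mul, map_smul, smul_eq_mul, mul_one] at h1
  obtain ⟨D, hD⟩ : ∃ D : ℝ, ∀ t ∈ J, ‖p' (s₀, t) (1, 0)‖ ≤ D :=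
    isCompact_Icc.exists_bound_of_continuousOn
      ((hp'c.comp (continuousOn_const.prodMk continuousOn_id) fun t ht => ⟨hs₀, ht⟩).clm_apply
        continuousOn_const)
  have hD0 : 0 ≤ D := (norm_nonneg _).trans (hD 0 h0J)
  obtain ⟨ρ, hρ, C, hC, hloc⟩ := exists_local_solution F G
  -- Here `c` bounds `Ad(W_{s₀}⁻¹)` and `1 + D` bounds the difference quotients of `p` in `s`: the
  -- expansion with `ε = 1`, plus the bound `D` for `∂ₛp`.
  set L := c * (1 + D) with hL
  have hL0 : 0 ≤ L := by positivity
  have hbB : ∀ᶠ s in 𝓝[J] s₀, ∀ t ∈ J, ‖b s t‖ ≤ L * ‖s - s₀‖ := by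
    filter_upwards [hunif 1 one_pos] with s hs t ht
    have h1 : ‖p (s, t) - p (s₀, t)‖ ≤ (1 + D) * ‖s - s₀‖ := by
      calc _ ≤ ‖p (s, t) - p (s₀, t) - (s - s₀) • p' (s₀, t) (1, 0)‖ +
            ‖(s - s₀) • p' (s₀, t) (1, 0)‖ := by
            simpa using norm_add_le (p (s, t) - p (s₀, t) - (s - s₀) • p' (s₀, t) (1, 0))
              ((s - s₀) • p' (s₀, t) (1, 0))
        _ ≤ 1 * ‖s - s₀‖ + ‖s - s₀‖ * D := by
            refine add_le_add (hs t ht) ?_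
            rw [norm_smul]
            exact mul_le_mul_of_nonneg_left (hD t ht) (norm_nonneg _)
        _ = _ := by ring
    rw [hb, norm_neg]
    refine ((M t).le_opNorm _).trans ?_
    rw [hL, mul_assoc]
    exact mul_le_mul (hc t ht) h1 (norm_nonneg _) hc0
  set φ := extChartAt 𝓘(ℝ, F) (1 : G) with hφ
  have hsmall : ∀ᶠ s in 𝓝[J] s₀, L * ‖s - s₀‖ * (1 - 0) ≤ ρ := by
    have h1 : Filter.Tendsto (fun s => L * ‖s - s₀‖ * (1 - 0)) (𝓝[J] s₀) (𝓝 0) := by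
      have h2 : Continuous fun s : ℝ => L * ‖s - s₀‖ * (1 - 0) := by fun_prop
      have h3 := h2.tendsto s₀
      simp only [sub_self, norm_zero, mul_zero, zero_mul] at h3
      exact h3.mono_left nhdsWithin_le_nhds
    exact (h1.eventually (Iio_mem_nhds hρ)).mono fun s hs => le_of_lt hs
  have hVs : ∀ᶠ s in 𝓝[J] s₀, (W s₀ 1)⁻¹ * W s 1 ∈ φ.source ∧
      ‖φ ((W s₀ 1)⁻¹ * W s 1) - chartOne F G - ∫ t in (0:ℝ)..1, b s t‖ ≤
        C * (L * ‖s - s₀‖) ^ 2 := by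
    filter_upwards [self_mem_nhdsWithin, hbB, hsmall] with s hs hsB hss
    obtain ⟨V, hV0, hVd, hV1, hV2⟩ := hloc 0 1 _ (b s) zero_le_one (hbc s hs) hsB hss
    have e : (W s₀ 1)⁻¹ * W s 1 = V 1 :=
      HasRightLogDeriv.eqOn (hV s hs) hVd (by simp [hV0, hW0 s hs, hW0 s₀ hs₀]) h1J
    rw [e]
    refine ⟨hV1, ?_⟩
    rwa [sub_zero, mul_one] at hV2
  -- In the chart the quotient at `t = 1` is the identity plus `∫ b` plus `O(|s - s₀|²)`. Half of
  -- `ε` absorbs the quadratic term, the other half the integral.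
  have hφd : HasFDerivWithinAt (fun s => φ ((W s₀ 1)⁻¹ * W s 1)) (0 : ℝ →L[ℝ] F) J s₀ := by
    rw [hasFDerivWithinAt_iff_isLittleO, Asymptotics.isLittleO_iff]
    intro ε hε
    have hε1 : 0 < ε / (2 * (c + 1)) := by positivity
    have hnear : ∀ᶠ s in 𝓝[J] s₀, C * L ^ 2 * ‖s - s₀‖ ≤ ε / 2 := by
      have h1 : Filter.Tendsto (fun s => C * L ^ 2 * ‖s - s₀‖) (𝓝[J] s₀) (𝓝 0) := by
        have h2 : Continuous fun s : ℝ => C * L ^ 2 * ‖s - s₀‖ := by fun_prop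
        have h3 := h2.tendsto s₀
        simp only [sub_self, norm_zero, mul_zero] at h3
        exact h3.mono_left nhdsWithin_le_nhds
      exact (h1.eventually (Iio_mem_nhds (half_pos hε))).mono fun s hs => le_of_lt hs
    filter_upwards [hVs, hunif _ hε1, self_mem_nhdsWithin, hnear] with s hs1 hs2 hsJ hs3
    have e0 : φ ((W s₀ 1)⁻¹ * W s₀ 1) = chartOne F G := by rw [inv_mul_cancel]; rfl
    rw [e0, zero_apply, sub_zero]
    have hI : ‖∫ t in (0:ℝ)..1, b s t‖ ≤ ε / 2 * ‖s - s₀‖ := by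
      have hcont : ContinuousOn (fun t => M t (p' (s₀, t) (1, 0))) J := by
        refine hMc.clm_apply (ContinuousOn.clm_apply ?_ continuousOn_const)
        exact hp'c.comp (continuousOn_const.prodMk continuousOn_id) fun t ht => ⟨hs₀, ht⟩
      -- Adding the vanishing integral `hint` cancels the linear part of `b` and leaves `M` applied
      -- to the remainder of the expansion of `p`.
      have e1 : ∫ t in (0:ℝ)..1, b s t =
          ∫ t in (0:ℝ)..1, (b s t + (s - s₀) • M t (p' (s₀, t) (1, 0))) := by
        have hcont' : ContinuousOn (fun t => (s - s₀) • M t (p' (s₀, t) (1, 0))) J :=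
          hcont.const_smul (s - s₀)
        rw [intervalIntegral.integral_add ((hbc s hsJ).intervalIntegrable_of_Icc zero_le_one)
          (hcont'.intervalIntegrable_of_Icc zero_le_one),
          intervalIntegral.integral_smul, hint, smul_zero, add_zero]
      rw [e1]
      refine (intervalIntegral.norm_integral_le_of_norm_le_const
        (C := ε / 2 * ‖s - s₀‖) fun t ht => ?_).trans (by simp)
      rw [uIoc_of_le zero_le_one] at ht
      have htJ : t ∈ J := ⟨ht.1.le, ht.2⟩
      have e2 : b s t + (s - s₀) • M t (p' (s₀, t) (1, 0)) =
          -M t (p (s, t) - p (s₀, t) - (s - s₀) • p' (s₀, t) (1, 0)) := by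
        simp only [hb, map_sub, map_smul]; abel
      rw [e2, norm_neg]
      refine ((M t).le_opNorm _).trans ?_
      calc ‖M t‖ * ‖p (s, t) - p (s₀, t) - (s - s₀) • p' (s₀, t) (1, 0)‖
          ≤ (c + 1) * (ε / (2 * (c + 1)) * ‖s - s₀‖) :=
            mul_le_mul ((hc t htJ).trans (by linarith)) (hs2 t htJ) (norm_nonneg _) (by positivity)
        _ = ε / 2 * ‖s - s₀‖ := by field_simp
    calc ‖φ ((W s₀ 1)⁻¹ * W s 1) - chartOne F G‖
        ≤ ‖φ ((W s₀ 1)⁻¹ * W s 1) - chartOne F G - ∫ t in (0:ℝ)..1, b s t‖ +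
          ‖∫ t in (0:ℝ)..1, b s t‖ := by
          simpa using norm_add_le (φ ((W s₀ 1)⁻¹ * W s 1) - chartOne F G -
            ∫ t in (0:ℝ)..1, b s t) (∫ t in (0:ℝ)..1, b s t)
      _ ≤ C * (L * ‖s - s₀‖) ^ 2 + ε / 2 * ‖s - s₀‖ := add_le_add hs1.2 hI
      _ = (C * L ^ 2 * ‖s - s₀‖) * ‖s - s₀‖ + ε / 2 * ‖s - s₀‖ := by ring
      _ ≤ ε / 2 * ‖s - s₀‖ + ε / 2 * ‖s - s₀‖ := by gcongr
      _ = ε * ‖s - s₀‖ := by ring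
  have e0 : φ ((W s₀ 1)⁻¹ * W s₀ 1) ∈ φ.target := by
    rw [inv_mul_cancel]; exact extChartAt_self_mem_target (H := F) (1 : G)
  have hg : MDifferentiableAt 𝓘(ℝ, F) 𝓘(ℝ, F) (fun y => W s₀ 1 * φ.symm y)
      (φ ((W s₀ 1)⁻¹ * W s₀ 1)) :=
    MDifferentiableAt.comp (x := φ ((W s₀ 1)⁻¹ * W s₀ 1)) (g := fun h : G => W s₀ 1 * h)
      (f := φ.symm) (mdifferentiable_mul_left F _ _) (mdifferentiableAt_extChartAt_symm_of_mem e0)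
  have hfin := (hasTDerivWithinAt_iff_hasFDerivWithinAt.2 hφd).tderiv_comp hg
  rw [ContinuousLinearMap.comp_zero] at hfin
  -- Near `s₀` the curve `W s 1` is recovered from its chart expression, so it inherits the zero
  -- derivative.
  have hinv : ∀ᶠ s in 𝓝[J] s₀, W s 1 = W s₀ 1 * φ.symm (φ ((W s₀ 1)⁻¹ * W s 1)) := by
    filter_upwards [hVs] with s hs
    rw [φ.left_inv hs.1, mul_inv_cancel_left]
  exact hfin.congr_of_eventuallyEq hinv (hinv.self_of_nhdsWithin hs₀)

end Flat

/-! ### Smoothing continuous maps relative to a closed set -/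

section Smoothing

variable {V : Type*} [NormedAddCommGroup V] [NormedSpace ℝ V] [FiniteDimensional ℝ V]
  {E : Type*} [NormedAddCommGroup E] [NormedSpace ℝ E]
  {M : Type*} [TopologicalSpace M] [ChartedSpace E M]

open Classical in
/-- Displace `f x` by `e` in the chart at `y₀`, with a cut-off near `x₀`. -/
def chartShift (f : V → M) (y₀ : M) {x₀ : V} (χ : ContDiffBump x₀) (ρ : ℝ) (x : V) (e : E) : M :=
  if x ∈ Metric.ball x₀ ρ then
    (extChartAt 𝓘(ℝ, E) y₀).symm (extChartAt 𝓘(ℝ, E) y₀ (f x) + χ x • e)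
  else f x

variable {f : V → M} {y₀ : M} {x₀ : V} {χ : ContDiffBump x₀} {ρ : ℝ}

theorem chartShift_of_mem {x : V} (hx : x ∈ Metric.ball x₀ ρ) (e : E) :
    chartShift f y₀ χ ρ x e =
      (extChartAt 𝓘(ℝ, E) y₀).symm (extChartAt 𝓘(ℝ, E) y₀ (f x) + χ x • e) := if_pos hx

/-- Where the bump vanishes, the two branches of the definition agree. As the bump is supported
strictly inside the ball of radius `ρ`, continuity and smoothness persist across its boundary. -/
theorem chartShift_of_bump_eq_zero
    (hf : MapsTo f (Metric.closedBall x₀ ρ) (extChartAt 𝓘(ℝ, E) y₀).source) {x : V} (hx : χ x = 0)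
    (e : E) : chartShift f y₀ χ ρ x e = f x := by
  unfold chartShift
  split_ifs with h
  · rw [hx, zero_smul, add_zero, PartialEquiv.left_inv _ (hf (Metric.ball_subset_closedBall h))]
  · rfl

theorem chartShift_zero
    (hf : MapsTo f (Metric.closedBall x₀ ρ) (extChartAt 𝓘(ℝ, E) y₀).source) (x : V) :
    chartShift f y₀ χ ρ x (0 : E) = f x := by
  unfold chartShift
  split_ifs with h
  · rw [smul_zero, add_zero, PartialEquiv.left_inv _ (hf (Metric.ball_subset_closedBall h))]
  · rfl

theorem eventually_bump_eq_zero (hρ : χ.rOut < ρ) {x : V} (hx : x ∉ Metric.ball x₀ ρ) :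
    ∀ᶠ x' in 𝓝 x, χ x' = 0 := by
  have h : x ∈ (Metric.closedBall x₀ χ.rOut)ᶜ := fun h =>
    hx (lt_of_le_of_lt (Metric.mem_closedBall.1 h) hρ)
  filter_upwards [Metric.isClosed_closedBall.isOpen_compl.mem_nhds h] with x' hx'
  exact χ.zero_of_le_dist (not_le.1 (fun h => hx' (Metric.mem_closedBall.2 h))).le

theorem continuousOn_chartShift (hfc : Continuous f) (hρ : χ.rOut < ρ)
    (hf : MapsTo f (Metric.closedBall x₀ ρ) (extChartAt 𝓘(ℝ, E) y₀).source) {δ : ℝ}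
    (hδ : ∀ x ∈ Metric.closedBall x₀ ρ, ∀ e : E, ‖e‖ ≤ δ →
      extChartAt 𝓘(ℝ, E) y₀ (f x) + e ∈ (extChartAt 𝓘(ℝ, E) y₀).target) :
    ContinuousOn (fun z : V × E => chartShift f y₀ χ ρ z.1 z.2)
      (univ ×ˢ Metric.closedBall 0 δ) := by
  rintro ⟨x, e⟩ ⟨-, he⟩
  by_cases hx : x ∈ Metric.ball x₀ ρ
  · have h1 : ContinuousAt (fun x => extChartAt 𝓘(ℝ, E) y₀ (f x)) x :=
      ContinuousAt.comp (g := extChartAt 𝓘(ℝ, E) y₀)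
        (continuousAt_extChartAt' (hf (Metric.ball_subset_closedBall hx))) hfc.continuousAt
    have h2 : ContinuousAt (fun z : V × E => extChartAt 𝓘(ℝ, E) y₀ (f z.1) + χ z.1 • z.2) (x, e) :=
      (ContinuousAt.comp (x := ((x, e) : V × E)) (f := Prod.fst) h1 continuousAt_fst).add
        ((χ.continuous.continuousAt.comp continuousAt_fst).smul continuousAt_snd)
    have he' : ‖χ x • e‖ ≤ δ := by
      rw [norm_smul, Real.norm_of_nonneg χ.nonneg]
      exact (mul_le_of_le_one_left (norm_nonneg _) χ.le_one).trans (by simpa using he)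
    have h3 := (ContinuousAt.comp (x := ((x, e) : V × E)) (g := (extChartAt 𝓘(ℝ, E) y₀).symm)
      (continuousAt_extChartAt_symm'' (hδ x (Metric.ball_subset_closedBall hx) _ he')) h2)
    refine (h3.congr ?_).continuousWithinAt
    filter_upwards [continuousAt_fst.preimage_mem_nhds (Metric.isOpen_ball.mem_nhds hx)] with z hz
    exact (chartShift_of_mem hz _).symm
  · have h1 : ContinuousAt (fun z : V × E => f z.1) (x, e) := hfc.continuousAt.comp continuousAt_fst
    refine (h1.congr ?_).continuousWithinAt
    filter_upwards [continuousAt_fst.eventually (eventually_bump_eq_zero hρ hx)] with z hz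
    exact (chartShift_of_bump_eq_zero hf hz _).symm

variable [IsManifold 𝓘(ℝ, E) ∞ M]

/-- A point at which `f` is smooth stays smooth. The displacement need be smooth only inside the
ball, which is all that the cut-off map of a chart provides. -/
theorem contMDiffAt_chartShift (hρ : χ.rOut < ρ)
    (hf : MapsTo f (Metric.closedBall x₀ ρ) (extChartAt 𝓘(ℝ, E) y₀).source) {δ : ℝ}
    (hδ : ∀ x ∈ Metric.closedBall x₀ ρ, ∀ e : E, ‖e‖ ≤ δ →
      extChartAt 𝓘(ℝ, E) y₀ (f x) + e ∈ (extChartAt 𝓘(ℝ, E) y₀).target)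
    {v : V → E} {x : V} (hv : ‖v x‖ ≤ δ) (hfx : ContMDiffAt 𝓘(ℝ, V) 𝓘(ℝ, E) ∞ f x)
    (hvx : x ∈ Metric.ball x₀ ρ → ContDiffAt ℝ ∞ v x) :
    ContMDiffAt 𝓘(ℝ, V) 𝓘(ℝ, E) ∞ (fun x => chartShift f y₀ χ ρ x (v x)) x := by
  by_cases hx : x ∈ Metric.ball x₀ ρ
  · have hfs := hf (Metric.ball_subset_closedBall hx)
    have h1 : ContMDiffAt 𝓘(ℝ, V) 𝓘(ℝ, E) ∞ (fun x => extChartAt 𝓘(ℝ, E) y₀ (f x)) x :=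
      ContMDiffAt.comp x (g := extChartAt 𝓘(ℝ, E) y₀)
        (contMDiffAt_extChartAt' (by simpa using hfs)) hfx
    have h2 : ContDiffAt ℝ ∞ (fun x => extChartAt 𝓘(ℝ, E) y₀ (f x) + χ x • v x) x :=
      h1.contDiffAt.add (χ.contDiffAt.smul (hvx hx))
    have he' : ‖χ x • v x‖ ≤ δ := by
      rw [norm_smul, Real.norm_of_nonneg χ.nonneg]
      exact (mul_le_of_le_one_left (norm_nonneg _) χ.le_one).trans hv
    have h3 : ContMDiffAt 𝓘(ℝ, E) 𝓘(ℝ, E) ∞ (extChartAt 𝓘(ℝ, E) y₀).symm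
        (extChartAt 𝓘(ℝ, E) y₀ (f x) + χ x • v x) :=
      (contMDiffOn_extChartAt_symm y₀).contMDiffAt
        ((isOpen_extChartAt_target y₀).mem_nhds (hδ x (Metric.ball_subset_closedBall hx) _ he'))
    refine (ContMDiffAt.comp x h3 h2.contMDiffAt).congr_of_eventuallyEq ?_
    filter_upwards [Metric.isOpen_ball.mem_nhds hx] with z hz
    exact chartShift_of_mem hz _
  · refine hfx.congr_of_eventuallyEq ?_
    filter_upwards [eventually_bump_eq_zero hρ hx] with z hz
    exact chartShift_of_bump_eq_zero hf hz _

/-- Smoothing inside a chart. -/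
theorem exists_smoothing_local [FiniteDimensional ℝ E] {O : Set V} (hO : IsOpen O) (f : C(V, M))
    {x₀ : V} (hx₀ : x₀ ∈ O) :
    ∃ D ∈ 𝓝 x₀, ∃ 𝒰 : Set C(V, M), IsOpen 𝒰 ∧ f ∈ 𝒰 ∧ ∀ f₁ ∈ 𝒰, ∀ 𝒱 : Set C(V, M), IsOpen 𝒱 →
      f₁ ∈ 𝒱 → ∃ f₂ ∈ 𝒱, f₁.HomotopicRel f₂ Oᶜ ∧
        (∀ x, ContMDiffAt 𝓘(ℝ, V) 𝓘(ℝ, E) ∞ f₁ x → ContMDiffAt 𝓘(ℝ, V) 𝓘(ℝ, E) ∞ f₂ x) ∧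
        ∀ x ∈ D, ContMDiffAt 𝓘(ℝ, V) 𝓘(ℝ, E) ∞ f₂ x := by
  set φ := extChartAt 𝓘(ℝ, E) (f x₀) with hφ
  have hsrc : φ.source ∈ 𝓝 (f x₀) := extChartAt_source_mem_nhds _
  have hsrco : IsOpen φ.source := isOpen_extChartAt_source _
  obtain ⟨R, hR, hball⟩ := Metric.nhds_basis_closedBall.mem_iff.1
    (Filter.inter_mem (hO.mem_nhds hx₀) (f.continuous.continuousAt.preimage_mem_nhds hsrc))
  let χ : ContDiffBump x₀ := ⟨R / 4, R / 2, by positivity, by linarith⟩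
  let χ' : ContDiffBump x₀ := ⟨R / 2, 3 * R / 4, by positivity, by linarith⟩
  -- The open set `𝒰` is fixed before `f₁`, so that maps already modified elsewhere are still
  -- admitted; `𝒱` prescribes how small the new modification must be. Both serve the induction over
  -- a compact set.
  refine ⟨Metric.ball x₀ (R / 4), Metric.ball_mem_nhds _ (by positivity),
    {f₁ | MapsTo f₁ (Metric.closedBall x₀ R) φ.source},
    ContinuousMap.isOpen_setOfPred_mapsTo (isCompact_closedBall x₀ R) hsrco,
    fun x hx => (hball hx).2, fun f₁ hf₁ 𝒱 h𝒱 hf₁𝒱 => ?_⟩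
  replace hf₁ : MapsTo f₁ (Metric.closedBall x₀ R) φ.source := hf₁
  have hρ : χ.rOut < R := show R / 2 < R by linarith
  have hρ' : χ'.rOut < R := show 3 * R / 4 < R by linarith
  have hφc : ContinuousOn (fun x => φ (f₁ x)) (Metric.closedBall x₀ R) :=
    (continuousOn_extChartAt (f x₀)).comp f₁.continuous.continuousOn hf₁
  obtain ⟨δ, hδ, hδt⟩ := ((isCompact_closedBall x₀ R).image_of_continuousOn
    hφc).exists_cthickening_subset_open (isOpen_extChartAt_target (f x₀))
    (by rintro _ ⟨x, hx, rfl⟩; exact φ.map_source (hf₁ hx))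
  -- The image of the ball in the chart is compact, so displacements of norm at most `δ` do not
  -- leave the chart.
  have hδ' : ∀ x ∈ Metric.closedBall x₀ R, ∀ e : E, ‖e‖ ≤ δ → φ (f₁ x) + e ∈ φ.target := by
    intro x hx e he
    refine hδt (Metric.mem_cthickening_of_dist_le _ (φ (f₁ x)) δ _ (mem_image_of_mem _ hx) ?_)
    simpa [dist_eq_norm] using he
  -- the map in the chart, cut off
  set g : V → E := fun x => χ' x • φ (f₁ x) with hg
  have hg1 : ∀ x ∈ Metric.ball x₀ R, ContinuousAt g x := fun x hx =>
    χ'.continuous.continuousAt.smul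
      (hφc.continuousAt (Metric.closedBall_mem_nhds_of_mem hx))
  have hgc : Continuous g := by
    rw [continuous_iff_continuousAt]
    intro x
    by_cases hx : x ∈ Metric.ball x₀ R
    · exact hg1 x hx
    · refine (continuousAt_const (y := (0 : E))).congr ?_
      filter_upwards [eventually_bump_eq_zero hρ' hx] with x' hx'
      simp [hg, hx']
  have happ : ∀ m : ℕ, ∃ g' : V → E, ContDiff ℝ ∞ g' ∧ ∀ x, ‖g' x - g x‖ ≤ δ / (m + 1) := by
    intro m
    obtain ⟨g', hg', hd, -⟩ := hgc.exists_contDiff_approx ⊤ (ε := fun _ => δ / (m + 1))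
      continuous_const (fun _ => by positivity)
    exact ⟨g', hg', fun x => by rw [← dist_eq_norm]; exact (hd x).le⟩
  choose g' hg' hgd using happ
  have hle : ∀ m : ℕ, δ / (m + 1) ≤ δ := fun m =>
    div_le_self hδ.le (by linarith [(Nat.cast_nonneg m : (0:ℝ) ≤ m)])
  have hes : ∀ m x, g' m x - g x ∈ Metric.closedBall (0 : E) δ := fun m x => by
    simpa using (hgd m x).trans (hle m)
  have hcont := continuousOn_chartShift (χ := χ) f₁.continuous hρ hf₁ hδ'
  -- Composition with the fixed map `Ψ` is continuous for the compact-open topology. Uniform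
  -- convergence of the displacements to zero thus brings the shifted maps into `𝒱`.
  let Ψ : C(V × Metric.closedBall (0 : E) δ, M) :=
    ⟨fun z => chartShift f₁ (f x₀) χ R z.1 (z.2 : E), hcont.comp_continuous
      (f := fun z : V × Metric.closedBall (0 : E) δ => (z.1, (z.2 : E)))
      (continuous_fst.prodMk (continuous_subtype_val.comp continuous_snd))
      fun z => ⟨mem_univ _, z.2.2⟩⟩
  let e : ℕ → C(V, Metric.closedBall (0 : E) δ) := fun m =>
    ⟨fun x => ⟨g' m x - g x, hes m x⟩, ((hg' m).continuous.sub hgc).subtype_mk _⟩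
  let e₀ : C(V, Metric.closedBall (0 : E) δ) :=
    ContinuousMap.const V ⟨0, Metric.mem_closedBall_self hδ.le⟩
  have hlim : Filter.Tendsto (fun m => (ContinuousMap.id V).prodMk (e m)) Filter.atTop
      (𝓝 ((ContinuousMap.id V).prodMk e₀)) := by
    refine ContinuousMap.tendsto_of_tendstoLocallyUniformly
      (TendstoUniformly.tendstoLocallyUniformly ?_)
    rw [Metric.tendstoUniformly_iff]
    intro ε hε
    have hl : Filter.Tendsto (fun m : ℕ => δ / ((m : ℝ) + 1)) Filter.atTop (𝓝 0) :=
      tendsto_const_nhds.div_atTop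
        (Filter.tendsto_atTop_add_const_right _ _ tendsto_natCast_atTop_atTop)
    filter_upwards [hl.eventually (Iio_mem_nhds hε)] with m hm x
    have h1 : dist (((ContinuousMap.id V).prodMk e₀) x) (((ContinuousMap.id V).prodMk (e m)) x) =
        ‖g' m x - g x‖ := by
      rw [ContinuousMap.prod_eval, ContinuousMap.prod_eval, dist_prod_same_left, Subtype.dist_eq,
        dist_eq_norm, norm_sub_rev]
      exact congrArg norm (sub_zero _)
    rw [h1]
    exact (hgd m x).trans_lt hm
  have hΦ : Filter.Tendsto (fun m => Ψ.comp ((ContinuousMap.id V).prodMk (e m))) Filter.atTop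
      (𝓝 (Ψ.comp ((ContinuousMap.id V).prodMk e₀))) :=
    ((ContinuousMap.continuous_postcomp Ψ).tendsto _).comp hlim
  have hΦ0 : Ψ.comp ((ContinuousMap.id V).prodMk e₀) = f₁ := by
    ext x
    exact chartShift_zero hf₁ x
  rw [hΦ0] at hΦ
  obtain ⟨m, hm⟩ := (hΦ.eventually (h𝒱.mem_nhds hf₁𝒱)).exists
  set f₂ := Ψ.comp ((ContinuousMap.id V).prodMk (e m)) with hf₂
  have hf₂x : ∀ x, f₂ x = chartShift f₁ (f x₀) χ R x (g' m x - g x) := fun x => rfl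
  -- The homotopy scales the displacement by the time; outside the ball nothing moves, so it is
  -- relative to `Oᶜ`.
  refine ⟨f₂, hm, ⟨⟨⟨⟨fun z => chartShift f₁ (f x₀) χ R z.2 ((z.1 : ℝ) • (g' m z.2 - g z.2)), ?_⟩,
    fun x => ?_, fun x => ?_⟩, fun t x hx => ?_⟩⟩, fun x hx => ?_, fun x hx => ?_⟩
  · refine hcont.comp_continuous (f := fun z : I × V => (z.2, (z.1 : ℝ) • (g' m z.2 - g z.2))) ?_ ?_
    · have := (hg' m).continuous
      fun_prop
    · intro z
      refine ⟨mem_univ _, ?_⟩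
      have h1 := hes m z.2
      simp only [mem_closedBall_zero_iff] at h1 ⊢
      rw [norm_smul, Real.norm_of_nonneg z.1.2.1]
      exact (mul_le_of_le_one_left (norm_nonneg _) z.1.2.2).trans h1
  · simpa using chartShift_zero hf₁ x
  · simp [hf₂x]
  · have h1 : x ∉ Metric.ball x₀ R := fun h => hx (hball (Metric.ball_subset_closedBall h)).1
    exact if_neg h1
  · refine contMDiffAt_chartShift (v := fun x => g' m x - g x) hρ hf₁ hδ'
      (by simpa using hes m x) hx fun hxR => ?_
    have h1 : ContMDiffAt 𝓘(ℝ, V) 𝓘(ℝ, E) ∞ (fun x => φ (f₁ x)) x :=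
      ContMDiffAt.comp x (g := φ)
        (contMDiffAt_extChartAt' (by
          rw [← extChartAt_source 𝓘(ℝ, E)]; exact hf₁ (Metric.ball_subset_closedBall hxR))) hx
    exact (hg' m).contDiffAt.sub (χ'.contDiffAt.smul h1.contDiffAt)
  · have hxR : x ∈ Metric.ball x₀ R := Metric.ball_subset_ball (by linarith) hx
    -- On the ball of radius `R / 4` both bumps equal `1`, so there `f₂` is the smooth map `g' m`
    -- read through the chart.
    have h2 : ContMDiffAt 𝓘(ℝ, E) 𝓘(ℝ, E) ∞ φ.symm (g' m x) := by
      refine (contMDiffOn_extChartAt_symm (f x₀)).contMDiffAt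
        ((isOpen_extChartAt_target _).mem_nhds ?_)
      have h3 := hδ' x (Metric.ball_subset_closedBall hxR) (g' m x - g x) (by simpa using hes m x)
      have h4 : g x = φ (f₁ x) := by
        rw [hg]
        simp only
        rw [χ'.one_of_mem_closedBall
          (Metric.ball_subset_closedBall (Metric.ball_subset_ball (show R / 4 ≤ R / 2 by linarith) hx)),
          one_smul]
      rwa [h4, add_sub_cancel] at h3
    refine (ContMDiffAt.comp x h2 (hg' m).contDiffAt.contMDiffAt).congr_of_eventuallyEq ?_
    filter_upwards [Metric.isOpen_ball.mem_nhds hx] with z hz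
    have hzR : z ∈ Metric.ball x₀ R := Metric.ball_subset_ball (by linarith) hz
    have h4 : g z = φ (f₁ z) := by
      rw [hg]
      simp only
      rw [χ'.one_of_mem_closedBall
        (Metric.ball_subset_closedBall (Metric.ball_subset_ball (show R / 4 ≤ R / 2 by linarith) hz)),
        one_smul]
    rw [hf₂x, chartShift_of_mem hzR, χ.one_of_mem_closedBall (Metric.ball_subset_closedBall hz),
      one_smul, h4, add_sub_cancel]
    rfl

/-- Smoothing of a continuous map relative to a closed set. -/
theorem exists_smooth_homotopicRel [FiniteDimensional ℝ E] {K O : Set V} (hK : IsCompact K)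
    (hO : IsOpen O) (hKO : K ⊆ O) (f : C(V, M))
    (hf : ∀ x ∉ K, ContMDiffAt 𝓘(ℝ, V) 𝓘(ℝ, E) ∞ f x) :
    ∃ f' : C(V, M), ContMDiff 𝓘(ℝ, V) 𝓘(ℝ, E) ∞ f' ∧ f.HomotopicRel f' Oᶜ := by
  have key : ∃ 𝒰 : Set C(V, M), IsOpen 𝒰 ∧ f ∈ 𝒰 ∧ ∀ f₁ ∈ 𝒰, ∀ 𝒱 : Set C(V, M), IsOpen 𝒱 →
      f₁ ∈ 𝒱 → ∃ f₂ ∈ 𝒱, f₁.HomotopicRel f₂ Oᶜ ∧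
        (∀ x, ContMDiffAt 𝓘(ℝ, V) 𝓘(ℝ, E) ∞ f₁ x → ContMDiffAt 𝓘(ℝ, V) 𝓘(ℝ, E) ∞ f₂ x) ∧
        ∀ x ∈ K, ContMDiffAt 𝓘(ℝ, V) 𝓘(ℝ, E) ∞ f₂ x := by
    refine hK.induction_on (p := fun K => ∃ 𝒰 : Set C(V, M), IsOpen 𝒰 ∧ f ∈ 𝒰 ∧ ∀ f₁ ∈ 𝒰,
      ∀ 𝒱 : Set C(V, M), IsOpen 𝒱 → f₁ ∈ 𝒱 → ∃ f₂ ∈ 𝒱, f₁.HomotopicRel f₂ Oᶜ ∧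
        (∀ x, ContMDiffAt 𝓘(ℝ, V) 𝓘(ℝ, E) ∞ f₁ x → ContMDiffAt 𝓘(ℝ, V) 𝓘(ℝ, E) ∞ f₂ x) ∧
        ∀ x ∈ K, ContMDiffAt 𝓘(ℝ, V) 𝓘(ℝ, E) ∞ f₂ x) ?_ ?_ ?_ ?_
    · exact ⟨univ, isOpen_univ, mem_univ _, fun f₁ _ 𝒱 _ h => ⟨f₁, h, .refl _, fun _ => id,
        fun x hx => hx.elim⟩⟩
    · rintro s t hst ⟨𝒰, h1, h2, h3⟩
      refine ⟨𝒰, h1, h2, fun f₁ hf₁ 𝒱 h𝒱 hf𝒱 => ?_⟩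
      obtain ⟨f₂, h4, h5, h6, h7⟩ := h3 f₁ hf₁ 𝒱 h𝒱 hf𝒱
      exact ⟨f₂, h4, h5, h6, fun x hx => h7 x (hst hx)⟩
    · rintro s t ⟨𝒰, h1, h2, h3⟩ ⟨𝒰', h1', h2', h3'⟩
      refine ⟨𝒰 ∩ 𝒰', h1.inter h1', ⟨h2, h2'⟩, fun f₁ hf₁ 𝒱 h𝒱 hf𝒱 => ?_⟩
      -- The first modification is asked to remain in `𝒰'`, where the second one applies; the second
      -- preserves the points smoothed by the first.
      obtain ⟨f₂, h4, h5, h6, h7⟩ := h3 f₁ hf₁.1 (𝒱 ∩ 𝒰') (h𝒱.inter h1') ⟨hf𝒱, hf₁.2⟩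
      obtain ⟨f₃, h4', h5', h6', h7'⟩ := h3' f₂ h4.2 𝒱 h𝒱 h4.1
      exact ⟨f₃, h4', h5.trans h5', fun x hx => h6' x (h6 x hx),
        fun x hx => hx.elim (fun hx => h6' x (h7 x hx)) (h7' x)⟩
    · intro x hx
      obtain ⟨D, hD, h⟩ := exists_smoothing_local (E := E) hO f (hKO hx)
      exact ⟨D, mem_nhdsWithin_of_mem_nhds hD, h⟩
  obtain ⟨𝒰, -, h2, h3⟩ := key
  obtain ⟨f₂, -, h5, h6, h7⟩ := h3 f h2 univ isOpen_univ (mem_univ _)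
  refine ⟨f₂, fun x => ?_, h5⟩
  by_cases hx : x ∈ K
  exacts [h7 x hx, h6 x (hf x hx)]

end Smoothing

/-! ### Coordinates on the unit cube -/

section Cube

variable {n : ℕ}

theorem toCube_coe (s : Fin n → I) : toCube (fun i => (s i : ℝ)) = s :=
  funext fun i => projIcc_val zero_le_one (s i)

theorem coe_mem_Icc (s : Fin n → I) : (fun i => (s i : ℝ)) ∈ Icc (0 : Fin n → ℝ) 1 :=
  ⟨fun i => (s i).2.1, fun i => (s i).2.2⟩

theorem coe_projIcc {t : ℝ} (ht : t ∈ Icc (0 : ℝ) 1) : (projIcc 0 1 zero_le_one t : ℝ) = t := by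
  rw [projIcc_of_mem _ ht]

theorem coe_toCube {s : Fin n → ℝ} (hs : s ∈ Icc (0 : Fin n → ℝ) 1) (i : Fin n) :
    (toCube s i : ℝ) = s i := coe_projIcc ⟨hs.1 i, hs.2 i⟩

theorem toCube_snoc (s : Fin n → ℝ) (t : ℝ) :
    toCube (Fin.snoc (α := fun _ => ℝ) s t) =
      Fin.snoc (α := fun _ => I) (toCube s) (projIcc 0 1 zero_le_one t) := by
  funext i
  refine Fin.lastCases ?_ (fun j => ?_) i <;> simp [toCube]

theorem continuous_toCube : Continuous (toCube : (Fin n → ℝ) → Fin n → I) :=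
  continuous_pi fun i => continuous_projIcc.comp (continuous_apply i)

theorem snoc_mem_Icc {s : Fin n → ℝ} (hs : s ∈ Icc (0 : Fin n → ℝ) 1) {t : ℝ}
    (ht : t ∈ Icc (0 : ℝ) 1) :
    (Fin.snoc (α := fun _ => ℝ) s t : Fin (n + 1) → ℝ) ∈ Icc (0 : Fin (n + 1) → ℝ) 1 := by
  constructor <;> intro i <;> refine Fin.lastCases ?_ (fun j => ?_) i
  · simpa using ht.1
  · simpa using hs.1 j
  · simpa using ht.2
  · simpa using hs.2 j

theorem uniqueDiffOn_cube : UniqueDiffOn ℝ (Icc (0 : Fin n → ℝ) 1) :=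
  uniqueDiffOn_convex (convex_Icc _ _) (by
    rw [← pi_univ_Icc, interior_pi_set finite_univ]
    refine ⟨fun _ => 1 / 2, fun i _ => ?_⟩
    simp only [Pi.zero_apply, Pi.one_apply, interior_Icc, mem_Ioo]
    norm_num)

end Cube

/-! ### Smooth families of loops and the pull-back of a connection -/

section Families

variable {E : Type*} [NormedAddCommGroup E] [NormedSpace ℝ E]
  {M : Type*} [TopologicalSpace M] [ChartedSpace E M] {x₀ : M} {n : ℕ}
  {V : Type*} [NormedAddCommGroup V] [NormedSpace ℝ V] {S : Set V} {x : V → Ω^ (Fin n) M x₀}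
  {V' : Type*} [NormedAddCommGroup V'] [NormedSpace ℝ V'] {S' : Set V'}

theorem IsSmoothFamily.comp (hx : IsSmoothFamily E S x) {c : V' → V} (hc : ContDiffOn ℝ ∞ c S')
    (hS : MapsTo c S' S) : IsSmoothFamily E S' (fun q => x (c q)) := by
  have h1 : ContMDiffOn 𝓘(ℝ, V' × (Fin n → ℝ)) 𝓘(ℝ, V × (Fin n → ℝ)) ∞
      (fun z : V' × (Fin n → ℝ) => (c z.1, z.2)) (S' ×ˢ Icc 0 1) :=
    ((hc.comp contDiffOn_fst fun z hz => hz.1).prodMk contDiffOn_snd).contMDiffOn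
  exact ContMDiffOn.comp (g := fun z : V × (Fin n → ℝ) => x z.1 (toCube z.2)) hx h1
    fun z hz => ⟨hS hz.1, hz.2⟩

theorem IsSmoothFamily.eval (hx : IsSmoothFamily E S x) (s : Fin n → I) :
    ContMDiffOn 𝓘(ℝ, V) 𝓘(ℝ, E) ∞ (fun q => x q s) S := by
  have h1 : ContMDiffOn 𝓘(ℝ, V) 𝓘(ℝ, V × (Fin n → ℝ)) ∞
      (fun q : V => (q, fun i => (s i : ℝ))) S :=
    (contDiffOn_id.prodMk contDiffOn_const).contMDiffOn
  have h2 := ContMDiffOn.comp (g := fun z : V × (Fin n → ℝ) => x z.1 (toCube z.2)) hx h1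
    fun z hz => ⟨hz, coe_mem_Icc s⟩
  refine h2.congr fun q _ => ?_
  simp only [Function.comp_apply, toCube_coe]

theorem IsSmoothFamily.isSmoothLoop (hx : IsSmoothFamily E S x) {q : V} (hq : q ∈ S) :
    IsSmoothLoop E (x q) := by
  have h1 : ContMDiffOn 𝓘(ℝ, Fin n → ℝ) 𝓘(ℝ, V × (Fin n → ℝ)) ∞
      (fun s : Fin n → ℝ => (q, s)) (Icc 0 1) :=
    (contDiffOn_const.prodMk contDiffOn_id).contMDiffOn
  exact ContMDiffOn.comp (g := fun z : V × (Fin n → ℝ) => x z.1 (toCube z.2)) hx h1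
    fun z hz => ⟨hq, hz⟩

theorem velocity_eq {q : V} {s : Fin n → I} {L : V →L[ℝ] E}
    (h : HasTDerivWithinAt (fun q' => x q' s) L S q) (hS : UniqueDiffWithinAt ℝ S q) (v : V) :
    (velocity E S x q v s : E) = L v :=
  DFunLike.congr_fun (HasMFDerivWithinAt.mfderivWithin h
    (uniqueMDiffWithinAt_iff_uniqueDiffWithinAt.2 hS)) v

theorem IsSmoothFamily.exists_hasTDerivWithinAt (hx : IsSmoothFamily E S x) (s : Fin n → I) {q : V}
    (hq : q ∈ S) : ∃ L : V →L[ℝ] E, HasTDerivWithinAt (fun q' => x q' s) L S q :=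
  ⟨_, ((hx.eval s).mdifferentiableOn (by simp) q hq).hasMFDerivWithinAt⟩

theorem velocity_boundary {q : V} (hq : UniqueDiffWithinAt ℝ S q) (v : V) {s : Fin n → I}
    (hs : s ∈ Cube.boundary (Fin n)) : (velocity E S x q v s : E) = 0 := by
  have h1 : HasTDerivWithinAt (fun q' => x q' s) (0 : V →L[ℝ] E) S q :=
    (hasTDerivWithinAt_const x₀ S q).congr (fun q' _ => (x q').2 s hs) ((x q).2 s hs)
  rw [velocity_eq h1 hq]
  rfl

/-- Exhibits the velocity as a partial derivative of the joint map, hence as smooth in all variables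
together. -/
theorem IsSmoothFamily.velocity_toCube (hx : IsSmoothFamily E S x)
    (hS : UniqueDiffOn ℝ S) {q : V} (hq : q ∈ S) {s : Fin n → ℝ} (hs : s ∈ Icc (0 : Fin n → ℝ) 1)
    (v : V) : (velocity E S x q v (toCube s) : E) =
      mfderivWithin 𝓘(ℝ, V × (Fin n → ℝ)) 𝓘(ℝ, E) (fun z : V × (Fin n → ℝ) => x z.1 (toCube z.2))
        (S ×ˢ Icc 0 1) (q, s) (v, 0) := by
  have h5 : HasTDerivWithinAt (fun z : V × (Fin n → ℝ) => x z.1 (toCube z.2)) _ (S ×ˢ Icc 0 1)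
    (q, s) := (ContMDiffOn.mdifferentiableOn hx (by simp) (q, s) ⟨hq, hs⟩).hasMFDerivWithinAt
  have h6 : HasTDerivWithinAt (fun q' : V => (q', s)) (ContinuousLinearMap.inl ℝ V (Fin n → ℝ)) S q :=
    hasTDerivWithinAt_iff_hasFDerivWithinAt.2 (hasFDerivAt_prodMk_left q s).hasFDerivWithinAt
  exact velocity_eq (x := x) (HasTDerivWithinAt.comp (f := fun q' : V => (q', s)) h5 h6
    fun q' hq' => ⟨hq', hs⟩) (hS q hq) v

variable [IsManifold 𝓘(ℝ, E) ∞ M]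

/-- The derivative of a smooth map in a fixed direction is a smooth field along the map. -/
theorem contMDiffOn_mfderivWithin_apply {D : Set V} {f : V → M}
    (hf : ContMDiffOn 𝓘(ℝ, V) 𝓘(ℝ, E) ∞ f D) (hD : UniqueDiffOn ℝ D) (v : V) :
    ContMDiffOn 𝓘(ℝ, V) (𝓘(ℝ, E)).tangent ∞ (fun z =>
      (⟨f z, mfderivWithin 𝓘(ℝ, V) 𝓘(ℝ, E) f D z v⟩ : TangentBundle 𝓘(ℝ, E) M)) D := by
  have h1 := hf.contMDiffOn_tangentMapWithin (m := ∞) (by simp) (uniqueMDiffOn_iff_uniqueDiffOn.2 hD)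
  have h2 : ContMDiff 𝓘(ℝ, V) (𝓘(ℝ, V)).tangent ∞
      (fun z : V => (⟨z, v⟩ : TangentBundle 𝓘(ℝ, V) V)) :=
    contMDiff_vectorSpace_iff_contDiff.2 contDiff_const
  exact h1.comp h2.contMDiffOn (s := D) fun z hz => hz

theorem IsSmoothFamily.isTangentVector_velocity (hx : IsSmoothFamily E S x)
    (hS : UniqueDiffOn ℝ S) {q : V} (hq : q ∈ S) (v : V) :
    IsTangentVector (x q) (velocity E S x q v) := by
  refine ⟨?_, fun s hs => velocity_boundary (hS q hq) v hs⟩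
  have h1 := contMDiffOn_mfderivWithin_apply hx (hS.prod uniqueDiffOn_cube) (v, 0)
  have h3 : ContMDiff 𝓘(ℝ, Fin n → ℝ) 𝓘(ℝ, V × (Fin n → ℝ)) ∞ (fun s : Fin n → ℝ => (q, s)) :=
    (contDiff_const.prodMk contDiff_id).contMDiff
  refine (h1.comp h3.contMDiffOn (s := Icc 0 1) fun s hs => ⟨hq, hs⟩).congr fun s hs => ?_
  exact congrArg (fun e : E => (⟨x q (toCube s), e⟩ : TangentBundle 𝓘(ℝ, E) M))
    (hx.velocity_toCube hS hq hs v)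

variable {F : Type*} [NormedAddCommGroup F] [NormedSpace ℝ F] {𝒜 : FormData E M x₀ n F}

/-- The type of the fields depends on the loop. Comparing them pointwise in the model space `E`
avoids transport along `e`. -/
theorem FormData.congr (𝒜 : FormData E M x₀ n F) {N N' : Ω^ (Fin n) M x₀} (e : N = N')
    {X : FieldAlong E N} {X' : FieldAlong E N'} (h : ∀ s, (X s : E) = X' s) : 𝒜 N X = 𝒜 N' X' := by
  subst e
  exact congrArg (𝒜 N) (funext h)

/-- Naturality of the pull-back. -/
theorem FormData.pullback_comp (𝒜 : FormData E M x₀ n F) (hx : IsSmoothFamily E S x) {c : V' → V}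
    {x' : V' → Ω^ (Fin n) M x₀} {q' : V'} (hq' : q' ∈ S') (hS' : UniqueDiffWithinAt ℝ S' q')
    (hS : UniqueDiffOn ℝ S) (hc : MapsTo c S' S) {L : V' →L[ℝ] V}
    (hL : HasFDerivWithinAt c L S' q') (e : ∀ q ∈ S', x' q = x (c q)) (v : V') :
    𝒜.pullback S' x' v q' = 𝒜.pullback S x (L v) (c q') := by
  refine 𝒜.congr (e q' hq') fun s => ?_
  obtain ⟨K, hK⟩ := hx.exists_hasTDerivWithinAt s (hc hq')
  rw [velocity_eq hK (hS _ (hc hq'))]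
  have h1 : HasTDerivWithinAt (fun q => x' q s) (K.comp L) S' q' :=
    (hK.comp (hasTDerivWithinAt_iff_hasFDerivWithinAt.2 hL) hc).congr (fun q hq => by rw [e q hq])
      (by rw [e q' hq'])
  rw [velocity_eq h1 hS']
  rfl

theorem FormData.IsConnection.pullback_linear (h𝒜 : 𝒜.IsConnection) (hx : IsSmoothFamily E S x)
    (hS : UniqueDiffOn ℝ S) {q : V} (hq : q ∈ S) (a b : ℝ) (v w : V) :
    𝒜.pullback S x (a • v + b • w) q = a • 𝒜.pullback S x v q + b • 𝒜.pullback S x w q := by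
  rw [FormData.pullback, FormData.pullback, FormData.pullback,
    ← h𝒜.linear _ (hx.isSmoothLoop hq) _ _ (hx.isTangentVector_velocity hS hq v)
      (hx.isTangentVector_velocity hS hq w)]
  refine 𝒜.congr rfl fun s => ?_
  obtain ⟨K, hK⟩ := hx.exists_hasTDerivWithinAt s hq
  rw [velocity_eq hK (hS _ hq), map_add, map_smul, map_smul]
  exact congrArg₂ (· + ·) (congrArg (a • ·) (velocity_eq hK (hS _ hq) v).symm)
    (congrArg (b • ·) (velocity_eq hK (hS _ hq) w).symm)

theorem FormData.IsConnection.pullback_smul (h𝒜 : 𝒜.IsConnection) (hx : IsSmoothFamily E S x)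
    (hS : UniqueDiffOn ℝ S) {q : V} (hq : q ∈ S) (a : ℝ) (v : V) :
    𝒜.pullback S x (a • v) q = a • 𝒜.pullback S x v q := by
  simpa using h𝒜.pullback_linear hx hS hq a 0 v v

/-- The pull-back vanishes along a family that is constant equal to the constant loop. -/
theorem FormData.IsConnection.pullback_const (h𝒜 : 𝒜.IsConnection) {q : V}
    (hS : UniqueDiffWithinAt ℝ S q) (hq : q ∈ S) (hx : ∀ q ∈ S, x q = GenLoop.const) (v : V) :
    𝒜.pullback S x v q = 0 := by
  have h0 : IsTangentVector (E := E) (GenLoop.const : Ω^ (Fin n) M x₀) (fun _ => (0 : E)) :=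
    ⟨contMDiffOn_const (c := (⟨x₀, 0⟩ : TangentBundle 𝓘(ℝ, E) M)), fun _ _ => rfl⟩
  -- Linearity with both coefficients `0` gives the value `0` on the zero field.
  have h1 := h𝒜.linear GenLoop.const (contMDiffOn_const (c := x₀)) _ _ h0 h0 0 0
  replace h1 := h1.trans (by rw [zero_smul, add_zero] :
    _ = (0 : F))
  rw [← h1]
  refine 𝒜.congr (hx q hq) fun s => ?_
  have h2 : HasTDerivWithinAt (fun q' => x q' s) (0 : V →L[ℝ] E) S q :=
    (hasTDerivWithinAt_const x₀ S q).congr (fun q' hq' => by rw [hx q' hq']; rfl)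
      (by rw [hx q hq]; rfl)
  rw [velocity_eq h2 hS]
  have h3 : (0 : E) = (0 : ℝ) • (0 : E) + (0 : ℝ) • (0 : E) := by simp
  exact h3

variable {k : ℕ} (e : (Fin k → ℝ) ≃L[ℝ] V)

/-- `IsConnection` and `IsFlat` test families over cubes in `Fin k → ℝ`. The linear equivalence `e`
carries their consequences to the interval in `ℝ` and the square in `ℝ × ℝ`. -/
theorem FormData.pullback_equiv (𝒜 : FormData E M x₀ n F) (he : e ⁻¹' S = Icc 0 1)
    (hx : IsSmoothFamily E S x) (hS : UniqueDiffOn ℝ S) {q : Fin k → ℝ} (hq : q ∈ Icc 0 1)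
    (v : Fin k → ℝ) :
    𝒜.pullback (Icc 0 1) (fun q => x (e q)) v q = 𝒜.pullback S x (e v) (e q) :=
  𝒜.pullback_comp hx hq (uniqueDiffOn_cube q hq) hS (fun q hq => by rwa [← he] at hq)
    e.hasFDerivWithinAt (fun _ _ => rfl) v

theorem IsSmoothFamily.comp_equiv (hx : IsSmoothFamily E S x) (he : e ⁻¹' S = Icc 0 1) :
    IsSmoothFamily E (Icc 0 1) (fun q => x (e q)) :=
  hx.comp e.contDiff.contDiffOn fun q hq => by rwa [← he] at hq

theorem FormData.IsConnection.contDiffOn_pullback (h𝒜 : 𝒜.IsConnection) (he : e ⁻¹' S = Icc 0 1)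
    (hx : IsSmoothFamily E S x) (hS : UniqueDiffOn ℝ S) (v : V) :
    ContDiffOn ℝ 1 (𝒜.pullback S x v) S := by
  have h1 : ContDiffOn ℝ 1 (fun q => 𝒜.pullback S x v (e q)) (Icc 0 1) := by
    refine (h𝒜.contDiff k (fun q => x (e q)) (hx.comp_equiv e he) (e.symm v)).congr fun q hq => ?_
    rw [𝒜.pullback_equiv e he hx hS hq, e.apply_symm_apply]
  have h2 : ContDiffOn ℝ 1 (fun q => 𝒜.pullback S x v (e (e.symm q))) S :=
    h1.comp e.symm.contDiff.contDiffOn fun q hq => by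
      rw [← he, mem_preimage, e.apply_symm_apply]; exact hq
  simpa using h2

theorem FormData.IsFlat.curvature_eq_zero {G : Type*} [TopologicalSpace G] [ChartedSpace F G]
    [Group G] (hF : 𝒜.IsFlat G)
    (e : (Fin 2 → ℝ) ≃L[ℝ] V) (he : e ⁻¹' S = Icc 0 1) (hx : IsSmoothFamily E S x)
    (hS : UniqueDiffOn ℝ S) {q : V} (hq : q ∈ S) (u v : V) :
    fderivWithin ℝ (𝒜.pullback S x v) S q u - fderivWithin ℝ (𝒜.pullback S x u) S q v
      + bracket G (𝒜.pullback S x u q) (𝒜.pullback S x v q) = 0 := by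
  have hq' : e.symm q ∈ Icc (0 : Fin 2 → ℝ) 1 := by
    rw [← he, mem_preimage, e.apply_symm_apply]; exact hq
  have h1 := hF _ (hx.comp_equiv e he) (e.symm q) hq' (e.symm u) (e.symm v)
  have h2 : ∀ u v : V, fderivWithin ℝ (𝒜.pullback (Icc 0 1) (fun q => x (e q)) (e.symm v))
      (Icc 0 1) (e.symm q) (e.symm u) = fderivWithin ℝ (𝒜.pullback S x v) S q u := by
    intro u v
    have h3 : EqOn (𝒜.pullback (Icc 0 1) (fun q => x (e q)) (e.symm v))
        (𝒜.pullback S x v ∘ e) (Icc 0 1) := fun q hq => by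
      rw [𝒜.pullback_equiv e he hx hS hq, e.apply_symm_apply]; rfl
    rw [fderivWithin_congr h3 (h3 hq'), ← he, e.comp_right_fderivWithin
      (by rw [he]; exact uniqueDiffOn_cube _ hq')]
    simp
  rw [h2, h2, 𝒜.pullback_equiv e he hx hS hq', 𝒜.pullback_equiv e he hx hS hq'] at h1
  simpa using h1

end Families

/-! ### An `(n+1)`-loop as a loop of `n`-loops -/

section Slices

variable {E : Type*} [NormedAddCommGroup E] [NormedSpace ℝ E]
  {M : Type*} [TopologicalSpace M] [ChartedSpace E M] {x₀ : M} {n : ℕ}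
  {V : Type*} [NormedAddCommGroup V] [NormedSpace ℝ V] {S : Set V}

/-- The `n`-loops that a family of `(n+1)`-loops consists of. -/
def sliceFamily (A : V → Ω^ (Fin (n + 1)) M x₀) (z : V × ℝ) : Ω^ (Fin n) M x₀ :=
  slice (A z.1) (projIcc 0 1 zero_le_one z.2)

theorem contDiff_snoc : ContDiff ℝ ∞
    (fun z : (Fin n → ℝ) × ℝ => (Fin.snoc (α := fun _ => ℝ) z.1 z.2 : Fin (n + 1) → ℝ)) := by
  rw [contDiff_pi]
  intro i
  refine Fin.lastCases ?_ (fun j => ?_) i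
  · simpa using contDiff_snd
  · simp only [Fin.snoc_castSucc]
    exact (contDiff_apply ℝ ℝ j).comp contDiff_fst

theorem sliceFamily_toCube (A : V → Ω^ (Fin (n + 1)) M x₀) (z : V × ℝ) (s : Fin n → ℝ) :
    sliceFamily A z (toCube s) = A z.1 (toCube (Fin.snoc (α := fun _ => ℝ) s z.2)) := by
  rw [toCube_snoc]
  rfl

theorem IsSmoothFamily.sliceFamily {A : V → Ω^ (Fin (n + 1)) M x₀} (hA : IsSmoothFamily E S A) :
    IsSmoothFamily E (S ×ˢ Icc (0 : ℝ) 1) (sliceFamily A) := by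
  have h1 : ContDiff ℝ ∞ (fun z : (V × ℝ) × (Fin n → ℝ) =>
      (z.1.1, (Fin.snoc (α := fun _ => ℝ) z.2 z.1.2 : Fin (n + 1) → ℝ))) :=
    (contDiff_fst.comp contDiff_fst).prodMk
      (contDiff_snoc.comp (contDiff_snd.prodMk (contDiff_snd.comp contDiff_fst)))
  refine (ContMDiffOn.comp (g := fun z : V × (Fin (n + 1) → ℝ) => A z.1 (toCube z.2)) hA
    h1.contMDiff.contMDiffOn (s := (S ×ˢ Icc (0 : ℝ) 1) ×ˢ Icc (0 : Fin n → ℝ) 1)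
    fun z hz => ⟨hz.1.1, snoc_mem_Icc hz.2 hz.1.2⟩).congr fun z _ => ?_
  exact sliceFamily_toCube A z.1 z.2

theorem IsSmoothLoop.isSmoothFamily {α : Ω^ (Fin n) M x₀} (hα : IsSmoothLoop E α) (S : Set V) :
    IsSmoothFamily E S (fun _ : V => α) :=
  ContMDiffOn.comp (g := fun s : Fin n → ℝ => α (toCube s)) hα contDiff_snd.contMDiff.contMDiffOn
    fun _ hz => hz.2

/-- The loop in the space of `n`-loops that an `(n+1)`-loop describes. -/
def loopFamily (α : Ω^ (Fin (n + 1)) M x₀) (t : ℝ) : Ω^ (Fin n) M x₀ :=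
  slice α (projIcc 0 1 zero_le_one t)

theorem IsSmoothLoop.loopFamily {α : Ω^ (Fin (n + 1)) M x₀} (hα : IsSmoothLoop E α) :
    IsSmoothFamily E (Icc (0 : ℝ) 1) (loopFamily α) :=
  ((hα.isSmoothFamily (univ : Set ℝ)).sliceFamily).comp (c := fun t : ℝ => ((0 : ℝ), t))
    (contDiff_const.prodMk contDiff_id).contDiffOn fun _ ht => ⟨mem_univ _, ht⟩

theorem slice_eq_const (α : Ω^ (Fin (n + 1)) M x₀) {t : I} (ht : t = 0 ∨ t = 1) :
    slice α t = GenLoop.const := by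
  ext s
  exact α.2 _ ⟨Fin.last n, by simpa using ht⟩

end Slices

/-! ### Existence, uniqueness and homotopy invariance of holonomy -/

section Holonomy

variable {E : Type*} [NormedAddCommGroup E] [NormedSpace ℝ E]
  {M : Type*} [TopologicalSpace M] [ChartedSpace E M] [IsManifold 𝓘(ℝ, E) ∞ M] {x₀ : M} {n : ℕ}
  {F : Type*} [NormedAddCommGroup F] [NormedSpace ℝ F]
  {G : Type*} [TopologicalSpace G] [ChartedSpace F G] [Group G] [LieGroup 𝓘(ℝ, F) ∞ G]
  {𝒜 : FormData E M x₀ n F}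

theorem funUnique_preimage :
    (ContinuousLinearEquiv.funUnique (Fin 1) ℝ ℝ) ⁻¹' Icc (0 : ℝ) 1 = Icc 0 1 := by
  ext q
  simp [Pi.le_def]

theorem finTwoArrow_preimage :
    (ContinuousLinearEquiv.finTwoArrow ℝ ℝ) ⁻¹' (Icc (0 : ℝ) 1 ×ˢ Icc (0 : ℝ) 1) = Icc 0 1 := by
  ext q
  simp [Pi.le_def, Fin.forall_fin_two]

theorem FormData.IsConnection.continuousOn_loopFamily (h𝒜 : 𝒜.IsConnection)
    {α : Ω^ (Fin (n + 1)) M x₀} (hα : IsSmoothLoop E α) :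
    ContinuousOn (𝒜.pullback (Icc 0 1) (loopFamily α) 1) (Icc (0 : ℝ) 1) :=
  (h𝒜.contDiffOn_pullback _ funUnique_preimage hα.loopFamily
    (uniqueDiffOn_Icc zero_lt_one) 1).continuousOn

theorem FormData.IsConnection.existsUnique_isHolonomy [CompleteSpace F] (h𝒜 : 𝒜.IsConnection)
    {α : Ω^ (Fin (n + 1)) M x₀} (hα : IsSmoothLoop E α) : ∃! h : G, 𝒜.IsHolonomy α h := by
  obtain ⟨W, hW0, hW⟩ := exists_hasRightLogDeriv_Icc (zero_le_one' ℝ)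
    (h𝒜.continuousOn_loopFamily hα).neg (1 : G)
  refine ⟨W 1, ⟨W, hW0, rfl, hW⟩, ?_⟩
  rintro _ ⟨V, hV0, rfl, hV⟩
  exact HasRightLogDeriv.eqOn hV hW (hV0.trans hW0.symm) (right_mem_Icc.2 zero_le_one)

/-- Invariance of the holonomy of a flat connection under smooth homotopies. -/
theorem FormData.IsFlat.isHolonomy_eq [CompleteSpace F] (hF : 𝒜.IsFlat G) (h𝒜 : 𝒜.IsConnection)
    {A : ℝ → Ω^ (Fin (n + 1)) M x₀} (hA : IsSmoothFamily E (Icc (0 : ℝ) 1) A) {g₀ g₁ : G}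
    (h₀ : 𝒜.IsHolonomy (A 0) g₀) (h₁ : 𝒜.IsHolonomy (A 1) g₁) : g₀ = g₁ := by
  have h0J : (0 : ℝ) ∈ Icc (0 : ℝ) 1 := left_mem_Icc.2 zero_le_one
  have h1J : (1 : ℝ) ∈ Icc (0 : ℝ) 1 := right_mem_Icc.2 zero_le_one
  have hex : ∀ s : ℝ, ∃ W : ℝ → G, s ∈ Icc (0 : ℝ) 1 → W 0 = 1 ∧ ∀ τ ∈ Icc (0 : ℝ) 1,
      HasRightLogDeriv W (-𝒜.pullback (Icc 0 1) (loopFamily (A s)) 1 τ) (Icc 0 1) τ := by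
    intro s
    by_cases hs : s ∈ Icc (0 : ℝ) 1
    · obtain ⟨_, ⟨W, hW0, -, hW⟩, -⟩ := h𝒜.existsUnique_isHolonomy (G := G) (hA.isSmoothLoop hs)
      exact ⟨W, fun _ => ⟨hW0, hW⟩⟩
    · exact ⟨fun _ => 1, fun h => absurd h hs⟩
  choose W hW using hex
  have e₀ : g₀ = W 0 1 := (h𝒜.existsUnique_isHolonomy (hA.isSmoothLoop h0J)).unique h₀
    ⟨W 0, (hW 0 h0J).1, rfl, (hW 0 h0J).2⟩
  have e₁ : g₁ = W 1 1 := (h𝒜.existsUnique_isHolonomy (hA.isSmoothLoop h1J)).unique h₁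
    ⟨W 1, (hW 1 h1J).1, rfl, (hW 1 h1J).2⟩
  rw [e₀, e₁]
  have hx := hA.sliceFamily
  have hu := uniqueDiffOn_unitSquare
  have hI := uniqueDiffOn_Icc (zero_lt_one' ℝ)
  -- The first coordinate is the homotopy parameter, the second the loop time. The coefficient along
  -- the homotopy vanishes at the times `0` and `1`, where each slice is the constant loop.
  refine transport_eq_of_flat (W := W)
    (h𝒜.contDiffOn_pullback _ finTwoArrow_preimage hx hu (0, 1))
    (h𝒜.contDiffOn_pullback _ finTwoArrow_preimage hx hu (1, 0))
    (fun z hz => hF.curvature_eq_zero _ finTwoArrow_preimage hx hu hz (1, 0) (0, 1))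
    (fun s hs => ?_) (fun s hs => ?_) (fun s hs => (hW s hs).1) (fun s hs t ht => ?_) h0J h1J
  · have h1 := 𝒜.pullback_comp hx (x' := fun s => sliceFamily A (s, 0)) hs (hI s hs) hu
      (fun s hs => ⟨hs, h0J⟩) (hasFDerivAt_prodMk_left s (0 : ℝ)).hasFDerivWithinAt
      (fun _ _ => rfl) 1
    refine h1.symm.trans (h𝒜.pullback_const (hI s hs) hs (fun s _ => slice_eq_const _ ?_) _)
    left; simp
  · have h1 := 𝒜.pullback_comp hx (x' := fun s => sliceFamily A (s, 1)) hs (hI s hs) hu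
      (fun s hs => ⟨hs, h1J⟩) (hasFDerivAt_prodMk_left s (1 : ℝ)).hasFDerivWithinAt
      (fun _ _ => rfl) 1
    refine h1.symm.trans (h𝒜.pullback_const (hI s hs) hs (fun s _ => slice_eq_const _ ?_) _)
    right; simp
  · have h1 := 𝒜.pullback_comp hx (x' := loopFamily (A s)) ht (hI t ht) hu
      (fun t ht => ⟨hs, ht⟩) (hasFDerivAt_prodMk_right s t).hasFDerivWithinAt
      (fun _ _ => rfl) 1
    have h2 := (hW s hs).2 t ht
    rw [h1] at h2
    exact h2

end Holonomy

/-! ### Smooth representatives of loops and of homotopies -/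

section SmoothRepresentatives

/-- A smooth step function, equal to `0` for `t ≤ 1/3` and to `1` for `2/3 ≤ t`. -/
def smoothStep (t : ℝ) : ℝ := Real.smoothTransition (3 * t - 1)

theorem contDiff_smoothStep : ContDiff ℝ ∞ smoothStep :=
  Real.smoothTransition.contDiff.comp ((contDiff_const.mul contDiff_id).sub contDiff_const)

theorem smoothStep_mem (t : ℝ) : smoothStep t ∈ Icc (0 : ℝ) 1 :=
  ⟨Real.smoothTransition.nonneg _, Real.smoothTransition.le_one _⟩

theorem smoothStep_eq_zero {t : ℝ} (ht : t ≤ 1 / 3) : smoothStep t = 0 :=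
  Real.smoothTransition.zero_of_nonpos (by linarith)

theorem smoothStep_eq_one {t : ℝ} (ht : 2 / 3 ≤ t) : smoothStep t = 1 :=
  Real.smoothTransition.one_of_one_le (by linarith)

variable {E : Type*} [NormedAddCommGroup E] [NormedSpace ℝ E]
  {M : Type*} [TopologicalSpace M] [ChartedSpace E M] {x₀ : M} {m : ℕ}

theorem continuous_coe_cube : Continuous (fun (s : Fin m → I) (i : Fin m) => (s i : ℝ)) :=
  continuous_pi fun i => continuous_subtype_val.comp (continuous_apply i)

theorem toCube_mem_boundary {y : Fin m → ℝ} {i : Fin m} (h : y i ≤ 0 ∨ 1 ≤ y i) :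
    toCube y ∈ Cube.boundary (Fin m) :=
  ⟨i, h.imp (fun h => projIcc_of_le_left _ h) fun h => projIcc_of_right_le _ h⟩

/-- Reparametrization by the smooth step function, for `r = 1`, and the straight homotopy to it. -/
def reparam (α : Ω^ (Fin m) M x₀) (r : ℝ) : Ω^ (Fin m) M x₀ :=
  ⟨⟨fun s => α (toCube fun i => (1 - r) * s i + r * smoothStep (s i)), by
      have h1 : Continuous smoothStep := contDiff_smoothStep.continuous
      refine (map_continuous α.1).comp (continuous_toCube.comp (continuous_pi fun i => ?_))
      have h2 : Continuous fun s : Fin m → I => (s i : ℝ) :=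
        continuous_subtype_val.comp (continuous_apply i)
      fun_prop⟩, by
    rintro s ⟨i, hi⟩
    refine α.2 _ (toCube_mem_boundary (i := i) ?_)
    rcases hi with hi | hi
    · left
      simp [hi, smoothStep_eq_zero]
    · right
      simp [hi, smoothStep_eq_one (show (2 / 3 : ℝ) ≤ 1 by norm_num)]⟩

theorem reparam_apply (α : Ω^ (Fin m) M x₀) (r : ℝ) (s : Fin m → I) :
    reparam α r s = α (toCube fun i => (1 - r) * s i + r * smoothStep (s i)) := rfl

theorem reparam_zero (α : Ω^ (Fin m) M x₀) : reparam α 0 = α := by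
  ext s
  rw [reparam_apply]
  simp [toCube_coe]

theorem convexComb_mem {r : ℝ} (hr : r ∈ Icc (0 : ℝ) 1) {a b : ℝ} (ha : a ∈ Icc (0 : ℝ) 1)
    (hb : b ∈ Icc (0 : ℝ) 1) : (1 - r) * a + r * b ∈ Icc (0 : ℝ) 1 :=
  convex_Icc (0 : ℝ) 1 ha hb (sub_nonneg.2 hr.2) hr.1 (sub_add_cancel _ _)

theorem IsSmoothLoop.isSmoothFamily_reparam {α : Ω^ (Fin m) M x₀} (hα : IsSmoothLoop E α) :
    IsSmoothFamily E (Icc (0 : ℝ) 1) (reparam α) := by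
  have h1 : ContDiff ℝ ∞ (fun z : ℝ × (Fin m → ℝ) => fun i : Fin m =>
      (1 - z.1) * z.2 i + z.1 * smoothStep (z.2 i)) := by
    have := contDiff_smoothStep
    fun_prop
  refine (ContMDiffOn.comp (g := fun s : Fin m → ℝ => α (toCube s)) hα
    h1.contMDiff.contMDiffOn (s := Icc (0 : ℝ) 1 ×ˢ Icc (0 : Fin m → ℝ) 1) ?_).congr ?_
  · intro z hz
    have h2 : ∀ i, (1 - z.1) * z.2 i + z.1 * smoothStep (z.2 i) ∈ Icc (0 : ℝ) 1 := fun i =>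
      convexComb_mem hz.1 ⟨hz.2.1 i, hz.2.2 i⟩ (smoothStep_mem _)
    exact ⟨fun i => (h2 i).1, fun i => (h2 i).2⟩
  · intro z hz
    simp only [reparam_apply, Function.comp_apply, coe_toCube hz.2]

theorem homotopic_reparam (α : Ω^ (Fin m) M x₀) : GenLoop.Homotopic α (reparam α 1) := by
  refine ⟨⟨⟨⟨fun z => reparam α z.1 z.2, ?_⟩, fun s => ?_, fun s => ?_⟩, fun t s hs => ?_⟩⟩
  · have h1 : Continuous smoothStep := contDiff_smoothStep.continuous
    refine (map_continuous α.1).comp (continuous_toCube.comp (continuous_pi fun i => ?_))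
    have h2 : Continuous fun z : I × (Fin m → I) => (z.2 i : ℝ) :=
      continuous_subtype_val.comp ((continuous_apply i).comp continuous_snd)
    have h3 : Continuous fun z : I × (Fin m → I) => (z.1 : ℝ) :=
      continuous_subtype_val.comp continuous_fst
    fun_prop
  · simp only [Icc.coe_zero, reparam_zero]; rfl
  · rfl
  · exact ((reparam α t).2 s hs).trans (α.2 s hs).symm

/-- The loop `reparam α 1`, extended to `ℝᵐ`. -/
def extendLoop (α : Ω^ (Fin m) M x₀) : C(Fin m → ℝ, M) :=
  ⟨fun y => α (toCube fun i => smoothStep (y i)), by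
    have h1 : Continuous smoothStep := contDiff_smoothStep.continuous
    exact (map_continuous α.1).comp (continuous_toCube.comp (by fun_prop))⟩

theorem extendLoop_apply (α : Ω^ (Fin m) M x₀) (y : Fin m → ℝ) :
    extendLoop α y = α (toCube fun i => smoothStep (y i)) := rfl

theorem extendLoop_coe (α : Ω^ (Fin m) M x₀) (s : Fin m → I) :
    extendLoop α (fun i => (s i : ℝ)) = reparam α 1 s := by
  simp [reparam_apply, extendLoop_apply]

theorem toCube_smoothStep_mem_boundary {y : Fin m → ℝ} {i : Fin m} (h : y i ≤ 1 / 3 ∨ 2 / 3 ≤ y i) :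
    toCube (fun i => smoothStep (y i)) ∈ Cube.boundary (Fin m) :=
  toCube_mem_boundary (i := i)
    (h.imp (fun h => (smoothStep_eq_zero h).le) fun h => (smoothStep_eq_one h).ge)

theorem extendLoop_eq (α : Ω^ (Fin m) M x₀) {y : Fin m → ℝ} {i : Fin m}
    (h : y i ≤ 1 / 3 ∨ 2 / 3 ≤ y i) : extendLoop α y = x₀ :=
  α.2 _ (toCube_smoothStep_mem_boundary h)

theorem IsSmoothLoop.contMDiff_extendLoop {α : Ω^ (Fin m) M x₀} (hα : IsSmoothLoop E α) :
    ContMDiff 𝓘(ℝ, Fin m → ℝ) 𝓘(ℝ, E) ∞ (extendLoop α) := by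
  have h1 : ContDiff ℝ ∞ (fun y : Fin m → ℝ => fun i : Fin m => smoothStep (y i)) := by
    have := contDiff_smoothStep
    fun_prop
  rw [← contMDiffOn_univ]
  exact ContMDiffOn.comp (g := fun s : Fin m → ℝ => α (toCube s)) hα h1.contMDiff.contMDiffOn
    fun y _ => ⟨fun i => (smoothStep_mem _).1, fun i => (smoothStep_mem _).2⟩

theorem exists_le_or_ge_of_notMem_Icc {y : Fin m → ℝ} {a b : ℝ}
    (hy : y ∉ Icc (fun _ => a) (fun _ => b)) : ∃ i, y i < a ∨ b < y i := by
  by_contra! h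
  exact hy ⟨fun i => (h i).1, fun i => (h i).2⟩

theorem eventually_lt_or_gt {y : Fin m → ℝ} {a b : ℝ} {i : Fin m} (h : y i < a ∨ b < y i) :
    ∀ᶠ y' in 𝓝 y, y' i ≤ a ∨ b ≤ y' i := by
  rcases h with h | h
  · filter_upwards [(continuous_apply i).continuousAt.eventually (Iio_mem_nhds h)] with y' hy'
      using Or.inl (le_of_lt hy')
  · filter_upwards [(continuous_apply i).continuousAt.eventually (Ioi_mem_nhds h)] with y' hy'
      using Or.inr (le_of_lt hy')

/-- The open unit cube. -/
def openCube (m : ℕ) : Set (Fin m → ℝ) := univ.pi fun _ => Ioo 0 1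

theorem isOpen_openCube : IsOpen (openCube m) := isOpen_set_pi finite_univ fun _ _ => isOpen_Ioo

theorem Icc_subset_openCube :
    Icc (fun _ => 1 / 3) (fun _ => 2 / 3) ⊆ openCube m := fun y hy i _ =>
  ⟨lt_of_lt_of_le (by norm_num) (hy.1 i), lt_of_le_of_lt (hy.2 i) (by norm_num)⟩

theorem exists_of_notMem_openCube {y : Fin m → ℝ} (hy : y ∉ openCube m) :
    ∃ i, y i ≤ 1 / 3 ∨ 2 / 3 ≤ y i := by
  by_contra! h
  exact hy fun i _ => ⟨by linarith [(h i).1], by linarith [(h i).2]⟩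

theorem coe_notMem_openCube {s : Fin m → I} (hs : s ∈ Cube.boundary (Fin m)) :
    (fun i => (s i : ℝ)) ∉ openCube m := by
  obtain ⟨i, hi⟩ := hs
  intro h
  have h1 := h i (mem_univ i)
  rcases hi with hi | hi <;> simp [hi] at h1

theorem homotopicRel_comp {X Y Z : Type*} [TopologicalSpace X] [TopologicalSpace Y]
    [TopologicalSpace Z] {f f' : C(Y, Z)} {T : Set Y} {B : Set X} (h : f.HomotopicRel f' T)
    (c : C(X, Y)) (hc : MapsTo c B T) : (f.comp c).HomotopicRel (f'.comp c) B := by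
  obtain ⟨H⟩ := h
  refine ⟨⟨⟨⟨fun z => H (z.1, c z.2), ?_⟩, fun x => ?_, fun x => ?_⟩, fun t x hx => ?_⟩⟩
  · exact (map_continuous H).comp (continuous_fst.prodMk (c.continuous.comp continuous_snd))
  · exact H.apply_zero _
  · exact H.apply_one _
  · exact H.prop' t (c x) (hc hx)

variable [FiniteDimensional ℝ E] [IsManifold 𝓘(ℝ, E) ∞ M]

variable (E) in
/-- Every loop is homotopic to a smooth one. -/
theorem exists_smooth_homotopic (α : Ω^ (Fin m) M x₀) :
    ∃ β : Ω^ (Fin m) M x₀, IsSmoothLoop E β ∧ GenLoop.Homotopic α β := by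
  -- The extension equals `x₀` whenever some coordinate lies outside `[1/3, 2/3]`, hence is smooth
  -- off that smaller cube. Smoothing relative to the complement of the open unit cube keeps the
  -- boundary values.
  obtain ⟨f, hf, hfr⟩ := exists_smooth_homotopicRel (E := E)
    (isCompact_Icc (a := fun _ : Fin m => (1 / 3 : ℝ)) (b := fun _ => 2 / 3))
    isOpen_openCube Icc_subset_openCube (extendLoop α) (fun y hy => by
      obtain ⟨i, hi⟩ := exists_le_or_ge_of_notMem_Icc hy
      refine (contMDiffAt_const (c := x₀)).congr_of_eventuallyEq ?_
      filter_upwards [eventually_lt_or_gt hi] with y' hy' using extendLoop_eq α hy')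
  let c : C(Fin m → I, Fin m → ℝ) := ⟨fun s i => (s i : ℝ), continuous_coe_cube⟩
  have hc : MapsTo c (Cube.boundary (Fin m)) (openCube m)ᶜ := fun s hs => coe_notMem_openCube hs
  refine ⟨⟨f.comp c, fun s hs => ?_⟩, ?_, ?_⟩
  · obtain ⟨i, hi⟩ := exists_of_notMem_openCube (hc hs)
    exact (hfr.fst_eq_snd (hc hs)).symm.trans (extendLoop_eq α hi)
  · refine hf.contMDiffOn.congr fun s hs => ?_
    exact congrArg f (funext fun i => coe_toCube hs i)
  · refine (homotopic_reparam α).trans ?_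
    have h1 := homotopicRel_comp hfr c hc
    have h2 : (extendLoop α).comp c = (reparam α 1).1 := by
      ext s
      exact extendLoop_coe α s
    rwa [h2] at h1

/-- Homotopic smooth loops are smoothly homotopic, up to a reparametrization. -/
theorem exists_isSmoothFamily_of_homotopic {α β : Ω^ (Fin m) M x₀} (hα : IsSmoothLoop E α)
    (hβ : IsSmoothLoop E β) (h : GenLoop.Homotopic α β) :
    ∃ A : ℝ → Ω^ (Fin m) M x₀, IsSmoothFamily E (Icc (0 : ℝ) 1) A ∧ A 0 = reparam α 1 ∧
      A 1 = reparam β 1 := by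
  obtain ⟨H⟩ := h
  have hstep : Continuous smoothStep := contDiff_smoothStep.continuous
  -- The step function is applied to the homotopy parameter as well. Off the product of the
  -- intervals `[1/3, 2/3]` the map is then locally the extension of `α`, the extension of `β`, or
  -- constant, and in each case smooth.
  let f : C(ℝ × (Fin m → ℝ), M) :=
    ⟨fun z => H (projIcc 0 1 zero_le_one (smoothStep z.1), toCube fun i => smoothStep (z.2 i)),
      (map_continuous H).comp ((continuous_projIcc.comp (by fun_prop)).prodMk
        (continuous_toCube.comp (by fun_prop)))⟩
  have hf0 : ∀ z : ℝ × (Fin m → ℝ), z.1 ≤ 1 / 3 → f z = extendLoop α z.2 := by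
    intro z hz
    have h1 : projIcc (0 : ℝ) 1 zero_le_one (smoothStep z.1) = 0 :=
      projIcc_of_le_left _ (smoothStep_eq_zero hz).le
    change H (projIcc (0 : ℝ) 1 zero_le_one (smoothStep z.1), _) = _
    rw [h1]
    exact H.apply_zero _
  have hf1 : ∀ z : ℝ × (Fin m → ℝ), 2 / 3 ≤ z.1 → f z = extendLoop β z.2 := by
    intro z hz
    have h1 : projIcc (0 : ℝ) 1 zero_le_one (smoothStep z.1) = 1 :=
      projIcc_of_right_le _ (smoothStep_eq_one hz).ge
    change H (projIcc (0 : ℝ) 1 zero_le_one (smoothStep z.1), _) = _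
    rw [h1]
    exact H.apply_one _
  have hfb : ∀ (z : ℝ × (Fin m → ℝ)) (i : Fin m), z.2 i ≤ 1 / 3 ∨ 2 / 3 ≤ z.2 i → f z = x₀ := by
    intro z i hi
    have h1 := toCube_smoothStep_mem_boundary hi
    exact (H.prop' _ _ h1).trans (α.2 _ h1)
  obtain ⟨f', hf', hfr⟩ := exists_smooth_homotopicRel (E := E)
    ((isCompact_Icc (a := (1 / 3 : ℝ)) (b := 2 / 3)).prod
      (isCompact_Icc (a := fun _ : Fin m => (1 / 3 : ℝ)) (b := fun _ => 2 / 3)))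
    ((isOpen_Ioo (a := (0 : ℝ)) (b := 1)).prod isOpen_openCube)
    (prod_mono (fun t ht => ⟨lt_of_lt_of_le (by norm_num) ht.1, lt_of_le_of_lt ht.2 (by norm_num)⟩)
      Icc_subset_openCube) f (fun z hz => by
      by_cases hy : z.2 ∈ Icc (fun _ : Fin m => (1 / 3 : ℝ)) (fun _ => 2 / 3)
      · have ht : z.1 < 1 / 3 ∨ 2 / 3 < z.1 := by
          by_contra! h
          exact hz ⟨h, hy⟩
        rcases ht with ht | ht
        · refine ((hα.contMDiff_extendLoop z.2).comp z
            contDiff_snd.contMDiff.contMDiffAt).congr_of_eventuallyEq ?_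
          filter_upwards [continuousAt_fst.eventually (Iio_mem_nhds ht)] with z' hz'
            using hf0 z' (le_of_lt hz')
        · refine ((hβ.contMDiff_extendLoop z.2).comp z
            contDiff_snd.contMDiff.contMDiffAt).congr_of_eventuallyEq ?_
          filter_upwards [continuousAt_fst.eventually (Ioi_mem_nhds ht)] with z' hz'
            using hf1 z' (le_of_lt hz')
      · obtain ⟨i, hi⟩ := exists_le_or_ge_of_notMem_Icc hy
        refine (contMDiffAt_const (c := x₀)).congr_of_eventuallyEq ?_
        filter_upwards [continuousAt_snd.eventually (eventually_lt_or_gt hi)] with z' hz'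
          using hfb z' i hz')
  have hb : ∀ (r : ℝ) (s : Fin m → I), s ∈ Cube.boundary (Fin m) →
      f' (r, fun i => (s i : ℝ)) = x₀ := by
    intro r s hs
    have h1 := coe_notMem_openCube hs
    obtain ⟨i, hi⟩ := exists_of_notMem_openCube h1
    exact (hfr.fst_eq_snd (show (r, fun i => (s i : ℝ)) ∈ (Ioo (0 : ℝ) 1 ×ˢ openCube m)ᶜ from
      fun h => h1 h.2)).symm.trans (hfb _ i hi)
  refine ⟨fun r => ⟨⟨fun s => f' (r, fun i => (s i : ℝ)),
    f'.continuous.comp (continuous_const.prodMk continuous_coe_cube)⟩, hb r⟩, ?_, ?_, ?_⟩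
  · refine hf'.contMDiffOn.congr fun z hz => ?_
    exact congrArg (fun y => f' (z.1, y)) (funext fun i => coe_toCube hz.2 i)
  · ext s
    -- The parameter `0` lies outside the open unit interval, where smoothing changed nothing.
    refine (hfr.fst_eq_snd (x := ((0 : ℝ), fun i => (s i : ℝ))) fun h => lt_irrefl _ h.1.1).symm.trans ?_
    rw [hf0 _ (by norm_num)]
    exact extendLoop_coe α s
  · ext s
    refine (hfr.fst_eq_snd (x := ((1 : ℝ), fun i => (s i : ℝ))) fun h => lt_irrefl _ h.1.2).symm.trans ?_
    rw [hf1 _ (by norm_num)]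
    exact extendLoop_coe β s

end SmoothRepresentatives

/-! ### Holonomy of a concatenation -/

section Concatenation

variable {E : Type*} [NormedAddCommGroup E] [NormedSpace ℝ E]
  {M : Type*} [TopologicalSpace M] [ChartedSpace E M] {x₀ : M} {n : ℕ}

/-- The concatenation, in the last variable, of the reparametrized loops. -/
def concat (α β : Ω^ (Fin (n + 1)) M x₀) : Ω^ (Fin (n + 1)) M x₀ :=
  GenLoop.transAt (Fin.last n) (reparam α 1) (reparam β 1)

theorem concat_apply (α β : Ω^ (Fin (n + 1)) M x₀) (s : Fin (n + 1) → I) :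
    concat α β s = if (s (Fin.last n) : ℝ) ≤ 1 / 2
      then reparam α 1 (Function.update s (Fin.last n)
        (projIcc 0 1 zero_le_one (2 * (s (Fin.last n) : ℝ))))
      else reparam β 1 (Function.update s (Fin.last n)
        (projIcc 0 1 zero_le_one (2 * (s (Fin.last n) : ℝ) - 1))) := rfl

theorem coe_update_last {s : Fin (n + 1) → ℝ} (hs : s ∈ Icc (0 : Fin (n + 1) → ℝ) 1) {t : ℝ}
    (ht : t ∈ Icc (0 : ℝ) 1) :
    (fun i => ((Function.update (toCube s) (Fin.last n) (projIcc 0 1 zero_le_one t) :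
      Fin (n + 1) → I) i : ℝ)) = Function.update s (Fin.last n) t := by
  funext i
  by_cases hi : i = Fin.last n
  · subst hi
    simp [coe_projIcc ht]
  · simp [hi, coe_toCube hs]

theorem concat_toCube (α β : Ω^ (Fin (n + 1)) M x₀) {s : Fin (n + 1) → ℝ}
    (hs : s ∈ Icc (0 : Fin (n + 1) → ℝ) 1) :
    concat α β (toCube s) = if s (Fin.last n) ≤ 1 / 2
      then extendLoop α (Function.update s (Fin.last n) (2 * s (Fin.last n)))
      else extendLoop β (Function.update s (Fin.last n) (2 * s (Fin.last n) - 1)) := by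
  have h0 := hs.1 (Fin.last n)
  have h1 := hs.2 (Fin.last n)
  simp only [Pi.zero_apply, Pi.one_apply] at h0 h1
  rw [concat_apply, coe_toCube hs]
  split_ifs with h
  · rw [← extendLoop_coe, coe_update_last hs ⟨by linarith, by linarith⟩]
  · rw [← extendLoop_coe, coe_update_last hs ⟨by linarith, by linarith⟩]

/-- The formula of the first half remains valid up to `2/3`, because beyond `1/2` both expressions
are `x₀`. With the mirror statement the two formulas overlap on `[1/3, 2/3]`, which makes the
concatenation smooth. -/
theorem concat_toCube_left (α β : Ω^ (Fin (n + 1)) M x₀) {s : Fin (n + 1) → ℝ}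
    (hs : s ∈ Icc (0 : Fin (n + 1) → ℝ) 1) (h : s (Fin.last n) ≤ 2 / 3) :
    concat α β (toCube s) =
      extendLoop α (Function.update s (Fin.last n) (2 * s (Fin.last n))) := by
  rw [concat_toCube α β hs]
  split_ifs with h'
  · rfl
  · rw [extendLoop_eq (i := Fin.last n), extendLoop_eq (i := Fin.last n)]
    · right; simp; linarith
    · left; simp; linarith

theorem concat_toCube_right (α β : Ω^ (Fin (n + 1)) M x₀) {s : Fin (n + 1) → ℝ}
    (hs : s ∈ Icc (0 : Fin (n + 1) → ℝ) 1) (h : 1 / 3 ≤ s (Fin.last n)) :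
    concat α β (toCube s) =
      extendLoop β (Function.update s (Fin.last n) (2 * s (Fin.last n) - 1)) := by
  rw [concat_toCube α β hs]
  split_ifs with h'
  · rw [extendLoop_eq (i := Fin.last n), extendLoop_eq (i := Fin.last n)]
    · left; simp; linarith
    · right; simp; linarith
  · rfl

theorem contDiff_update_last {c : ℝ → ℝ} (hc : ContDiff ℝ ∞ c) :
    ContDiff ℝ ∞ (fun s : Fin (n + 1) → ℝ => Function.update s (Fin.last n) (c (s (Fin.last n)))) := by
  rw [contDiff_pi]
  intro i
  by_cases hi : i = Fin.last n
  · subst hi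
    simp only [Function.update_self]
    exact hc.comp (contDiff_apply ℝ ℝ _)
  · simp only [Function.update_of_ne hi]
    exact contDiff_apply ℝ ℝ i

theorem IsSmoothLoop.concat {α β : Ω^ (Fin (n + 1)) M x₀} (hα : IsSmoothLoop E α)
    (hβ : IsSmoothLoop E β) : IsSmoothLoop E (concat α β) := by
  intro s hs
  have hl : Continuous fun s : Fin (n + 1) → ℝ => s (Fin.last n) := continuous_apply _
  have c1 : ContDiff ℝ ∞ (fun t : ℝ => 2 * t) := contDiff_const.mul contDiff_id
  have c2 : ContDiff ℝ ∞ (fun t : ℝ => 2 * t - 1) := c1.sub contDiff_const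
  rcases lt_or_ge (s (Fin.last n)) (2 / 3) with h | h
  · have h1 := (hα.contMDiff_extendLoop.comp (contDiff_update_last c1).contMDiff) s
    refine h1.contMDiffWithinAt.congr_of_eventuallyEq ?_ (concat_toCube_left α β hs h.le)
    filter_upwards [self_mem_nhdsWithin,
      mem_nhdsWithin_of_mem_nhds (hl.continuousAt.preimage_mem_nhds (Iio_mem_nhds h))] with s' h' h''
    exact concat_toCube_left α β h' (le_of_lt h'')
  · have h2 : 1 / 3 < s (Fin.last n) := by linarith
    have h1 := (hβ.contMDiff_extendLoop.comp (contDiff_update_last c2).contMDiff) s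
    refine h1.contMDiffWithinAt.congr_of_eventuallyEq ?_ (concat_toCube_right α β hs h2.le)
    filter_upwards [self_mem_nhdsWithin,
      mem_nhdsWithin_of_mem_nhds (hl.continuousAt.preimage_mem_nhds (Ioi_mem_nhds h2))] with s' h' h''
    exact concat_toCube_right α β h' (le_of_lt h'')

theorem loopFamily_concat_left (α β : Ω^ (Fin (n + 1)) M x₀) {t : ℝ} (ht : t ∈ Icc (0 : ℝ) (1 / 2)) :
    loopFamily (concat α β) t = loopFamily (reparam α 1) (2 * t) := by
  ext s
  have ht' : (projIcc 0 1 zero_le_one t : ℝ) = t := coe_projIcc ⟨ht.1, by linarith [ht.2]⟩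
  change concat α β (Fin.snoc (α := fun _ => I) s (projIcc 0 1 zero_le_one t)) =
    reparam α 1 (Fin.snoc (α := fun _ => I) s (projIcc 0 1 zero_le_one (2 * t)))
  rw [concat_apply, Fin.snoc_last, ht', if_pos ht.2, Fin.update_snoc_last]

theorem loopFamily_concat_right (α β : Ω^ (Fin (n + 1)) M x₀) {t : ℝ}
    (ht : t ∈ Icc (1 / 2 : ℝ) 1) :
    loopFamily (concat α β) t = loopFamily (reparam β 1) (2 * t - 1) := by
  -- At `t = 1/2` the definition of `concat` selects the first branch; both sides are the constant
  -- loop there.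
  rcases ht.1.eq_or_lt with h | h
  · rw [← h]
    have h1 := loopFamily_concat_left α β (t := 1 / 2) ⟨by norm_num, le_rfl⟩
    rw [h1]
    unfold loopFamily
    rw [slice_eq_const _ (Or.inr (projIcc_of_right_le _ (by norm_num))),
      slice_eq_const _ (Or.inl (projIcc_of_le_left _ (by norm_num)))]
  · ext s
    have ht' : (projIcc 0 1 zero_le_one t : ℝ) = t := coe_projIcc ⟨by linarith, ht.2⟩
    change concat α β (Fin.snoc (α := fun _ => I) s (projIcc 0 1 zero_le_one t)) =
      reparam β 1 (Fin.snoc (α := fun _ => I) s (projIcc 0 1 zero_le_one (2 * t - 1)))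
    rw [concat_apply, Fin.snoc_last, ht', if_neg (not_le.2 h), Fin.update_snoc_last]

variable [IsManifold 𝓘(ℝ, E) ∞ M]
  {F : Type*} [NormedAddCommGroup F] [NormedSpace ℝ F]
  {G : Type*} [TopologicalSpace G] [ChartedSpace F G] [Group G] [LieGroup 𝓘(ℝ, F) ∞ G]
  {𝒜 : FormData E M x₀ n F}

theorem IsSmoothLoop.reparam_one {α : Ω^ (Fin n) M x₀} (hα : IsSmoothLoop E α) :
    IsSmoothLoop E (reparam α 1) :=
  hα.isSmoothFamily_reparam.isSmoothLoop (right_mem_Icc.2 zero_le_one)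

/-- The pull-back along a loop of `n`-loops that is, on `[a, b]`, the affine reparametrization of
another one. -/
theorem FormData.IsConnection.pullback_loopFamily_comp (h𝒜 : 𝒜.IsConnection)
    {α γ : Ω^ (Fin (n + 1)) M x₀} (hα : IsSmoothLoop E α) (hγ : IsSmoothLoop E γ) {a b c d : ℝ}
    (hab : a < b) (hJ : Icc a b ⊆ Icc 0 1)
    (hc : MapsTo (fun t => c * t + d) (Icc a b) (Icc 0 1))
    (e : ∀ t ∈ Icc a b, loopFamily γ t = loopFamily α (c * t + d)) {t : ℝ} (ht : t ∈ Icc a b) :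
    𝒜.pullback (Icc 0 1) (loopFamily γ) 1 t =
      c • 𝒜.pullback (Icc 0 1) (loopFamily α) 1 (c * t + d) := by
  have hu := uniqueDiffOn_Icc (zero_lt_one' ℝ)
  have hut := uniqueDiffOn_Icc hab t ht
  have h1 := 𝒜.pullback_comp hγ.loopFamily (c := fun t => t) (x' := loopFamily γ) ht hut hu hJ
    (hasFDerivAt_id (𝕜 := ℝ) t).hasFDerivWithinAt (fun _ _ => rfl) 1
  have hd : HasFDerivWithinAt (fun t : ℝ => c * t + d) (c • ContinuousLinearMap.id ℝ ℝ) (Icc a b) t :=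
    (((hasFDerivAt_id t).const_mul c).add_const d).hasFDerivWithinAt
  have h2 := 𝒜.pullback_comp hα.loopFamily (x' := loopFamily γ) ht hut hu hc hd e 1
  rw [ContinuousLinearMap.id_apply] at h1
  rw [← h1, h2, ← h𝒜.pullback_smul hα.loopFamily hu (hc ht)]
  rfl

/-- Transport along the concatenation is transport along the first loop at double speed, followed by
the second transport translated on the right by `W 1`. The factor travelled last therefore stands on
the left. -/
theorem FormData.IsConnection.isHolonomy_concat (h𝒜 : 𝒜.IsConnection)
    {α β : Ω^ (Fin (n + 1)) M x₀} (hα : IsSmoothLoop E α) (hβ : IsSmoothLoop E β) {g h : G}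
    (hg : 𝒜.IsHolonomy (reparam α 1) g) (hh : 𝒜.IsHolonomy (reparam β 1) h) :
    𝒜.IsHolonomy (concat α β) (h * g) := by
  obtain ⟨W, hW0, rfl, hW⟩ := hg
  obtain ⟨V, hV0, rfl, hV⟩ := hh
  have hγ := hα.concat hβ
  -- The summand `0` puts both halves in the common affine form `c * t + d`.
  refine ⟨fun t => if t ≤ 1 / 2 then W (2 * t + 0) else V (2 * t + (-1)) * W 1, ?_, ?_, ?_⟩
  · simp [hW0]
  · have : ¬ (1 : ℝ) ≤ 1 / 2 := by norm_num
    simp only [this, if_false]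
    norm_num
  · intro t ht
    have m1 : MapsTo (fun t : ℝ => 2 * t + 0) (Icc 0 (1 / 2)) (Icc 0 1) := fun t ht =>
      ⟨by linarith [ht.1], by linarith [ht.2]⟩
    have m2 : MapsTo (fun t : ℝ => 2 * t + (-1)) (Icc (1 / 2) 1) (Icc 0 1) := fun t ht =>
      ⟨by linarith [ht.1], by linarith [ht.2]⟩
    have hd : ∀ (d : ℝ) (S : Set ℝ) (t : ℝ), HasDerivWithinAt (fun t : ℝ => 2 * t + d) 2 S t :=
      fun d S t => by simpa using (((hasDerivAt_id t).const_mul 2).add_const d).hasDerivWithinAt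
    refine HasRightLogDeriv.glue (W := fun t => W (2 * t + 0)) (V := fun t => V (2 * t + (-1)) * W 1)
      (p := fun t => -𝒜.pullback (Icc 0 1) (loopFamily (concat α β)) 1 t) (a := 0) (b := 1 / 2)
      (c := 1) (by norm_num) (by norm_num) (fun t ht => ?_) (fun t ht => ?_) ?_ ht
    · have h1 := h𝒜.pullback_loopFamily_comp hα.reparam_one hγ (a := 0) (b := 1 / 2)
        (by norm_num) (Icc_subset_Icc_right (by norm_num)) m1 (fun t ht => by
          rw [loopFamily_concat_left α β ht, add_zero]) ht
      rw [h1, ← smul_neg]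
      exact HasRightLogDeriv.comp (hW _ (m1 ht)) (hd 0 _ t) m1
    · have h1 := h𝒜.pullback_loopFamily_comp hβ.reparam_one hγ (a := 1 / 2) (b := 1)
        (by norm_num) (Icc_subset_Icc_left (by norm_num)) m2 (fun t ht => by
          rw [loopFamily_concat_right α β ht, sub_eq_add_neg]) ht
      rw [h1, ← smul_neg]
      exact (HasRightLogDeriv.comp (f := fun t => 2 * t + (-1)) (hV _ (m2 ht)) (hd (-1) _ t)
        m2).mul_const _
    · norm_num [hV0]

end Concatenation

/-! ### The holonomy representation of the homotopy group -/

section Representation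

variable {E : Type*} [NormedAddCommGroup E] [NormedSpace ℝ E] [FiniteDimensional ℝ E]
  {M : Type*} [TopologicalSpace M] [ChartedSpace E M] [IsManifold 𝓘(ℝ, E) ∞ M] {x₀ : M} {n : ℕ}
  {F : Type*} [NormedAddCommGroup F] [NormedSpace ℝ F] [CompleteSpace F]
  {G : Type*} [TopologicalSpace G] [ChartedSpace F G] [Group G] [LieGroup 𝓘(ℝ, F) ∞ G]
  {𝒜 : FormData E M x₀ n F}

/-- `reparam α` is a smooth homotopy that starts at `α`, so homotopy invariance applies. It
compensates for the reparametrizations made in smoothing homotopies and in concatenating. -/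
theorem FormData.IsFlat.isHolonomy_reparam (hF : 𝒜.IsFlat G) (h𝒜 : 𝒜.IsConnection)
    {α : Ω^ (Fin (n + 1)) M x₀} (hα : IsSmoothLoop E α) {g : G} (hg : 𝒜.IsHolonomy α g) :
    𝒜.IsHolonomy (reparam α 1) g := by
  obtain ⟨h, hh, -⟩ := h𝒜.existsUnique_isHolonomy (G := G) hα.reparam_one
  have h1 := hF.isHolonomy_eq h𝒜 hα.isSmoothFamily_reparam (g₀ := g) (by rwa [reparam_zero]) hh
  rwa [h1]

theorem FormData.IsFlat.isHolonomy_eq_of_homotopic (hF : 𝒜.IsFlat G) (h𝒜 : 𝒜.IsConnection)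
    {α β : Ω^ (Fin (n + 1)) M x₀} (hα : IsSmoothLoop E α) (hβ : IsSmoothLoop E β)
    (h : GenLoop.Homotopic α β) {g g' : G} (hg : 𝒜.IsHolonomy α g) (hg' : 𝒜.IsHolonomy β g') :
    g = g' := by
  obtain ⟨A, hA, h0, h1⟩ := exists_isSmoothFamily_of_homotopic hα hβ h
  exact hF.isHolonomy_eq h𝒜 hA (by rw [h0]; exact hF.isHolonomy_reparam h𝒜 hα hg)
    (by rw [h1]; exact hF.isHolonomy_reparam h𝒜 hβ hg')

/-- The holonomy of a flat connection as a homomorphism on the homotopy group. -/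
theorem FormData.IsFlat.exists_monoidHom (hF : 𝒜.IsFlat G) (h𝒜 : 𝒜.IsConnection) :
    ∃ ρ : HomotopyGroup.Pi (n + 1) M x₀ →* G, ∀ α : Ω^ (Fin (n + 1)) M x₀, IsSmoothLoop E α →
      𝒜.IsHolonomy α (ρ (Quotient.mk _ α)) := by
  have hex : ∀ c : HomotopyGroup.Pi (n + 1) M x₀, ∃ g : G, ∀ α : Ω^ (Fin (n + 1)) M x₀,
      IsSmoothLoop E α → Quotient.mk _ α = c → 𝒜.IsHolonomy α g := by
    intro c
    obtain ⟨α, rfl⟩ := Quotient.exists_rep c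
    obtain ⟨β, hβ, hαβ⟩ := exists_smooth_homotopic E α
    obtain ⟨g, hg, -⟩ := h𝒜.existsUnique_isHolonomy (G := G) hβ
    refine ⟨g, fun γ hγ hγα => ?_⟩
    obtain ⟨g', hg', -⟩ := h𝒜.existsUnique_isHolonomy (G := G) hγ
    have h1 : GenLoop.Homotopic γ β := (Quotient.exact hγα : GenLoop.Homotopic γ α).trans hαβ
    rwa [← hF.isHolonomy_eq_of_homotopic h𝒜 hγ hβ h1 hg' hg]
  choose ρ hρ using hex
  refine ⟨MonoidHom.mk' ρ fun c c' => ?_, fun α hα => hρ _ α hα rfl⟩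
  obtain ⟨α', rfl⟩ := Quotient.exists_rep c
  obtain ⟨α, hα, hαα⟩ := exists_smooth_homotopic E α'
  obtain ⟨β', rfl⟩ := Quotient.exists_rep c'
  obtain ⟨β, hβ, hββ⟩ := exists_smooth_homotopic E β'
  have e1 : (Quotient.mk _ α' : HomotopyGroup.Pi (n + 1) M x₀) = Quotient.mk _ (reparam α 1) :=
    Quotient.sound (hαα.trans (homotopic_reparam α))
  have e2 : (Quotient.mk _ β' : HomotopyGroup.Pi (n + 1) M x₀) = Quotient.mk _ (reparam β 1) :=
    Quotient.sound (hββ.trans (homotopic_reparam β))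
  rw [e1, e2]
  -- The product of the classes of `α` and `β` is represented by `β` followed by `α`, which matches
  -- the order of factors in the holonomy; no commutativity is needed here.
  have h3 := h𝒜.isHolonomy_concat hβ hα (hρ _ _ hβ.reparam_one rfl) (hρ _ _ hα.reparam_one rfl)
  refine (h𝒜.existsUnique_isHolonomy (hβ.concat hα)).unique (hρ _ _ (hβ.concat hα) ?_) h3
  exact (HomotopyGroup.mul_spec (i := Fin.last n) (p := reparam α 1) (q := reparam β 1)).symm

/-- Smooth representatives show that the holonomies form the range of the homomorphism on `π_{n+1}`.
That set is a subgroup, so it coincides with the subgroup it generates, and it inherits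
commutativity from the homotopy group. -/
theorem FormData.IsFlat.holonomy_representation (hn : 1 ≤ n) (hF : 𝒜.IsFlat G)
    (h𝒜 : 𝒜.IsConnection) :
    (𝒜.holonomyGroup G : Set G) = 𝒜.holonomies G ∧
      (∀ a ∈ 𝒜.holonomyGroup G, ∀ b ∈ 𝒜.holonomyGroup G, a * b = b * a) ∧
      ∃! ρ : HomotopyGroup.Pi (n + 1) M x₀ →* 𝒜.holonomyGroup G,
        ∀ α : GenLoop (Fin (n + 1)) M x₀, IsSmoothLoop E α →
          𝒜.IsHolonomy α (ρ (Quotient.mk _ α) : G) := by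
  obtain ⟨ρ, hρ⟩ := hF.exists_monoidHom h𝒜
  have hrange : 𝒜.holonomies G = (ρ.range : Set G) := by
    ext g
    constructor
    · rintro ⟨α, hα, hg⟩
      exact ⟨Quotient.mk _ α, (h𝒜.existsUnique_isHolonomy hα).unique (hρ α hα) hg⟩
    · rintro ⟨c, rfl⟩
      obtain ⟨α, rfl⟩ := Quotient.exists_rep c
      obtain ⟨β, hβ, hαβ⟩ := exists_smooth_homotopic E α
      refine ⟨β, hβ, ?_⟩
      rw [show (Quotient.mk _ α : HomotopyGroup.Pi (n + 1) M x₀) = Quotient.mk _ β from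
        Quotient.sound hαβ]
      exact hρ β hβ
  have hgroup : 𝒜.holonomyGroup G = ρ.range := by
    rw [FormData.holonomyGroup, hrange, Subgroup.closure_eq]
  have hcomm : ∀ c c' : HomotopyGroup.Pi (n + 1) M x₀, c * c' = c' * c := by
    -- Two distinct coordinates are available because `n ≥ 1`; this is the Eckmann-Hilton situation.
    have : Nontrivial (Fin (n + 1)) := Fin.nontrivial_iff_two_le.2 (by omega)
    intro c c'
    exact (HomotopyGroup.commGroup (N := Fin (n + 1)) (X := M) (x := x₀)).mul_comm c c'
  refine ⟨by rw [hgroup, hrange], ?_, ?_⟩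
  · rw [hgroup]
    rintro _ ⟨c, rfl⟩ _ ⟨c', rfl⟩
    rw [← map_mul, ← map_mul, hcomm]
  · have hmem : ∀ c, ρ c ∈ 𝒜.holonomyGroup G := fun c => by rw [hgroup]; exact ⟨c, rfl⟩
    refine ⟨ρ.codRestrict _ hmem, fun α hα => hρ α hα, fun ρ' hρ' => ?_⟩
    ext c
    obtain ⟨α, rfl⟩ := Quotient.exists_rep c
    obtain ⟨β, hβ, hαβ⟩ := exists_smooth_homotopic E α
    rw [show (Quotient.mk _ α : HomotopyGroup.Pi (n + 1) M x₀) = Quotient.mk _ β from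
        Quotient.sound hαβ]
    exact (h𝒜.existsUnique_isHolonomy hβ).unique (hρ' β hβ) (hρ β hβ)

end Representation

/-! ### Parameter dependence of linear differential equations -/

section LinearODE

variable {𝔸 : Type*} [NormedRing 𝔸] [NormedAlgebra ℝ 𝔸]

/-- Grönwall's inequality. The bound depends only on `C`, so it is uniform in the parameters. -/
theorem norm_le_of_linearODE {t₀ t₁ C : ℝ} {f f' : ℝ → 𝔸}
    (hf : ∀ t ∈ Icc t₀ t₁, HasDerivWithinAt f (f' t) (Icc t₀ t₁) t)
    (hb : ∀ t ∈ Icc t₀ t₁, ‖f' t‖ ≤ C * ‖f t‖) (hC : 0 ≤ C) (h0 : f t₀ = 1)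
    {t : ℝ} (ht : t ∈ Icc t₀ t₁) : ‖f t‖ ≤ ‖(1 : 𝔸)‖ * Real.exp (C * (t₁ - t₀)) := by
  have h1 := norm_le_gronwallBound_of_norm_deriv_right_le (f := f) (f' := f') (δ := ‖(1 : 𝔸)‖)
    (K := C) (ε := 0) (a := t₀) (b := t₁) (fun t ht => (hf t ht).continuousWithinAt)
    (fun t ht => ((hf t ⟨ht.1, ht.2.le⟩).mono_of_mem_nhdsWithin
      (Icc_mem_nhdsGE_of_mem ht))) (by rw [h0])
    (fun t ht => by simpa using hb t ⟨ht.1, ht.2.le⟩) t ht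
  rw [gronwallBound_ε0] at h1
  refine h1.trans ?_
  gcongr
  exact ht.2

variable [CompleteSpace 𝔸] {R : Type*} [NormedAddCommGroup R] [NormedSpace ℝ R]

/-- Solutions of linear differential equations depend in a `C¹` way on parameters. -/
theorem contDiffOn_one_of_linearODE {S : Set R} (hS : Convex ℝ S) (hSu : UniqueDiffOn ℝ S)
    {t₀ t₁ C : ℝ} (h01 : t₀ ≤ t₁) {α : R → ℝ → 𝔸} {α' : R → ℝ → R →L[ℝ] 𝔸}
    (hα : ∀ r ∈ S, ContinuousOn (α r) (Icc t₀ t₁))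
    (hα' : ContinuousOn (fun z : R × ℝ => α' z.1 z.2) (S ×ˢ Icc t₀ t₁))
    (hd : ∀ r ∈ S, ∀ t ∈ Icc t₀ t₁, HasFDerivWithinAt (fun r => α r t) (α' r t) S r)
    (hC : ∀ r ∈ S, ∀ t ∈ Icc t₀ t₁, ‖α r t‖ ≤ C) {W V : R → ℝ → 𝔸}
    (hW0 : ∀ r ∈ S, W r t₀ = 1) (hV0 : ∀ r ∈ S, V r t₀ = 1)
    (hVW : ∀ r ∈ S, ∀ t ∈ Icc t₀ t₁, V r t * W r t = 1)
    (hWV : ∀ r ∈ S, ∀ t ∈ Icc t₀ t₁, W r t * V r t = 1)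
    (hW : ∀ r ∈ S, ∀ t ∈ Icc t₀ t₁, HasDerivWithinAt (W r) (W r t * α r t) (Icc t₀ t₁) t)
    (hV : ∀ r ∈ S, ∀ t ∈ Icc t₀ t₁, HasDerivWithinAt (V r) (-(α r t * V r t)) (Icc t₀ t₁) t) :
    ContDiffOn ℝ 1 (fun r => W r t₁) S := by
  set J := Icc t₀ t₁ with hJ
  have h0J : t₀ ∈ J := left_mem_Icc.2 h01
  have h1J : t₁ ∈ J := right_mem_Icc.2 h01
  rcases S.eq_empty_or_nonempty with rfl | ⟨r₁, hr₁⟩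
  · exact fun r hr => hr.elim
  have hC0 : 0 ≤ C := (norm_nonneg _).trans (hC r₁ hr₁ t₀ h0J)
  set Bd := ‖(1 : 𝔸)‖ * Real.exp (C * (t₁ - t₀)) with hBd
  have hBd0 : 0 ≤ Bd := by positivity
  have hWb : ∀ r ∈ S, ∀ t ∈ J, ‖W r t‖ ≤ Bd := fun r hr t ht =>
    norm_le_of_linearODE (hW r hr) (fun t ht => (norm_mul_le _ _).trans (by
      rw [mul_comm]; exact mul_le_mul_of_nonneg_right (hC r hr t ht) (norm_nonneg _))) hC0
      (hW0 r hr) ht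
  have hVb : ∀ r ∈ S, ∀ t ∈ J, ‖V r t‖ ≤ Bd := fun r hr t ht =>
    norm_le_of_linearODE (hV r hr) (fun t ht => by
      rw [norm_neg]
      exact (norm_mul_le _ _).trans (mul_le_mul_of_nonneg_right (hC r hr t ht) (norm_nonneg _)))
      hC0 (hV0 r hr) ht
  have hWc : ∀ r ∈ S, ContinuousOn (W r) J := fun r hr t ht => (hW r hr t ht).continuousWithinAt
  have hVc : ∀ r ∈ S, ContinuousOn (V r) J := fun r hr t ht => (hV r hr t ht).continuousWithinAt
  -- Duhamel's formula
  have hduh : ∀ r ∈ S, ∀ r₀ ∈ S, ∀ t ∈ J, HasDerivWithinAt (fun t => W r t * V r₀ t)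
      (W r t * (α r t - α r₀ t) * V r₀ t) J t := by
    intro r hr r₀ hr₀ t ht
    refine ((hW r hr t ht).mul (hV r₀ hr₀ t ht)).congr_deriv ?_
    noncomm_ring
  -- uniform continuity in the parameter
  have hαu : ∀ r₀ ∈ S, ∀ ε > 0, ∀ᶠ r in 𝓝[S] r₀, ∀ t ∈ J, ‖α r t - α r₀ t‖ ≤ ε := by
    intro r₀ hr₀ ε hε
    obtain ⟨D, hD⟩ : ∃ D : ℝ, ∀ t ∈ J, ‖α' r₀ t‖ ≤ D :=
      isCompact_Icc.exists_bound_of_continuousOn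
        (hα'.comp (continuousOn_const.prodMk continuousOn_id) fun t ht => ⟨hr₀, ht⟩)
    have hlim : Filter.Tendsto (fun r => (1 + D) * ‖r - r₀‖) (𝓝[S] r₀) (𝓝 0) := by
      have h2 : Continuous fun r : R => (1 + D) * ‖r - r₀‖ := by fun_prop
      have h3 := h2.tendsto r₀
      simp only [sub_self, norm_zero, mul_zero] at h3
      exact h3.mono_left nhdsWithin_le_nhds
    filter_upwards [eventually_norm_sub_fderiv_le hS isCompact_Icc hα' hd hr₀ one_pos,
      hlim.eventually (Iio_mem_nhds hε)] with r hr hrε t ht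
    calc ‖α r t - α r₀ t‖
        ≤ ‖α r t - α r₀ t - α' r₀ t (r - r₀)‖ + ‖α' r₀ t (r - r₀)‖ := by
          simpa using norm_add_le (α r t - α r₀ t - α' r₀ t (r - r₀)) (α' r₀ t (r - r₀))
      _ ≤ 1 * ‖r - r₀‖ + D * ‖r - r₀‖ := add_le_add (hr t ht)
          ((ContinuousLinearMap.le_opNorm _ _).trans
            (mul_le_mul_of_nonneg_right (hD t ht) (norm_nonneg _)))
      _ = (1 + D) * ‖r - r₀‖ := by ring
      _ ≤ ε := le_of_lt hrε
  have hWu : ∀ r₀ ∈ S, ∀ ε > 0, ∀ᶠ r in 𝓝[S] r₀, ∀ t ∈ J, ‖W r t - W r₀ t‖ ≤ ε := by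
    intro r₀ hr₀ ε hε
    set c := Bd * Bd * (t₁ - t₀) * Bd with hc
    have hc0 : 0 ≤ c := by have := sub_nonneg.2 h01; positivity
    filter_upwards [hαu r₀ hr₀ (ε / (c + 1)) (by positivity), self_mem_nhdsWithin] with r hr hrS t ht
    have h1 := (convex_Icc t₀ t₁).norm_image_sub_le_of_norm_hasDerivWithin_le
      (C := Bd * (ε / (c + 1)) * Bd) (hduh r hrS r₀ hr₀) (fun t ht => by
        refine (norm_mul_le _ _).trans (mul_le_mul ((norm_mul_le _ _).trans ?_) (hVb r₀ hr₀ t ht)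
          (norm_nonneg _) (by positivity))
        exact mul_le_mul (hWb r hrS t ht) (hr t ht) (norm_nonneg _) hBd0) h0J ht
    rw [hW0 r hrS, hV0 r₀ hr₀, mul_one, Real.norm_of_nonneg (sub_nonneg.2 ht.1)] at h1
    -- Duhamel's formula controls the quotient `W_r V_{r₀}`; multiplication by `W_{r₀}`, the inverse
    -- of `V_{r₀}`, returns to the difference.
    have h2 : W r t - W r₀ t = (W r t * V r₀ t - 1) * W r₀ t := by
      rw [sub_mul, mul_assoc, hVW r₀ hr₀ t ht, mul_one, one_mul]
    rw [h2]
    calc ‖(W r t * V r₀ t - 1) * W r₀ t‖ ≤ (Bd * (ε / (c + 1)) * Bd * (t - t₀)) * Bd :=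
          (norm_mul_le _ _).trans (mul_le_mul h1 (hWb r₀ hr₀ t ht) (norm_nonneg _)
            (by have := sub_nonneg.2 ht.1; positivity))
      _ ≤ (Bd * (ε / (c + 1)) * Bd * (t₁ - t₀)) * Bd := by gcongr; exact ht.2
      _ = c / (c + 1) * ε := by rw [hc]; ring
      _ ≤ 1 * ε := by
          gcongr
          rw [div_le_one (by positivity)]
          linarith
      _ = ε := one_mul _
  have hVu : ∀ r₀ ∈ S, ∀ ε > 0, ∀ᶠ r in 𝓝[S] r₀, ∀ t ∈ J, ‖V r t - V r₀ t‖ ≤ ε := by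
    intro r₀ hr₀ ε hε
    filter_upwards [hWu r₀ hr₀ (ε / (Bd * Bd + 1)) (by positivity), self_mem_nhdsWithin]
      with r hr hrS t ht
    -- Resolvent identity for the inverses, which reduces the claim to the one for `W`.
    have h2 : V r t - V r₀ t = -(V r t * (W r t - W r₀ t) * V r₀ t) := by
      rw [mul_sub, hVW r hrS t ht, sub_mul, mul_assoc, hWV r₀ hr₀ t ht, one_mul, mul_one, neg_sub]
    rw [h2, norm_neg]
    calc _ ≤ (Bd * (ε / (Bd * Bd + 1))) * Bd :=
          (norm_mul_le _ _).trans (mul_le_mul ((norm_mul_le _ _).trans (mul_le_mul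
            (hVb r hrS t ht) (hr t ht) (norm_nonneg _) hBd0)) (hVb r₀ hr₀ t ht) (norm_nonneg _)
            (by positivity))
      _ = (Bd * Bd) / (Bd * Bd + 1) * ε := by ring
      _ ≤ 1 * ε := by
          gcongr
          rw [div_le_one (by positivity)]
          linarith
      _ = ε := one_mul _
  have hjoint : ∀ {Z : R → ℝ → 𝔸}, (∀ r ∈ S, ContinuousOn (Z r) J) →
      (∀ r₀ ∈ S, ∀ ε > 0, ∀ᶠ r in 𝓝[S] r₀, ∀ t ∈ J, ‖Z r t - Z r₀ t‖ ≤ ε) →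
      ContinuousOn (fun z : R × ℝ => Z z.1 z.2) (S ×ˢ J) := by
    rintro Z hZ hZu ⟨r₀, s₀⟩ ⟨hr₀, hs₀⟩
    rw [ContinuousWithinAt, Metric.tendsto_nhds]
    intro ε hε
    have h1 : ∀ᶠ z : R × ℝ in 𝓝[S ×ˢ J] (r₀, s₀), ∀ t ∈ J, ‖Z z.1 t - Z r₀ t‖ ≤ ε / 3 := by
      rw [nhdsWithin_prod_eq]
      exact Filter.tendsto_fst.eventually (hZu r₀ hr₀ (ε / 3) (by positivity))
    have h2 : ∀ᶠ z : R × ℝ in 𝓝[S ×ˢ J] (r₀, s₀), dist (Z r₀ z.2) (Z r₀ s₀) < ε / 3 := by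
      rw [nhdsWithin_prod_eq]
      exact Filter.tendsto_snd.eventually
        ((hZ r₀ hr₀ s₀ hs₀).eventually (Metric.ball_mem_nhds _ (by positivity)))
    filter_upwards [h1, h2, self_mem_nhdsWithin] with z hz1 hz2 hz
    have h3 := hz1 z.2 hz.2
    rw [← dist_eq_norm] at h3
    calc dist (Z z.1 z.2) (Z r₀ s₀) ≤ dist (Z z.1 z.2) (Z r₀ z.2) + dist (Z r₀ z.2) (Z r₀ s₀) :=
          dist_triangle _ _ _
      _ < ε := by linarith
  have hWj := hjoint hWc hWu
  have hVj := hjoint hVc hVu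
  -- the derivative
  set Φ : R → ℝ → R →L[ℝ] 𝔸 := fun r t =>
    (ContinuousLinearMap.mulLeftRight ℝ 𝔸 (W r t) (V r t)).comp (α' r t) with hΦ
  have hΦ_apply : ∀ r t v, Φ r t v = W r t * α' r t v * V r t := fun r t v => rfl
  have hΦj : ContinuousOn (fun z : R × ℝ => Φ z.1 z.2) (S ×ˢ J) := by
    refine ContinuousOn.clm_comp ?_ hα'
    exact ((ContinuousLinearMap.mulLeftRight ℝ 𝔸).continuous.comp_continuousOn hWj).clm_apply hVj
  have hΦr : ∀ r ∈ S, ContinuousOn (Φ r) J := fun r hr =>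
    hΦj.comp (f := fun t => (r, t)) (continuousOn_const.prodMk continuousOn_id) fun t ht => ⟨hr, ht⟩
  set L : R → R →L[ℝ] 𝔸 := fun r =>
    ((ContinuousLinearMap.mul ℝ 𝔸).flip (W r t₁)).comp (∫ t in t₀..t₁, Φ r t) with hL
  rw [show (1 : WithTop ℕ∞) = 0 + 1 by simp, contDiffOn_succ_iff_hasFDerivWithinAt_of_uniqueDiffOn hSu]
  refine ⟨by simp, L, contDiffOn_zero.2 ?_, fun r₀ hr₀ => ?_⟩
  · refine ContinuousOn.clm_comp ?_ ?_
    · exact (ContinuousLinearMap.continuous _).comp_continuousOn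
        (hWj.comp (f := fun r => (r, t₁)) (continuousOn_id.prodMk continuousOn_const)
          fun r hr => ⟨hr, h1J⟩)
    · have h1 := continuousOn_setIntegral (μ := MeasureTheory.volume) isCompact_Icc
        measurableSet_Icc hΦj
      refine h1.congr fun r hr => ?_
      simp only
      rw [intervalIntegral.integral_of_le h01, MeasureTheory.integral_Icc_eq_integral_Ioc]
  -- By Duhamel, `W_r(t₁) V_{r₀}(t₁) - 1 = ∫ W_r (α_r - α_{r₀}) V_{r₀}`. Replacing `W_r` by `W_{r₀}`
  -- and the difference by its linear part costs `o(‖r - r₀‖)`. Right multiplication by `W_{r₀}(t₁)`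
  -- then gives the derivative `L`.
  · have key : HasFDerivWithinAt (fun r => W r t₁ * V r₀ t₁) (∫ t in t₀..t₁, Φ r₀ t) S r₀ := by
      rw [hasFDerivWithinAt_iff_isLittleO, Asymptotics.isLittleO_iff]
      intro ε hε
      obtain ⟨D, hD⟩ : ∃ D : ℝ, ∀ t ∈ J, ‖α' r₀ t‖ ≤ D :=
        isCompact_Icc.exists_bound_of_continuousOn
          (hα'.comp (continuousOn_const.prodMk continuousOn_id) fun t ht => ⟨hr₀, ht⟩)
      have hD0 : 0 ≤ D := (norm_nonneg _).trans (hD t₀ h0J)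
      set c := (Bd * Bd + D * Bd) * (t₁ - t₀) with hc
      have hc0 : 0 ≤ c := by have := sub_nonneg.2 h01; positivity
      have hε' : 0 < ε / (c + 1) := by positivity
      filter_upwards [eventually_norm_sub_fderiv_le hS isCompact_Icc hα' hd hr₀ hε',
        hWu r₀ hr₀ _ hε', self_mem_nhdsWithin] with r h1 h2 hrS
      have hint : ∫ t in t₀..t₁, W r t * (α r t - α r₀ t) * V r₀ t = W r t₁ * V r₀ t₁ - 1 := by
        rw [intervalIntegral.integral_eq_sub_of_hasDerivAt_of_le h01
          (fun t ht => (hduh r hrS r₀ hr₀ t ht).continuousWithinAt)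
          (fun t ht => (hduh r hrS r₀ hr₀ t ⟨ht.1.le, ht.2.le⟩).hasDerivAt (Icc_mem_nhds ht.1 ht.2))
          ((((hWc r hrS).mul ((hα r hrS).sub (hα r₀ hr₀))).mul
            (hVc r₀ hr₀)).intervalIntegrable_of_Icc h01), hW0 r hrS, hV0 r₀ hr₀, mul_one]
      have hΦi : IntervalIntegrable (Φ r₀) MeasureTheory.volume t₀ t₁ :=
        (hΦr r₀ hr₀).intervalIntegrable_of_Icc h01
      have hΦc' : ContinuousOn (fun t => Φ r₀ t (r - r₀)) J := (hΦr r₀ hr₀).clm_apply continuousOn_const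
      have hc1 : ContinuousOn (fun t => W r t * (α r t - α r₀ t) * V r₀ t) J :=
        ((hWc r hrS).mul ((hα r hrS).sub (hα r₀ hr₀))).mul (hVc r₀ hr₀)
      rw [hWV r₀ hr₀ t₁ h1J, ← hint, ContinuousLinearMap.intervalIntegral_apply hΦi,
        ← intervalIntegral.integral_sub (hc1.intervalIntegrable_of_Icc h01)
          (hΦc'.intervalIntegrable_of_Icc h01)]
      refine (intervalIntegral.norm_integral_le_of_norm_le_const
        (C := (Bd * Bd + D * Bd) * (ε / (c + 1) * ‖r - r₀‖)) fun t ht => ?_).trans ?_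
      · rw [uIoc_of_le h01] at ht
        have htJ : t ∈ J := ⟨ht.1.le, ht.2⟩
        have e : W r t * (α r t - α r₀ t) * V r₀ t - Φ r₀ t (r - r₀) =
            W r t * (α r t - α r₀ t - α' r₀ t (r - r₀)) * V r₀ t +
              (W r t - W r₀ t) * α' r₀ t (r - r₀) * V r₀ t := by
          rw [hΦ_apply]; noncomm_ring
        rw [e]
        calc _ ≤ Bd * (ε / (c + 1) * ‖r - r₀‖) * Bd + ε / (c + 1) * (D * ‖r - r₀‖) * Bd := by
              refine (norm_add_le _ _).trans (add_le_add ?_ ?_)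
              · refine (norm_mul_le _ _).trans (mul_le_mul ((norm_mul_le _ _).trans
                  (mul_le_mul (hWb r hrS t htJ) (h1 t htJ) (norm_nonneg _) hBd0))
                  (hVb r₀ hr₀ t htJ) (norm_nonneg _) (by positivity))
              · refine (norm_mul_le _ _).trans (mul_le_mul ((norm_mul_le _ _).trans
                  (mul_le_mul (h2 t htJ) ((ContinuousLinearMap.le_opNorm _ _).trans
                    (mul_le_mul_of_nonneg_right (hD t htJ) (norm_nonneg _))) (norm_nonneg _) hε'.le))
                  (hVb r₀ hr₀ t htJ) (norm_nonneg _) (by positivity))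
          _ = _ := by ring
      · rw [abs_of_nonneg (sub_nonneg.2 h01)]
        calc _ = c / (c + 1) * (ε * ‖r - r₀‖) := by rw [hc]; ring
          _ ≤ 1 * (ε * ‖r - r₀‖) := by
              gcongr
              rw [div_le_one (by positivity)]
              linarith
          _ = ε * ‖r - r₀‖ := one_mul _
    have h1 := ((ContinuousLinearMap.mul ℝ 𝔸).flip (W r₀ t₁)).hasFDerivAt.comp_hasFDerivWithinAt r₀ key
    refine h1.congr (fun r hr => ?_) ?_
    · change W r t₁ = W r t₁ * V r₀ t₁ * W r₀ t₁
      rw [mul_assoc, hVW r₀ hr₀ t₁ h1J, mul_one]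
    · change W r₀ t₁ = W r₀ t₁ * V r₀ t₁ * W r₀ t₁
      rw [mul_assoc, hVW r₀ hr₀ t₁ h1J, mul_one]

end LinearODE

/-! ### Principal bundles: horizontal lifts and parallel transport -/

section Bundles

variable {E : Type*} [NormedAddCommGroup E] [NormedSpace ℝ E]
  {M : Type*} [TopologicalSpace M] [ChartedSpace E M]
  {F : Type*} [NormedAddCommGroup F] [NormedSpace ℝ F]
  {G : Type*} [TopologicalSpace G] [ChartedSpace F G] [Group G] [LieGroup 𝓘(ℝ, F) ∞ G]
  {Q : Type*} [NormedAddCommGroup Q] [NormedSpace ℝ Q]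
  {P : Type*} [TopologicalSpace P] [ChartedSpace Q P]

namespace PrincipalBundle

variable (π : PrincipalBundle E M F G Q P)

/-- A local trivialization of a principal bundle. -/
structure LocalTriv where
  /-- The domain. -/
  base : Set M
  isOpen_base : IsOpen base
  /-- The local section. -/
  sec : M → P
  /-- The component in the group. -/
  coord : P → G
  smooth_sec : ContMDiffOn 𝓘(ℝ, E) 𝓘(ℝ, Q) ∞ sec base
  smooth_coord : ContMDiffOn 𝓘(ℝ, Q) 𝓘(ℝ, F) ∞ coord (π.proj ⁻¹' base)
  proj_sec : ∀ z ∈ base, π.proj (sec z) = z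
  act_coord : ∀ p ∈ π.proj ⁻¹' base, π.act (sec (π.proj p)) (coord p) = p
  coord_act : ∀ z ∈ base, ∀ g : G, coord (π.act (sec z) g) = g

theorem exists_localTriv (y : M) : ∃ T : π.LocalTriv, y ∈ T.base := by
  obtain ⟨U, hU, hy, s, t, h1, h2, h3, h4, h5⟩ := π.locally_trivial y
  exact ⟨⟨U, hU, s, t, h1, h2, h3, h4, h5⟩, hy⟩

/-- Induction along a curve, by steps that stay in a trivialization. -/
theorem induction_along {c : ℝ → M} (hc : ContinuousOn c (Icc 0 1)) {p : ℝ → Prop} (h0 : p 0)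
    (step : ∀ (T : π.LocalTriv) (a b : ℝ), a ∈ Icc (0 : ℝ) 1 → b ∈ Icc (0 : ℝ) 1 → a < b →
      (∀ t ∈ Icc a b, c t ∈ T.base) → p a → p b) : p 1 := by
  obtain ⟨t, ht0, htm, ⟨n, hn⟩, ht⟩ := exists_monotone_Icc_subset_open_cover_unitInterval
    (c := fun T : π.LocalTriv => {t : I | c t ∈ T.base})
    (fun T => T.isOpen_base.preimage hc.domRestrict) (fun t _ => by
      obtain ⟨T, hT⟩ := π.exists_localTriv (c t)
      exact mem_iUnion.2 ⟨T, hT⟩)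
  have h1 : ∀ m, p (t m) := by
    intro m
    induction m with
    | zero => rw [ht0]; exact h0
    | succ m ih =>
      obtain ⟨T, hT⟩ := ht m
      rcases (htm m.le_succ).eq_or_lt with h | h
      · rwa [← h]
      · refine step T (t m) (t (m + 1)) (t m).2 (t (m + 1)).2 h (fun s hs => ?_) ih
        exact hT (a := ⟨s, (t m).2.1.trans hs.1, hs.2.trans (t (m + 1)).2.2⟩) hs
  have h2 := h1 n
  rwa [hn n le_rfl] at h2

theorem mdifferentiable_act :
    MDifferentiable ((𝓘(ℝ, Q)).prod 𝓘(ℝ, F)) 𝓘(ℝ, Q) (fun z : P × G => π.act z.1 z.2) :=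
  π.smooth_act.mdifferentiable (by simp)

theorem mdifferentiable_act_left (g : G) :
    MDifferentiable 𝓘(ℝ, Q) 𝓘(ℝ, Q) (fun p : P => π.act p g) := by
  have h1 : ContMDiff 𝓘(ℝ, Q) ((𝓘(ℝ, Q)).prod 𝓘(ℝ, F)) ∞ (fun p : P => (p, g)) :=
    contMDiff_id.prodMk contMDiff_const
  exact (π.smooth_act.comp h1).mdifferentiable (by simp)

theorem mdifferentiable_act_right (p : P) :
    MDifferentiable 𝓘(ℝ, F) 𝓘(ℝ, Q) (fun g : G => π.act p g) := by
  have h1 : ContMDiff 𝓘(ℝ, F) ((𝓘(ℝ, Q)).prod 𝓘(ℝ, F)) ∞ (fun g : G => (p, g)) :=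
    contMDiff_const.prodMk contMDiff_id
  exact (π.smooth_act.comp h1).mdifferentiable (by simp)

/-- The vertical vectors. -/
def vert (p : P) : F →L[ℝ] Q := tderiv (fun g : G => π.act p g) 1

/-- Differentiate `p · (h g) = (p · h) · g` at `h = 1`. -/
theorem tderiv_act_rightTranslateL (p : P) (g : G) :
    (tderiv (fun h : G => π.act p h) g : F →L[ℝ] Q).comp (rightTranslateL g) =
      (tderiv (fun p' : P => π.act p' g) p : Q →L[ℝ] Q).comp (π.vert p) := by
  have h1 := tderiv_comp (f := fun h : G => h * g) (x := 1) (one_mul g)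
    (π.mdifferentiable_act_right p g) (mdifferentiable_mul_right F g 1)
  have h2 := tderiv_comp (f := fun h : G => π.act p h) (x := 1) (π.act_one p)
    (π.mdifferentiable_act_left g p) (π.mdifferentiable_act_right p 1)
  simp only [π.act_mul] at h1
  exact h1.symm.trans h2

/-- Leibniz rule `(u g)' = (u' + vert ξ) · g`: the right logarithmic derivative of `g` becomes a
vertical vector at `u`, before the translation by `g`. -/
theorem hasTDerivWithinAt_act {u : ℝ → P} {g : ℝ → G} {K : ℝ →L[ℝ] Q} {ξ : F} {S : Set ℝ} {t : ℝ}
    (hu : HasTDerivWithinAt u K S t) (hg : HasRightLogDeriv g ξ S t) :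
    HasTDerivWithinAt (fun t => π.act (u t) (g t))
      ((tderiv (fun p : P => π.act p (g t)) (u t) : Q →L[ℝ] Q).comp
        (K + ContinuousLinearMap.toSpanSingleton ℝ (π.vert (u t) ξ))) S t := by
  have h1 := HasTDerivWithinAt.tderiv_comp₂ hu hg (π.mdifferentiable_act (u t, g t))
  have h2 := DFunLike.congr_fun (π.tderiv_act_rightTranslateL (u t) (g t)) ξ
  simp only [ContinuousLinearMap.comp_apply] at h2
  convert! h1 using 1
  ext
  simp [h2]

end PrincipalBundle

variable [IsManifold 𝓘(ℝ, E) ∞ M] [IsManifold 𝓘(ℝ, Q) ∞ P] {π : PrincipalBundle E M F G Q P}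

namespace PrincipalBundle.Connection

variable (A : π.Connection)

/-- The connection form, as a linear map of the model space. -/
def formL (p : P) : Q →L[ℝ] F := A.form p

theorem formL_vert (p : P) (ξ : F) : A.formL p (π.vert p ξ) = ξ := A.vertical p ξ

theorem formL_act (p : P) (g : G) (v : Q) :
    A.formL (π.act p g) ((tderiv (fun p' : P => π.act p' g) p : Q →L[ℝ] Q) v) =
      AdL g⁻¹ (A.formL p v) := A.equivariant p g v

theorem contDiffOn_formL {V : Type*} [NormedAddCommGroup V] [NormedSpace ℝ V] {D : Set V}
    {f : V → P} (hf : ContMDiffOn 𝓘(ℝ, V) 𝓘(ℝ, Q) ∞ f D) (hD : UniqueDiffOn ℝ D) (v : V) :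
    ContDiffOn ℝ ∞ (fun z => A.formL (f z) (mfderivWithin 𝓘(ℝ, V) 𝓘(ℝ, Q) f D z v : Q)) D :=
  (A.smooth.comp_contMDiffOn (contMDiffOn_mfderivWithin_apply hf hD v)).contDiffOn

/-- The derivative of the horizontal curve `u g` over the curve `u` with derivative `K`. -/
def horizontalDeriv (p : P) (g : G) (K : ℝ →L[ℝ] Q) : ℝ →L[ℝ] Q :=
  (tderiv (fun p : P => π.act p g) p : Q →L[ℝ] Q).comp
    (K + ContinuousLinearMap.toSpanSingleton ℝ (π.vert p (-A.formL p (K 1))))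

theorem formL_horizontalDeriv (p : P) (g : G) (K : ℝ →L[ℝ] Q) :
    A.formL (π.act p g) (A.horizontalDeriv p g K 1) = 0 := by
  rw [horizontalDeriv, ContinuousLinearMap.comp_apply, formL_act, add_apply, map_add,
    ContinuousLinearMap.toSpanSingleton_apply, one_smul, formL_vert, add_neg_cancel, map_zero]

theorem hasTDerivWithinAt_horizontal {u : ℝ → P} {g : ℝ → G} {K : ℝ →L[ℝ] Q} {S : Set ℝ} {t : ℝ}
    (hu : HasTDerivWithinAt u K S t) (hg : HasRightLogDeriv g (-A.formL (u t) (K 1)) S t) :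
    HasTDerivWithinAt (fun t => π.act (u t) (g t)) (A.horizontalDeriv (u t) (g t) K) S t :=
  π.hasTDerivWithinAt_act hu hg

/-- `c'` is a horizontal lift of `c` at the time `t`. -/
def IsHorizontalAt (c : ℝ → M) (c' : ℝ → P) (S : Set ℝ) (t : ℝ) : Prop :=
  π.proj (c' t) = c t ∧ ∃ L : ℝ →L[ℝ] Q, HasTDerivWithinAt c' L S t ∧ A.formL (c' t) (L 1) = 0

variable {A}

theorem IsHorizontalAt.mono {c : ℝ → M} {c' : ℝ → P} {S T : Set ℝ} {t : ℝ}
    (h : A.IsHorizontalAt c c' S t) (hT : T ⊆ S) : A.IsHorizontalAt c c' T t := by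
  obtain ⟨h1, L, h2, h3⟩ := h
  exact ⟨h1, L, h2.mono hT, h3⟩

/-- The group component of a horizontal lift satisfies the parallel transport equation. -/
theorem IsHorizontalAt.coord {T : π.LocalTriv} {c : ℝ → M} {c' : ℝ → P} {S : Set ℝ} {t : ℝ}
    (hS : UniqueDiffWithinAt ℝ S t) (ht : t ∈ S) (hc : ∀ s ∈ S, π.proj (c' s) = c s)
    (hT : ∀ s ∈ S, c s ∈ T.base) (h : A.IsHorizontalAt c c' S t) {K : ℝ →L[ℝ] Q}
    (hK : HasTDerivWithinAt (fun s => T.sec (c s)) K S t) :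
    HasRightLogDeriv (fun s => T.coord (c' s)) (-A.formL (T.sec (c t)) (K 1)) S t := by
  obtain ⟨-, L, hL, hL0⟩ := h
  have hmem : c' t ∈ π.proj ⁻¹' T.base := by rw [mem_preimage, hc t ht]; exact hT t ht
  have hcd : MDifferentiableAt 𝓘(ℝ, Q) 𝓘(ℝ, F) T.coord (c' t) :=
    (T.smooth_coord.contMDiffAt ((T.isOpen_base.preimage π.smooth_proj.continuous).mem_nhds
      hmem)).mdifferentiableAt (by simp)
  -- Some logarithmic derivative `ξ` exists. The Leibniz rule for `c' = sec · coord` and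
  -- horizontality give `Ad(g⁻¹)(A(K) + ξ) = 0`, which determines it.
  obtain ⟨ξ, hξ⟩ := exists_hasRightLogDeriv (hL.tderiv_comp hcd)
  have e : ∀ s ∈ S, c' s = π.act (T.sec (c s)) (T.coord (c' s)) := by
    intro s hs
    have h1 := T.act_coord (c' s) (by rw [mem_preimage, hc s hs]; exact hT s hs)
    rw [hc s hs] at h1
    exact h1.symm
  have h1 := (π.hasTDerivWithinAt_act hK hξ).congr e (e t ht)
  have h2 := hL.unique h1 hS
  rw [h2, ContinuousLinearMap.comp_apply, congrArg A.formL (e t ht), formL_act, add_apply, map_add,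
    ContinuousLinearMap.toSpanSingleton_apply, one_smul, formL_vert] at hL0
  have h3 : A.formL (T.sec (c t)) (K 1) + ξ = 0 := by
    have h4 := DFunLike.congr_fun (AdL_comp_inv (T.coord (c' t)) : _ = ContinuousLinearMap.id ℝ F)
      (A.formL (T.sec (c t)) (K 1) + ξ)
    rw [ContinuousLinearMap.comp_apply, hL0, map_zero] at h4
    exact h4.symm
  rwa [neg_eq_of_add_eq_zero_right h3]

variable (A) in
/-- Existence of horizontal lifts. -/
theorem exists_isHorizontalAt [CompleteSpace F] {c : ℝ → M}
    (hc : ContMDiffOn 𝓘(ℝ, ℝ) 𝓘(ℝ, E) ∞ c (Icc 0 1)) {p₀ : P} (hp₀ : π.proj p₀ = c 0) :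
    ∃ c' : ℝ → P, c' 0 = p₀ ∧ ∀ t ∈ Icc (0 : ℝ) 1, A.IsHorizontalAt c c' (Icc 0 1) t := by
  refine π.induction_along hc.continuousOn (p := fun b => ∃ c' : ℝ → P, c' 0 = p₀ ∧
    ∀ t ∈ Icc (0 : ℝ) b, A.IsHorizontalAt c c' (Icc 0 b) t) ?_ ?_
  · refine ⟨fun _ => p₀, rfl, fun t ht => ?_⟩
    rw [Icc_self, mem_singleton_iff] at ht
    subst ht
    exact ⟨hp₀, 0, hasTDerivWithinAt_const _ _ _, by simp⟩
  · rintro T a b ha hb hab hT ⟨c₁, h0, h1⟩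
    have hJ : Icc a b ⊆ Icc 0 1 := Icc_subset_Icc ha.1 hb.2
    have hcd : ∀ t ∈ Icc (0 : ℝ) 1, ∃ K : ℝ →L[ℝ] E, HasTDerivWithinAt c K (Icc 0 1) t :=
      fun t ht => ⟨_, (hc.mdifferentiableOn (by simp) t ht).hasMFDerivWithinAt⟩
    choose! Kc hKc using hcd
    set K : ℝ → ℝ →L[ℝ] Q := fun t => (tderiv T.sec (c t) : E →L[ℝ] Q).comp (Kc t) with hKdef
    have hK : ∀ t ∈ Icc a b, HasTDerivWithinAt (fun s => T.sec (c s)) (K t) (Icc 0 1) t :=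
      fun t ht => (hKc t (hJ ht)).tderiv_comp
        ((T.smooth_sec.contMDiffAt (T.isOpen_base.mem_nhds (hT t ht))).mdifferentiableAt (by simp))
    have hsm : ContMDiffOn 𝓘(ℝ, ℝ) 𝓘(ℝ, Q) ∞ (fun s => T.sec (c s)) (Icc a b) :=
      T.smooth_sec.comp (hc.mono hJ) hT
    have hcont : ContinuousOn (fun t => -A.formL (T.sec (c t)) (K t 1)) (Icc a b) := by
      refine ((A.contDiffOn_formL hsm (uniqueDiffOn_Icc hab) 1).continuousOn.congr
        fun t ht => ?_).neg
      have h2 : HasTDerivWithinAt (fun s => T.sec (c s)) _ (Icc a b) t :=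
        (hsm.mdifferentiableOn (by simp) t ht).hasMFDerivWithinAt
      rw [((hK t ht).mono hJ).unique h2 (uniqueDiffOn_Icc hab t ht)]
      rfl
    have ha' : a ∈ Icc a b := left_mem_Icc.2 hab.le
    obtain ⟨g, hg0, hg⟩ := exists_hasRightLogDeriv_Icc hab.le hcont (T.coord (c₁ a))
    have hproj : ∀ t ∈ Icc a b, π.proj (π.act (T.sec (c t)) (g t)) = c t := fun t ht => by
      rw [π.proj_act, T.proj_sec _ (hT t ht)]
    have hga : π.act (T.sec (c a)) (g a) = c₁ a := by
      have h2 := (h1 a (right_mem_Icc.2 ha.1)).1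
      have h3 := T.act_coord (c₁ a) (by rw [mem_preimage, h2]; exact hT a ha')
      rwa [h2, ← hg0] at h3
    have hder : ∀ t ∈ Icc a b, HasTDerivWithinAt (fun t => π.act (T.sec (c t)) (g t))
        (A.horizontalDeriv (T.sec (c t)) (g t) (K t)) (Icc a b) t := fun t ht =>
      A.hasTDerivWithinAt_horizontal ((hK t ht).mono hJ) (hg t ht)
    have hhor : ∀ t ∈ Icc a b, A.IsHorizontalAt c (fun t => π.act (T.sec (c t)) (g t))
        (Icc a b) t := fun t ht =>
      ⟨hproj t ht, _, hder t ht, A.formL_horizontalDeriv _ _ _⟩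
    -- For `a = 0` the earlier lift lives on a single point, where its derivative carries no
    -- information; it is discarded.
    rcases ha.1.eq_or_lt with h | h0a
    · subst h
      exact ⟨_, hga.trans h0, hhor⟩
    refine ⟨fun t => if t ≤ a then c₁ t else π.act (T.sec (c t)) (g t), by simp [ha.1, h0],
      fun t ht => ?_⟩
    rcases lt_trichotomy t a with hta | rfl | hta
    · obtain ⟨h2, L, h3, h4⟩ := h1 t ⟨ht.1, hta.le⟩
      refine ⟨by simp only [if_pos hta.le, h2], L, ?_, by simp only [if_pos hta.le, h4]⟩
      exact hasTDerivWithinAt_glue ha.1 hab.le (fun _ => h3)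
        (fun h => absurd h.1 (not_le.2 hta)) hga.symm ht
    -- At the junction both one-sided derivatives must be the same linear map. The left one is
    -- computed by writing the old lift near `t` as section times group coordinate, whose
    -- logarithmic derivative is forced by horizontality.
    · refine ⟨?_, A.horizontalDeriv (T.sec (c t)) (g t) (K t), ?_, ?_⟩
      · simp only [if_pos le_rfl, ← hga]; exact hproj t ha'
      · refine hasTDerivWithinAt_glue ha.1 hab.le (fun htt => ?_) (fun _ => hder t ha') hga.symm ht
        -- near `t` the curve `c₁` stays in the trivialization
        have hnear : ∀ᶠ s in 𝓝[Icc 0 t] t, c s ∈ T.base :=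
          ((hc.continuousOn t ha).mono (Icc_subset_Icc_right ha.2)).eventually
            (T.isOpen_base.mem_nhds (hT t ha'))
        obtain ⟨δ, hδ, hball⟩ := Metric.mem_nhdsWithin_iff.1 hnear
        set ε := max 0 (t - δ / 2) with hε
        have hεt : ε < t := max_lt h0a (by linarith)
        have hε0 : 0 ≤ ε := le_max_left _ _
        have hsub : Icc ε t ⊆ Icc 0 t := Icc_subset_Icc_left hε0
        have hbase : ∀ s ∈ Icc ε t, c s ∈ T.base := fun s hs => hball ⟨by
          rw [Metric.mem_ball, Real.dist_eq, abs_lt]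
          have := (le_max_right 0 (t - δ / 2)).trans hs.1
          constructor <;> linarith [hs.2], hsub hs⟩
        have htε : t ∈ Icc ε t := right_mem_Icc.2 hεt.le
        have hpr : ∀ s ∈ Icc ε t, π.proj (c₁ s) = c s := fun s hs => (h1 s (hsub hs)).1
        have hKε : HasTDerivWithinAt (fun s => T.sec (c s)) (K t) (Icc ε t) t :=
          (hK t ha').mono (Icc_subset_Icc hε0 ha.2)
        have h5 := IsHorizontalAt.coord (uniqueDiffOn_Icc hεt t htε) htε hpr hbase
          ((h1 t htt).mono hsub) hKε
        have h6 := A.hasTDerivWithinAt_horizontal hKε h5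
        rw [← hg0] at h6
        have h7 : HasTDerivWithinAt c₁ (A.horizontalDeriv (T.sec (c t)) (g t) (K t)) (Icc ε t) t := by
          have e : ∀ s ∈ Icc ε t, c₁ s = π.act (T.sec (c s)) (T.coord (c₁ s)) := by
            intro s hs
            have h8 := T.act_coord (c₁ s) (by rw [mem_preimage, hpr s hs]; exact hbase s hs)
            rw [hpr s hs] at h8
            exact h8.symm
          exact h6.congr e (e t htε)
        refine HasMFDerivWithinAt.mono_of_mem_nhdsWithin h7 ?_
        filter_upwards [self_mem_nhdsWithin, mem_nhdsWithin_of_mem_nhds (Ioi_mem_nhds hεt)]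
          with s hs hs' using ⟨le_of_lt hs', hs.2⟩
      · simp only [if_pos le_rfl, ← hga]
        exact A.formL_horizontalDeriv _ _ _
    · have htb : t ∈ Icc a b := ⟨hta.le, ht.2⟩
      refine ⟨by simp only [if_neg (not_le.2 hta)]; exact hproj t htb,
        A.horizontalDeriv (T.sec (c t)) (g t) (K t), ?_, ?_⟩
      · exact hasTDerivWithinAt_glue ha.1 hab.le (fun h => absurd h.2 (not_le.2 hta))
          (fun _ => hder t htb) hga.symm ht
      · simp only [if_neg (not_le.2 hta)]
        exact A.formL_horizontalDeriv _ _ _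

/-- `transport` is the end point of a chosen lift. Uniqueness of lifts is not required, since the
later statements on parameters hold for every family of horizontal lifts with fixed initial point.
-/
theorem exists_isHorizontalLift_transport [CompleteSpace F] {c : ℝ → M}
    (hc : ContMDiffOn 𝓘(ℝ, ℝ) 𝓘(ℝ, E) ∞ c (Icc 0 1)) {p₀ : P} (hp₀ : π.proj p₀ = c 0) :
    ∃ c' : ℝ → P, c' 0 = p₀ ∧ c' 1 = A.transport c p₀ ∧
      ∀ t ∈ Icc (0 : ℝ) 1, A.IsHorizontalAt c c' (Icc 0 1) t := by
  have h : ∃ c', A.IsHorizontalLift c p₀ c' := by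
    obtain ⟨c', h0, h1⟩ := A.exists_isHorizontalAt hc hp₀
    refine ⟨c', h0, fun t ht => ?_⟩
    obtain ⟨h2, L, h3, h4⟩ := h1 t ht
    refine ⟨h2, h3.mdifferentiableWithinAt, ?_⟩
    rw [HasMFDerivWithinAt.mfderivWithin h3 (uniqueMDiffWithinAt_iff_uniqueDiffWithinAt.2
      (uniqueDiffOn_Icc zero_lt_one t ht))]
    exact h4
  refine ⟨h.choose, h.choose_spec.1, ?_, fun t ht => ?_⟩
  · rw [transport, dif_pos h]
  · obtain ⟨h2, h3, h4⟩ := h.choose_spec.2 t ht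
    exact ⟨h2, _, h3.hasMFDerivWithinAt, h4⟩

end PrincipalBundle.Connection

end Bundles

/-! ### Localization in the parameters -/

section Parameters

variable {R : Type*} [NormedAddCommGroup R] [NormedSpace ℝ R]

/-- A tube lemma: it keeps nearby curves in one trivialization and nearby coefficients below one
bound. -/
theorem exists_ball_forall_mem_of_continuousOn {X Y : Type*} [TopologicalSpace X]
    [TopologicalSpace Y] {S : Set R} {K : Set X} {f : R × X → Y} (hK : IsCompact K)
    (hf : ContinuousOn f (S ×ˢ K)) {r₀ : R} (hr₀ : r₀ ∈ S) {U : Set Y} (hU : IsOpen U)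
    (h : ∀ t ∈ K, f (r₀, t) ∈ U) :
    ∃ δ > 0, ∀ r ∈ S ∩ Metric.ball r₀ δ, ∀ t ∈ K, f (r, t) ∈ U := by
  have h1 : ∀ᶠ r in 𝓝 r₀, ∀ t ∈ K, (r, t) ∈ S ×ˢ K → f (r, t) ∈ U := by
    refine hK.eventually_forall_of_forall_eventually fun t ht => ?_
    exact eventually_nhdsWithin_iff.1 ((hf (r₀, t) ⟨hr₀, ht⟩).eventually (hU.mem_nhds (h t ht)))
  obtain ⟨δ, hδ, hball⟩ := Metric.eventually_nhds_iff_ball.1 h1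
  exact ⟨δ, hδ, fun r hr t ht => hball r hr.2 t ht ⟨hr.1, ht⟩⟩

variable {𝔸 : Type*} [NormedRing 𝔸] [NormedAlgebra ℝ 𝔸] [CompleteSpace 𝔸]

/-- Being `C¹` is local in the parameter, and on a small ball compactness of the time interval
provides the uniform bound on the coefficient, here `C + 1`. -/
theorem contDiffOn_one_of_linearODE_of_contDiffOn {S : Set R} (hS : Convex ℝ S)
    (hSu : UniqueDiffOn ℝ S) {t₀ t₁ : ℝ} (h01 : t₀ < t₁) {α : R × ℝ → 𝔸}
    (hα : ContDiffOn ℝ 1 α (S ×ˢ Icc t₀ t₁)) {W V : R → ℝ → 𝔸}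
    (hW0 : ∀ r ∈ S, W r t₀ = 1) (hV0 : ∀ r ∈ S, V r t₀ = 1)
    (hVW : ∀ r ∈ S, ∀ t ∈ Icc t₀ t₁, V r t * W r t = 1)
    (hWV : ∀ r ∈ S, ∀ t ∈ Icc t₀ t₁, W r t * V r t = 1)
    (hW : ∀ r ∈ S, ∀ t ∈ Icc t₀ t₁, HasDerivWithinAt (W r) (W r t * α (r, t)) (Icc t₀ t₁) t)
    (hV : ∀ r ∈ S, ∀ t ∈ Icc t₀ t₁, HasDerivWithinAt (V r) (-(α (r, t) * V r t)) (Icc t₀ t₁) t) :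
    ContDiffOn ℝ 1 (fun r => W r t₁) S := by
  intro r₀ hr₀
  obtain ⟨C, hC⟩ := (isCompact_Icc (a := t₀) (b := t₁)).exists_bound_of_continuousOn
    (f := fun t => α (r₀, t)) (hα.continuousOn.comp (by fun_prop) fun t ht => ⟨hr₀, ht⟩)
  obtain ⟨δ, hδ, hball⟩ := exists_ball_forall_mem_of_continuousOn isCompact_Icc hα.continuousOn hr₀
    (U := {a | ‖a‖ < C + 1}) (isOpen_lt continuous_norm continuous_const)
    fun t ht => (hC t ht).trans_lt (lt_add_one C)
  set S' := S ∩ Metric.ball r₀ δ with hS'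
  have hsub : S' ⊆ S := inter_subset_left
  have hSI : UniqueDiffOn ℝ (S ×ˢ Icc t₀ t₁) := hSu.prod (uniqueDiffOn_Icc h01)
  have key : ContDiffOn ℝ 1 (fun r => W r t₁) S' := by
    refine contDiffOn_one_of_linearODE (hS.inter (convex_ball r₀ δ)) (hSu.inter Metric.isOpen_ball)
      (C := C + 1) h01.le (α := fun r t => α (r, t)) (V := V)
      (α' := fun r t => (fderivWithin ℝ α (S ×ˢ Icc t₀ t₁) (r, t)).comp
        (ContinuousLinearMap.inl ℝ R ℝ))
      (fun r hr => hα.continuousOn.comp (by fun_prop) fun t ht => ⟨hr.1, ht⟩) ?_ ?_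
      (fun r hr t ht => (hball r hr t ht).le) (fun r hr => hW0 r hr.1) (fun r hr => hV0 r hr.1)
      (fun r hr => hVW r hr.1) (fun r hr => hWV r hr.1) (fun r hr => hW r hr.1)
      (fun r hr => hV r hr.1)
    · exact ((hα.continuousOn_fderivWithin hSI le_rfl).mono
        (prod_mono hsub Subset.rfl)).clm_comp continuousOn_const
    · intro r hr t ht
      exact ((hα.differentiableOn one_ne_zero (r, t) ⟨hr.1, ht⟩).hasFDerivWithinAt).comp
        (f := fun r => (r, t)) r (hasFDerivAt_prodMk_left r t).hasFDerivWithinAt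
        fun r' hr' => ⟨hr'.1, ht⟩
  exact (contDiffWithinAt_inter (Metric.ball_mem_nhds r₀ hδ)).1
    (key r₀ ⟨hr₀, Metric.mem_ball_self hδ⟩)

end Parameters

/-! ### Dependence of parallel transport on parameters -/

section Bundles

variable {E : Type*} [NormedAddCommGroup E] [NormedSpace ℝ E]
  {M : Type*} [TopologicalSpace M] [ChartedSpace E M]
  {F : Type*} [NormedAddCommGroup F] [NormedSpace ℝ F]
  {G : Type*} [TopologicalSpace G] [ChartedSpace F G] [Group G] [LieGroup 𝓘(ℝ, F) ∞ G]
  {Q : Type*} [NormedAddCommGroup Q] [NormedSpace ℝ Q]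
  {P : Type*} [TopologicalSpace P] [ChartedSpace Q P]
  [IsManifold 𝓘(ℝ, E) ∞ M] [IsManifold 𝓘(ℝ, Q) ∞ P] {π : PrincipalBundle E M F G Q P}
  {R : Type*} [NormedAddCommGroup R] [NormedSpace ℝ R]

/-- The transition function between two trivializations. -/
theorem PrincipalBundle.LocalTriv.coord_eq (T T' : π.LocalTriv) {p : P} (h : π.proj p ∈ T.base)
    (h' : π.proj p ∈ T'.base) : T'.coord p = T'.coord (T.sec (π.proj p)) * T.coord p := by
  have h1 := T'.act_coord (T.sec (π.proj p)) (by rwa [mem_preimage, T.proj_sec _ h])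
  rw [T.proj_sec _ h] at h1
  have h2 := T.act_coord p h
  rw [← h1, ← π.act_mul] at h2
  have h3 := congrArg T'.coord h2
  rw [T'.coord_act _ h'] at h3
  exact h3.symm

namespace PrincipalBundle.Connection

variable {A : π.Connection}

/-- The quotient `g(t) g(a)⁻¹` starts at `1` and has the same logarithmic derivative `-α` as `g`.
Under `Ad` of the inverse this becomes `W' = W ∘ ad α` in `F →L[ℝ] F`, with `Ad` of the quotient as
the inverse solution `V`. -/
theorem contDiffOn_AdL_coord_div [CompleteSpace F] {T : π.LocalTriv} {S : Set R} (hS : Convex ℝ S)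
    (hSu : UniqueDiffOn ℝ S) {a b : ℝ} (hab : a < b) {c : R × ℝ → M}
    (hc : ContMDiffOn 𝓘(ℝ, R × ℝ) 𝓘(ℝ, E) ∞ c (S ×ˢ Icc a b))
    (hT : ∀ r ∈ S, ∀ t ∈ Icc a b, c (r, t) ∈ T.base) {c' : R → ℝ → P}
    (hc' : ∀ r ∈ S, ∀ t ∈ Icc a b, A.IsHorizontalAt (fun t => c (r, t)) (c' r) (Icc a b) t) :
    ContDiffOn ℝ 1 (fun r => (AdL (T.coord (c' r b) * (T.coord (c' r a))⁻¹)⁻¹ : F →L[ℝ] F)) S := by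
  have hSI : UniqueDiffOn ℝ (S ×ˢ Icc a b) := hSu.prod (uniqueDiffOn_Icc hab)
  have hsec : ContMDiffOn 𝓘(ℝ, R × ℝ) 𝓘(ℝ, Q) ∞ (fun z => T.sec (c z)) (S ×ˢ Icc a b) :=
    T.smooth_sec.comp hc fun z hz => hT z.1 hz.1 z.2 hz.2
  set α : R × ℝ → F := fun z => A.formL (T.sec (c z))
    (mfderivWithin 𝓘(ℝ, R × ℝ) 𝓘(ℝ, Q) (fun z => T.sec (c z)) (S ×ˢ Icc a b) z (0, 1) : Q) with hα
  have hαs : ContDiffOn ℝ ∞ α (S ×ˢ Icc a b) := A.contDiffOn_formL hsec hSI (0, 1)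
  have hg : ∀ r ∈ S, ∀ t ∈ Icc a b,
      HasRightLogDeriv (fun s => T.coord (c' r s)) (-α (r, t)) (Icc a b) t := by
    intro r hr t ht
    have h5 : HasTDerivWithinAt (fun z => T.sec (c z)) _ (S ×ˢ Icc a b) (r, t) :=
      (hsec.mdifferentiableOn (by simp) (r, t) ⟨hr, ht⟩).hasMFDerivWithinAt
    have h6 : HasTDerivWithinAt (fun s : ℝ => (r, s)) (ContinuousLinearMap.inr ℝ R ℝ) (Icc a b) t :=
      hasTDerivWithinAt_iff_hasFDerivWithinAt.2 (hasFDerivAt_prodMk_right r t).hasFDerivWithinAt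
    have h7 := HasTDerivWithinAt.comp (f := fun s : ℝ => (r, s)) h5 h6 fun s hs => ⟨hr, hs⟩
    exact IsHorizontalAt.coord (c := fun s => c (r, s)) (uniqueDiffOn_Icc hab t ht) ht
      (fun s hs => (hc' r hr s hs).1) (hT r hr) (hc' r hr t ht) h7
  have hh : ∀ r ∈ S, ∀ t ∈ Icc a b,
      HasRightLogDeriv (fun s => T.coord (c' r s) * (T.coord (c' r a))⁻¹) (-α (r, t))
        (Icc a b) t := fun r hr t ht => (hg r hr t ht).mul_const _
  refine contDiffOn_one_of_linearODE_of_contDiffOn (𝔸 := F →L[ℝ] F) hS hSu hab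
    (α := fun z => adL G (α z))
    (((adL G).contDiff.comp_contDiffOn hαs).of_le (by simp))
    (W := fun r t => AdL (T.coord (c' r t) * (T.coord (c' r a))⁻¹)⁻¹)
    (V := fun r t => AdL (T.coord (c' r t) * (T.coord (c' r a))⁻¹)) ?_ ?_ ?_ ?_ ?_ ?_
  · intro r _
    simp only [mul_inv_cancel, inv_one, AdL_one]; rfl
  · intro r _
    simp only [mul_inv_cancel, AdL_one]; rfl
  · exact fun r _ t _ => AdL_comp_inv _
  · exact fun r _ t _ => AdL_inv_comp _
  · intro r hr t ht
    have h1 := (hh r hr t ht).AdL_inv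
    rw [map_neg, ContinuousLinearMap.comp_neg, neg_neg] at h1
    exact h1
  · intro r hr t ht
    have h1 := (hh r hr t ht).AdL
    rw [map_neg, ContinuousLinearMap.neg_comp] at h1
    exact h1

/-- Horizontal lifts depend in a `C¹` way on parameters. -/
theorem exists_contDiffWithinAt_AdL_coord [CompleteSpace F] {S : Set R} (hS : Convex ℝ S)
    (hSu : UniqueDiffOn ℝ S) {c : R × ℝ → M}
    (hc : ContMDiffOn 𝓘(ℝ, R × ℝ) 𝓘(ℝ, E) ∞ c (S ×ˢ Icc 0 1)) {p₀ : P} {c' : R → ℝ → P}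
    (h0 : ∀ r ∈ S, c' r 0 = p₀)
    (hc' : ∀ r ∈ S, ∀ t ∈ Icc (0 : ℝ) 1,
      A.IsHorizontalAt (fun t => c (r, t)) (c' r) (Icc 0 1) t) {r₀ : R} (hr₀ : r₀ ∈ S) :
    ∃ T : π.LocalTriv, c (r₀, 1) ∈ T.base ∧
      ContDiffWithinAt ℝ 1 (fun r => (AdL (T.coord (c' r 1))⁻¹ : F →L[ℝ] F)) S r₀ := by
  have hc0 : ContinuousOn (fun t => c (r₀, t)) (Icc 0 1) :=
    hc.continuousOn.comp (by fun_prop) fun t ht => ⟨hr₀, ht⟩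
  refine π.induction_along hc0 (p := fun t => ∃ T : π.LocalTriv, c (r₀, t) ∈ T.base ∧
      ContDiffWithinAt ℝ 1 (fun r => (AdL (T.coord (c' r t))⁻¹ : F →L[ℝ] F)) S r₀) ?_ ?_
  · obtain ⟨T, hT⟩ := π.exists_localTriv (c (r₀, 0))
    refine ⟨T, hT, (contDiffWithinAt_const (c := AdL (T.coord p₀)⁻¹)).congr (fun r hr => ?_) ?_⟩
    · rw [h0 r hr]
    · rw [h0 r₀ hr₀]
  · rintro T a b ha hb hab hT ⟨T₁, hT₁, hd⟩
    have haJ : a ∈ Icc a b := left_mem_Icc.2 hab.le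
    have hJ : Icc a b ⊆ Icc 0 1 := Icc_subset_Icc ha.1 hb.2
    have hcab := hc.mono (prod_mono (Subset.refl S) hJ)
    obtain ⟨δ, hδ, hball⟩ := exists_ball_forall_mem_of_continuousOn isCompact_Icc
      hcab.continuousOn hr₀ T.isOpen_base hT
    have hca : ContMDiffOn 𝓘(ℝ, R) 𝓘(ℝ, E) ∞ (fun r => c (r, a)) S := by
      have h1 : ContMDiff 𝓘(ℝ, R) 𝓘(ℝ, R × ℝ) ∞ (fun r : R => (r, a)) :=
        (contDiff_id.prodMk contDiff_const).contMDiff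
      exact hc.comp h1.contMDiffOn fun r hr => ⟨hr, ha⟩
    refine ⟨T, hT b (right_mem_Icc.2 hab.le), ?_⟩
    set S' := S ∩ Metric.ball r₀ δ with hS'
    have h1 := contDiffOn_AdL_coord_div (hS.inter (convex_ball r₀ δ))
      (hSu.inter Metric.isOpen_ball) hab (hcab.mono (prod_mono inter_subset_left Subset.rfl)) hball
      (fun r hr t ht => (hc' r hr.1 t (hJ ht)).mono hJ)
    have h2 : ContDiffWithinAt ℝ 1 (fun r =>
        (AdL (T.coord (c' r b) * (T.coord (c' r a))⁻¹)⁻¹ : F →L[ℝ] F)) S r₀ :=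
      (contDiffWithinAt_inter (Metric.ball_mem_nhds r₀ hδ)).1
        (h1 r₀ ⟨hr₀, Metric.mem_ball_self hδ⟩)
    have h3 : ContDiffWithinAt ℝ 1 (fun r =>
        (AdL (T.coord (T₁.sec (c (r, a))))⁻¹ : F →L[ℝ] F)) S r₀ := by
      rw [← contMDiffWithinAt_iff_contDiffWithinAt]
      have h4 : ContMDiffWithinAt 𝓘(ℝ, R) 𝓘(ℝ, Q) ∞ (fun r => T₁.sec (c (r, a))) S r₀ :=
        (T₁.smooth_sec.contMDiffAt (T₁.isOpen_base.mem_nhds hT₁)).comp_contMDiffWithinAt r₀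
          (hca r₀ hr₀)
      have h5 : ContMDiffWithinAt 𝓘(ℝ, R) 𝓘(ℝ, F) ∞ (fun r => T.coord (T₁.sec (c (r, a)))) S r₀ :=
        (T.smooth_coord.contMDiffAt ((T.isOpen_base.preimage π.smooth_proj.continuous).mem_nhds
          (by rw [mem_preimage, T₁.proj_sec _ hT₁]; exact hT a haJ))).comp_contMDiffWithinAt r₀ h4
      exact (((contMDiff_AdL F G).contMDiffAt.comp_contMDiffWithinAt r₀ h5.inv).of_le (by simp))
    refine ((hd.clm_comp h3).clm_comp h2).congr_of_eventuallyEq_of_mem ?_ hr₀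
    have h6 : ∀ᶠ r in 𝓝[S] r₀, c (r, a) ∈ T₁.base :=
      (hca.continuousOn r₀ hr₀).eventually (T₁.isOpen_base.mem_nhds hT₁)
    have h7 : ∀ᶠ r in 𝓝[S] r₀, c (r, a) ∈ T.base :=
      (hca.continuousOn r₀ hr₀).eventually (T.isOpen_base.mem_nhds (hT a haJ))
    filter_upwards [h6, h7, self_mem_nhdsWithin] with r h8 h9 hr
    have h10 : π.proj (c' r a) = c (r, a) := (hc' r hr a ha).1
    have h11 := T₁.coord_eq T (p := c' r a) (by rwa [h10]) (by rwa [h10])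
    rw [h10] at h11
    -- The new coordinate at `b` is the quotient over `[a, b]`, times the transition function, times
    -- the old coordinate at `a`. Inversion reverses the three factors.
    rw [← AdL_mul, ← AdL_mul, ← mul_inv_rev, ← h11, ← mul_inv_rev, inv_mul_cancel_right]

end PrincipalBundle.Connection

end Bundles

/-! ### Adjoint forms in local frames and along parallel transport -/

theorem contMDiff_tangentBundle_mk {X H : Type*} [NormedAddCommGroup X] [NormedSpace ℝ X] [NormedAddCommGroup H] [NormedSpace ℝ H]
  {κ w : X → H} (hκ : ContDiff ℝ ∞ κ) (hw : ContDiff ℝ ∞ w) :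
  ContMDiff 𝓘(ℝ, X) (𝓘(ℝ, H)).tangent ∞ (fun x => (⟨κ x, w x⟩ : TangentBundle 𝓘(ℝ, H) H)) := by
  intro x
  apply Bundle.contMDiffAt_totalSpace.2
  refine ⟨hκ.contMDiff x, ?_⟩
  convert! hw.contMDiff x with y
  simp

/-- A smooth substitute for restriction to `U`: composition with `κ` makes a map defined on `U`
global without changing it near `e₀`. -/
theorem exists_contDiff_eventuallyEq_id {V : Type*} [NormedAddCommGroup V] [NormedSpace ℝ V] [HasContDiffBump V]
   {e₀ : V} {U : Set V} (hU : U ∈ 𝓝 e₀) :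
   ∃ κ : V → V, ContDiff ℝ ∞ κ ∧ (∀ e, κ e ∈ U) ∧ ∀ᶠ e in 𝓝 e₀, κ e = e := by
  obtain ⟨r, hr, hrU⟩ := Metric.mem_nhds_iff.1 hU
  let f : ContDiffBump e₀ := ⟨r / 4, r / 2, by positivity, by linarith⟩
  refine ⟨fun e => e₀ + f e • (e - e₀), ?_, fun e => hrU ?_, ?_⟩
  · exact contDiff_const.add (f.contDiff.smul (contDiff_id.sub contDiff_const))
  · rw [mem_ball_iff_norm, add_sub_cancel_left, norm_smul, Real.norm_of_nonneg f.nonneg]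
    by_cases h : e ∈ Metric.ball e₀ (r / 2)
    · rw [mem_ball_iff_norm] at h
      nlinarith [f.nonneg (x := e), f.le_one (x := e), norm_nonneg (e - e₀)]
    · rw [f.zero_of_le_dist (x := e) (by simpa using h), zero_mul]; exact hr
  · filter_upwards [f.eventuallyEq_one] with e he
    rw [he]; simp

section Bundles

variable {E : Type*} [NormedAddCommGroup E] [NormedSpace ℝ E]
  {M : Type*} [TopologicalSpace M] [ChartedSpace E M]
  {F : Type*} [NormedAddCommGroup F] [NormedSpace ℝ F]
  {G : Type*} [TopologicalSpace G] [ChartedSpace F G] [Group G] [LieGroup 𝓘(ℝ, F) ∞ G]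
  {Q : Type*} [NormedAddCommGroup Q] [NormedSpace ℝ Q]
  {P : Type*} [TopologicalSpace P] [ChartedSpace Q P]
  [IsManifold 𝓘(ℝ, E) ∞ M] [IsManifold 𝓘(ℝ, Q) ∞ P] {π : PrincipalBundle E M F G Q P}
  {R : Type*} [NormedAddCommGroup R] [NormedSpace ℝ R] {k : ℕ}

theorem tangentBundle_mk_congr {y z : M} (h : y = z) (v : E) :
    (⟨y, v⟩ : TangentBundle 𝓘(ℝ, E) M) = ⟨z, v⟩ := by
  subst h; rfl

/-- The coordinates, in the chart at `y₀`, of a smooth field along a smooth map. -/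
theorem contDiffWithinAt_mfderiv_extChartAt {S : Set R} {y : R → M} {ξ : R → E} {r₀ : R} {y₀ : M}
    (h : ContMDiffWithinAt 𝓘(ℝ, R) (𝓘(ℝ, E)).tangent ∞
      (fun r => (⟨y r, ξ r⟩ : TangentBundle 𝓘(ℝ, E) M)) S r₀)
    (hy : y r₀ ∈ (chartAt E y₀).source) :
    ContDiffWithinAt ℝ ∞ (fun r => (tderiv (extChartAt 𝓘(ℝ, E) y₀) (y r) : E →L[ℝ] E) (ξ r))
      S r₀ := by
  have ho := (chartAt E y₀).open_source
  have h0 : ContMDiffOn 𝓘(ℝ, E) 𝓘(ℝ, E) ∞ (extChartAt 𝓘(ℝ, E) y₀) (chartAt E y₀).source :=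
    contMDiffOn_extChartAt
  have h1 := h0.contMDiffOn_tangentMapWithin (m := ∞) (by simp) ho.uniqueMDiffOn
  have h2 := (contMDiff_snd_tangentBundle_modelSpace (n := ∞) E 𝓘(ℝ, E)).comp_contMDiffOn h1
  have h3 := (h2.contMDiffAt (x := (⟨y r₀, ξ r₀⟩ : TangentBundle 𝓘(ℝ, E) M))
    ((ho.preimage (FiberBundle.continuous_proj E (TangentSpace 𝓘(ℝ, E)))).mem_nhds
      hy)).comp_contMDiffWithinAt r₀ h
  rw [← contMDiffWithinAt_iff_contDiffWithinAt]
  have hyc : ContinuousWithinAt y S r₀ :=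
    (FiberBundle.continuous_proj E (TangentSpace 𝓘(ℝ, E))).continuousAt.comp_continuousWithinAt
      h.continuousWithinAt
  have e : ∀ r, y r ∈ (chartAt E y₀).source →
      (tderiv (extChartAt 𝓘(ℝ, E) y₀) (y r) : E →L[ℝ] E) (ξ r) =
      (tangentMapWithin 𝓘(ℝ, E) 𝓘(ℝ, E) (extChartAt 𝓘(ℝ, E) y₀) (chartAt E y₀).source
        ⟨y r, ξ r⟩).2 := by
    intro r hr
    exact DFunLike.congr_fun (mfderivWithin_of_isOpen ho hr).symm
      (ξ r)
  exact h3.congr_of_eventuallyEq ((hyc.eventually (ho.mem_nhds hy)).mono e) (e r₀ hy)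

/-- The value of the form in the frame `p`, as an alternating map on the model space. -/
def PrincipalBundle.AdjointForm.formL (B : π.AdjointForm k) (p : P) : E [⋀^Fin k]→L[ℝ] F :=
  B.form p

theorem PrincipalBundle.AdjointForm.formL_act (B : π.AdjointForm k) (p : P) (g : G)
    (v : Fin k → E) : B.formL (π.act p g) v = AdL g⁻¹ (B.formL p v) := B.equivariant p g v

/-- An adjoint form is smooth in a local frame. -/
theorem PrincipalBundle.AdjointForm.contDiffWithinAt_formL_sec [FiniteDimensional ℝ E]
    (B : π.AdjointForm k) (T : π.LocalTriv) {S : Set R} {y : R → M} {ξ : Fin k → R → E} {r₀ : R}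
    (hy : ContMDiffWithinAt 𝓘(ℝ, R) 𝓘(ℝ, E) ∞ y S r₀)
    (hξ : ∀ i, ContMDiffWithinAt 𝓘(ℝ, R) (𝓘(ℝ, E)).tangent ∞
      (fun r => (⟨y r, ξ i r⟩ : TangentBundle 𝓘(ℝ, E) M)) S r₀) (hr₀ : r₀ ∈ S)
    (hT : y r₀ ∈ T.base) :
    ContDiffWithinAt ℝ ∞ (fun r => B.formL (T.sec (y r)) (fun i => ξ i r)) S r₀ := by
  set φ := extChartAt 𝓘(ℝ, E) (y r₀) with hφ
  have hy₀ : y r₀ ∈ φ.source := mem_extChartAt_source _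
  have hto : IsOpen φ.target := isOpen_extChartAt_target (y r₀)
  have hsym : ContMDiffOn 𝓘(ℝ, E) 𝓘(ℝ, E) ∞ φ.symm φ.target := contMDiffOn_extChartAt_symm _
  have hU : φ.target ∩ φ.symm ⁻¹' T.base ∈ 𝓝 (φ (y r₀)) :=
    (hsym.continuousOn.isOpen_inter_preimage hto T.isOpen_base).mem_nhds
      ⟨φ.map_source hy₀, by rw [mem_preimage, φ.left_inv hy₀]; exact hT⟩
  -- The smoothness condition on `B` tests only maps defined on a whole space `ℝᵐ`. Squeezing by `κ`
  -- extends the chart expression to all of `E`, and a linear identification of `E × (Fin k → E)`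
  -- with some `ℝᵐ` makes the condition applicable.
  obtain ⟨κ, hκ, hκU, hκe⟩ := exists_contDiff_eventuallyEq_id hU
  -- the form in the chart
  set b : E × (Fin k → E) → F := fun z => B.formL (T.sec (φ.symm (κ z.1)))
    (fun i => (tderiv φ.symm (κ z.1) : E →L[ℝ] E) (z.2 i)) with hb
  have hbs : ContDiff ℝ ∞ b := by
    obtain ⟨e⟩ : Nonempty ((Fin (Module.finrank ℝ (E × (Fin k → E))) → ℝ) ≃L[ℝ] E × (Fin k → E)) :=
      ⟨ContinuousLinearEquiv.ofFinrankEq (by simp)⟩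
    have hκ' : ContDiff ℝ ∞ (fun q => κ (e q).1) := hκ.comp (contDiff_fst.comp e.contDiff)
    have h0 : ContMDiff 𝓘(ℝ, Fin (Module.finrank ℝ (E × (Fin k → E))) → ℝ) 𝓘(ℝ, E) ∞
        (fun q => φ.symm (κ (e q).1)) :=
      hsym.comp_contMDiff hκ'.contMDiff fun q => (hκU _).1
    have h1 : ContMDiff 𝓘(ℝ, Fin (Module.finrank ℝ (E × (Fin k → E))) → ℝ) 𝓘(ℝ, Q) ∞
        (fun q => T.sec (φ.symm (κ (e q).1))) :=
      T.smooth_sec.comp_contMDiff h0 fun q => (hκU _).2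
    have h2 : ∀ i, ContMDiff 𝓘(ℝ, Fin (Module.finrank ℝ (E × (Fin k → E))) → ℝ)
        (𝓘(ℝ, E)).tangent ∞ (fun q => (⟨π.proj (T.sec (φ.symm (κ (e q).1))),
          (tderiv φ.symm (κ (e q).1) : E →L[ℝ] E) ((e q).2 i)⟩ : TangentBundle 𝓘(ℝ, E) M)) := by
      intro i
      have h3 := hsym.contMDiffOn_tangentMapWithin (m := ∞) (by simp) hto.uniqueMDiffOn
      have h4 : ContDiff ℝ ∞ (fun q => (e q).2 i) :=
        (contDiff_apply ℝ E i).comp (contDiff_snd.comp e.contDiff)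
      have h5 := h3.comp_contMDiff (contMDiff_tangentBundle_mk hκ' h4) fun q => (hκU _).1
      refine h5.congr fun q => ?_
      rw [tangentBundle_mk_congr (T.proj_sec _ (hκU (e q).1).2)]
      exact congrArg (fun L : E →L[ℝ] E => (⟨φ.symm (κ (e q).1), L ((e q).2 i)⟩ :
        TangentBundle 𝓘(ℝ, E) M)) (mfderivWithin_of_isOpen hto (hκU (e q).1).1).symm
    have h6 : ContDiff ℝ ∞ (fun q => b (e q)) := B.smooth _ _ _ h1 h2
    simpa [Function.comp_def] using h6.comp e.symm.contDiff
  have hφy : ContDiffWithinAt ℝ ∞ (fun r => φ (y r)) S r₀ := by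
    rw [← contMDiffWithinAt_iff_contDiffWithinAt]
    have h1 : ContMDiffAt 𝓘(ℝ, E) 𝓘(ℝ, E) ∞ φ (y r₀) := contMDiffAt_extChartAt
    exact h1.comp_contMDiffWithinAt r₀ hy
  have hw : ContDiffWithinAt ℝ ∞ (fun r => fun i => (tderiv φ (y r) : E →L[ℝ] E) (ξ i r)) S r₀ :=
    contDiffWithinAt_pi.2 fun i =>
      contDiffWithinAt_mfderiv_extChartAt (hξ i) (mem_chart_source E (y r₀))
  refine (hbs.contDiffAt.comp_contDiffWithinAt r₀ (hφy.prodMk hw)).congr_of_eventuallyEq_of_mem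
    ?_ hr₀
  filter_upwards [hφy.continuousWithinAt.eventually hκe,
    hy.continuousWithinAt.eventually ((isOpen_extChartAt_source (y r₀)).mem_nhds hy₀)] with r h1 h2
  simp only [Function.comp_apply, hb, h1]
  rw [φ.left_inv h2]
  congr 1
  funext i
  -- The derivatives of the chart and of its inverse cancel, so the chart expression returns the
  -- original vectors.
  have h3 := tderiv_comp (f := φ) (g := φ.symm) (x := y r) rfl
    ((hsym.contMDiffAt (hto.mem_nhds (φ.map_source h2))).mdifferentiableAt (by simp))
    (mdifferentiableAt_extChartAt (by rwa [extChartAt_source] at h2))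
  have h4 : (tderiv (fun z => φ.symm (φ z)) (y r) : E →L[ℝ] E) = ContinuousLinearMap.id ℝ E := by
    have h5 : (fun z => φ.symm (φ z)) =ᶠ[𝓝 (y r)] id := by
      filter_upwards [(isOpen_extChartAt_source (y r₀)).mem_nhds h2] with z hz using φ.left_inv hz
    exact (Filter.EventuallyEq.mfderiv_eq h5).trans (mfderiv_id)
  rw [h4] at h3
  exact DFunLike.congr_fun h3 (ξ i r)

namespace PrincipalBundle.Connection

/-- The integrand of the loop form depends in a `C¹` way on parameters. -/
theorem contDiffOn_formL_transport [FiniteDimensional ℝ E] [CompleteSpace F] (A : π.Connection)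
    (B : π.AdjointForm k) {S : Set R} (hS : Convex ℝ S) (hSu : UniqueDiffOn ℝ S) {c : R × ℝ → M}
    (hc : ContMDiffOn 𝓘(ℝ, R × ℝ) 𝓘(ℝ, E) ∞ c (S ×ˢ Icc 0 1)) {p₀ : P}
    (hp₀ : ∀ r ∈ S, π.proj p₀ = c (r, 0)) {ξ : Fin k → R → E}
    (hξ : ∀ i, ContMDiffOn 𝓘(ℝ, R) (𝓘(ℝ, E)).tangent ∞
      (fun r => (⟨c (r, 1), ξ i r⟩ : TangentBundle 𝓘(ℝ, E) M)) S) :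
    ContDiffOn ℝ 1 (fun r => B.formL (A.transport (fun t => c (r, t)) p₀) (fun i => ξ i r)) S := by
  have hlift : ∀ r ∈ S, ∃ c' : ℝ → P, c' 0 = p₀ ∧ c' 1 = A.transport (fun t => c (r, t)) p₀ ∧
      ∀ t ∈ Icc (0 : ℝ) 1, A.IsHorizontalAt (fun t => c (r, t)) c' (Icc 0 1) t := by
    intro r hr
    refine exists_isHorizontalLift_transport ?_ (hp₀ r hr)
    have h1 : ContMDiff 𝓘(ℝ, ℝ) 𝓘(ℝ, R × ℝ) ∞ (fun t : ℝ => (r, t)) :=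
      (contDiff_const.prodMk contDiff_id).contMDiff
    exact hc.comp h1.contMDiffOn fun t ht => ⟨hr, ht⟩
  have : Nonempty P := ⟨p₀⟩
  choose! c' h0 h1 hc' using hlift
  have hy : ContMDiffOn 𝓘(ℝ, R) 𝓘(ℝ, E) ∞ (fun r => c (r, 1)) S := by
    have h1 : ContMDiff 𝓘(ℝ, R) 𝓘(ℝ, R × ℝ) ∞ (fun r : R => (r, (1 : ℝ))) :=
      (contDiff_id.prodMk contDiff_const).contMDiff
    exact hc.comp h1.contMDiffOn fun r hr => ⟨hr, right_mem_Icc.2 zero_le_one⟩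
  intro r₀ hr₀
  obtain ⟨T, hT, hTd⟩ := exists_contDiffWithinAt_AdL_coord hS hSu hc h0 hc' hr₀
  have h2 := B.contDiffWithinAt_formL_sec T (hy r₀ hr₀) (fun i => hξ i r₀ hr₀) hr₀ hT
  -- The transported frame is `sec(y) · g`, so equivariance turns the value of `B` in it into
  -- `Ad(g⁻¹)` applied to the value in the frame `sec(y)`. The first factor is `C¹`, the second
  -- smooth.
  refine (hTd.clm_apply (h2.of_le (by simp))).congr_of_eventuallyEq_of_mem ?_ hr₀
  filter_upwards [(hy r₀ hr₀).continuousWithinAt.eventually (T.isOpen_base.mem_nhds hT),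
    self_mem_nhdsWithin] with r hr hrS
  have h3 : π.proj (c' r 1) = c (r, 1) := (hc' r hrS 1 (right_mem_Icc.2 zero_le_one)).1
  have h4 := T.act_coord (c' r 1) (by rwa [mem_preimage, h3])
  rw [h3] at h4
  rw [← h1 r hrS, ← AdjointForm.formL_act, h4]

end PrincipalBundle.Connection

end Bundles

/-! ### The connection on the loop space built from `A` and `B` -/

section Bundles

variable {E : Type*} [NormedAddCommGroup E] [NormedSpace ℝ E]
  {M : Type*} [TopologicalSpace M] [ChartedSpace E M]
  {F : Type*} [NormedAddCommGroup F] [NormedSpace ℝ F]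
  {G : Type*} [TopologicalSpace G] [ChartedSpace F G] [Group G] [LieGroup 𝓘(ℝ, F) ∞ G]
  {Q : Type*} [NormedAddCommGroup Q] [NormedSpace ℝ Q]
  {P : Type*} [TopologicalSpace P] [ChartedSpace Q P]
  [IsManifold 𝓘(ℝ, E) ∞ M] [IsManifold 𝓘(ℝ, Q) ∞ P] {π : PrincipalBundle E M F G Q P}
  {x₀ : M} {n : ℕ}

/-- The derivatives of an `n`-loop in the directions of the coordinate axes. -/
def partialDeriv (N : Ω^ (Fin n) M x₀) (s : Fin n → ℝ) (i : Fin n) : E :=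
  mfderivWithin 𝓘(ℝ, Fin n → ℝ) 𝓘(ℝ, E) (fun s' : Fin n → ℝ => N (toCube s')) (Icc 0 1) s
    (Pi.single i (1 : ℝ))

theorem IsSmoothFamily.partialDeriv_eq {V : Type*} [NormedAddCommGroup V] [NormedSpace ℝ V]
    {S : Set V} {x : V → Ω^ (Fin n) M x₀} (hx : IsSmoothFamily E S x) {q : V} (hq : q ∈ S)
    {s : Fin n → ℝ} (hs : s ∈ Icc (0 : Fin n → ℝ) 1) (i : Fin n) :
    (partialDeriv (x q) s i : E) =
      mfderivWithin 𝓘(ℝ, V × (Fin n → ℝ)) 𝓘(ℝ, E) (fun z : V × (Fin n → ℝ) => x z.1 (toCube z.2))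
        (S ×ˢ Icc 0 1) (q, s) (0, Pi.single i 1) := by
  have h5 : HasTDerivWithinAt (fun z : V × (Fin n → ℝ) => x z.1 (toCube z.2)) _ (S ×ˢ Icc 0 1)
    (q, s) := (ContMDiffOn.mdifferentiableOn hx (by simp) (q, s) ⟨hq, hs⟩).hasMFDerivWithinAt
  have h6 : HasTDerivWithinAt (fun s' : Fin n → ℝ => (q, s'))
      (ContinuousLinearMap.inr ℝ V (Fin n → ℝ)) (Icc 0 1) s :=
    hasTDerivWithinAt_iff_hasFDerivWithinAt.2 (hasFDerivAt_prodMk_right q s).hasFDerivWithinAt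
  have h7 := HasTDerivWithinAt.comp (f := fun s' : Fin n → ℝ => (q, s')) h5 h6
    fun s' hs' => ⟨hq, hs'⟩
  exact DFunLike.congr_fun (HasMFDerivWithinAt.mfderivWithin h7
    (uniqueMDiffWithinAt_iff_uniqueDiffWithinAt.2 (uniqueDiffOn_cube s hs))) (Pi.single i (1 : ℝ))

theorem smul_mem_cube {s : Fin n → ℝ} (hs : s ∈ Icc (0 : Fin n → ℝ) 1) {t : ℝ}
    (ht : t ∈ Icc (0 : ℝ) 1) : t • s ∈ Icc (0 : Fin n → ℝ) 1 :=
  ⟨fun i => mul_nonneg ht.1 (hs.1 i), fun i => mul_le_one₀ ht.2 (hs.1 i) (hs.2 i)⟩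

/-- As `n ≥ 1`, the origin is a boundary point of the cube; hence every ray `λ ↦ N(λσ)` starts at
`x₀`, below the frame `p₀`. -/
theorem apply_toCube_zero_smul (hn : 1 ≤ n) (N : Ω^ (Fin n) M x₀) (s : Fin n → ℝ) :
    N (toCube ((0 : ℝ) • s)) = x₀ :=
  N.2 _ ⟨⟨0, hn⟩, Or.inl (by simp [toCube])⟩

namespace PrincipalBundle.Connection

/-- The integrand of the loop form. -/
def loopIntegrand (A : π.Connection) (B : π.AdjointForm (n + 1)) (p₀ : P) (N : Ω^ (Fin n) M x₀)
    (X : FieldAlong E N) (s : Fin n → ℝ) : F :=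
  B.formL (A.transport (fun l : ℝ => N (toCube (l • s))) p₀)
    (Fin.cons (α := fun _ => E) (X (toCube s)) (partialDeriv N s))

theorem loopForm_eq (A : π.Connection) (B : π.AdjointForm (n + 1)) (p₀ : P) (N : Ω^ (Fin n) M x₀)
    (X : FieldAlong E N) :
    A.loopForm B p₀ x₀ N X = ∫ s in Icc (0 : Fin n → ℝ) 1, A.loopIntegrand B p₀ N X s := rfl

variable [FiniteDimensional ℝ E] [CompleteSpace F]

/-- Used only for the integrability needed in the proof of linearity. -/
theorem contDiffOn_loopIntegrand (hn : 1 ≤ n) (A : π.Connection) (B : π.AdjointForm (n + 1))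
    {p₀ : P} (hp₀ : π.proj p₀ = x₀) {N : Ω^ (Fin n) M x₀} (hN : IsSmoothLoop E N)
    {X : FieldAlong E N} (hX : IsTangentVector N X) :
    ContDiffOn ℝ 1 (A.loopIntegrand B p₀ N X) (Icc 0 1) := by
  have hc : ContMDiffOn 𝓘(ℝ, (Fin n → ℝ) × ℝ) 𝓘(ℝ, E) ∞
      (fun z : (Fin n → ℝ) × ℝ => N (toCube (z.2 • z.1))) (Icc 0 1 ×ˢ Icc 0 1) := by
    have h1 : ContMDiff 𝓘(ℝ, (Fin n → ℝ) × ℝ) 𝓘(ℝ, Fin n → ℝ) ∞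
        (fun z : (Fin n → ℝ) × ℝ => z.2 • z.1) := (contDiff_snd.smul contDiff_fst).contMDiff
    exact ContMDiffOn.comp (g := fun s : Fin n → ℝ => N (toCube s)) hN h1.contMDiffOn
      fun z hz => smul_mem_cube hz.1 hz.2
  refine A.contDiffOn_formL_transport B (convex_Icc 0 1) uniqueDiffOn_cube hc (fun s _ => ?_)
    (ξ := fun i s => Fin.cons (α := fun _ => E) (X (toCube s)) (partialDeriv N s) i) fun i => ?_
  · rw [hp₀, apply_toCube_zero_smul hn]
  · refine Fin.cases ?_ (fun j => ?_) i
    · exact hX.1.congr fun s _ =>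
        tangentBundle_mk_congr (E := E) (congrArg (fun s => N (toCube s)) (one_smul ℝ s)) (X (toCube s))
    · exact (contMDiffOn_mfderivWithin_apply hN uniqueDiffOn_cube (Pi.single j (1 : ℝ))).congr
        fun s _ => tangentBundle_mk_congr (E := E) (congrArg (fun s => N (toCube s)) (one_smul ℝ s))
          (partialDeriv N s j)

/-- Both the family parameter and the point of the cube are parameters of the transport, whose time
runs along the ray. The velocity and the partial derivatives are directional derivatives of one
joint map, so they are smooth fields along it. -/
theorem contDiffOn_loopIntegrand_family (hn : 1 ≤ n) (A : π.Connection) (B : π.AdjointForm (n + 1))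
    {p₀ : P} (hp₀ : π.proj p₀ = x₀) {V : Type*} [NormedAddCommGroup V] [NormedSpace ℝ V]
    {S : Set V} (hS : Convex ℝ S) (hSu : UniqueDiffOn ℝ S) {x : V → Ω^ (Fin n) M x₀}
    (hx : IsSmoothFamily E S x) (v : V) :
    ContDiffOn ℝ 1 (fun z : V × (Fin n → ℝ) =>
      A.loopIntegrand B p₀ (x z.1) (velocity E S x z.1 v) z.2) (S ×ˢ Icc 0 1) := by
  have hD : UniqueDiffOn ℝ (S ×ˢ Icc (0 : Fin n → ℝ) 1) := hSu.prod uniqueDiffOn_cube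
  have hc : ContMDiffOn 𝓘(ℝ, (V × (Fin n → ℝ)) × ℝ) 𝓘(ℝ, E) ∞
      (fun z : (V × (Fin n → ℝ)) × ℝ => x z.1.1 (toCube (z.2 • z.1.2)))
      ((S ×ˢ Icc 0 1) ×ˢ Icc 0 1) := by
    have h1 : ContMDiff 𝓘(ℝ, (V × (Fin n → ℝ)) × ℝ) 𝓘(ℝ, V × (Fin n → ℝ)) ∞
        (fun z : (V × (Fin n → ℝ)) × ℝ => (z.1.1, z.2 • z.1.2)) :=
      (contDiff_fst.fst.prodMk (contDiff_snd.smul contDiff_fst.snd)).contMDiff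
    exact ContMDiffOn.comp (g := fun z : V × (Fin n → ℝ) => x z.1 (toCube z.2)) hx h1.contMDiffOn
      fun z hz => ⟨hz.1.1, smul_mem_cube hz.1.2 hz.2⟩
  have h1 := A.contDiffOn_formL_transport B (hS.prod (convex_Icc 0 1)) hD hc (p₀ := p₀)
    (fun z _ => by rw [hp₀, apply_toCube_zero_smul hn])
    (ξ := fun i z => mfderivWithin 𝓘(ℝ, V × (Fin n → ℝ)) 𝓘(ℝ, E)
      (fun z : V × (Fin n → ℝ) => x z.1 (toCube z.2)) (S ×ˢ Icc 0 1) z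
      (Fin.cons (α := fun _ => V × (Fin n → ℝ)) (v, 0) (fun j => (0, Pi.single j 1)) i))
    fun i => (contMDiffOn_mfderivWithin_apply hx hD _).congr fun z _ =>
      tangentBundle_mk_congr (E := E) (congrArg (fun s => x z.1 (toCube s)) (one_smul ℝ z.2)) _
  refine h1.congr fun z hz => ?_
  refine congrArg (B.formL (A.transport (fun l : ℝ => x z.1 (toCube (l • z.2))) p₀))
    (funext fun i => ?_)
  refine Fin.cases ?_ (fun j => ?_) i
  · exact hx.velocity_toCube hSu hz.1 hz.2 v
  · exact hx.partialDeriv_eq hz.1 hz.2 j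

/-- Linearity is multilinearity of `B` in its first slot under the integral. The `C¹` condition is
differentiation under the integral over the compact cube. -/
theorem isConnection_loopForm [SecondCountableTopology F] (hn : 1 ≤ n) (A : π.Connection)
    (B : π.AdjointForm (n + 1)) {p₀ : P} (hp₀ : π.proj p₀ = x₀) :
    (A.loopForm B p₀ x₀).IsConnection (E := E) (n := n) where
  linear N hN X Y hX hY a b := by
    have hint : ∀ X : FieldAlong E N, IsTangentVector N X →
        MeasureTheory.IntegrableOn (A.loopIntegrand B p₀ N X) (Icc 0 1) := fun X hX =>
      (A.contDiffOn_loopIntegrand hn B hp₀ hN hX).continuousOn.integrableOn_compact isCompact_Icc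
    simp only [loopForm_eq]
    rw [← MeasureTheory.integral_smul, ← MeasureTheory.integral_smul]
    refine Eq.trans ?_ (MeasureTheory.integral_add ((hint X hX).smul a) ((hint Y hY).smul b))
    congr 1
    funext s
    set p := A.transport (fun l : ℝ => N (toCube (l • s))) p₀ with hp
    have h1 := (B.formL p).toContinuousMultilinearMap.cons_add (partialDeriv N s)
      (a • (X (toCube s) : E)) (b • (Y (toCube s) : E))
    have h2 := (B.formL p).toContinuousMultilinearMap.cons_smul (partialDeriv N s) a
      (X (toCube s) : E)
    have h3 := (B.formL p).toContinuousMultilinearMap.cons_smul (partialDeriv N s) b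
      (Y (toCube s) : E)
    exact h1.trans (congrArg₂ (· + ·) h2 h3)
  contDiff k x hx v := by
    have h1 := A.contDiffOn_loopIntegrand_family hn B hp₀ (convex_Icc 0 1) uniqueDiffOn_cube hx v
    have hD : UniqueDiffOn ℝ (Icc (0 : Fin k → ℝ) 1 ×ˢ Icc (0 : Fin n → ℝ) 1) :=
      uniqueDiffOn_cube.prod uniqueDiffOn_cube
    set g := fun z : (Fin k → ℝ) × (Fin n → ℝ) =>
      A.loopIntegrand B p₀ (x z.1) (velocity E (Icc 0 1) x z.1 v) z.2 with hg
    refine contDiffOn_one_setIntegral (convex_Icc 0 1) uniqueDiffOn_cube isCompact_Icc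
      measurableSet_Icc (f := fun q s => g (q, s))
      (f' := fun q s => (fderivWithin ℝ g (Icc 0 1 ×ˢ Icc 0 1) (q, s)).comp
        (ContinuousLinearMap.inl ℝ (Fin k → ℝ) (Fin n → ℝ))) (fun q hq => ?_) ?_
      fun q hq s hs => ?_
    · exact h1.continuousOn.comp (by fun_prop) fun s hs => ⟨hq, hs⟩
    · exact (h1.continuousOn_fderivWithin hD le_rfl).clm_comp continuousOn_const
    · exact ((h1.differentiableOn one_ne_zero (q, s) ⟨hq, hs⟩).hasFDerivWithinAt).comp
        (f := fun q => (q, s)) q (hasFDerivAt_prodMk_left q s).hasFDerivWithinAt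
        fun q' hq' => ⟨hq', hs⟩

end PrincipalBundle.Connection

end Bundles

end HigherLoop

end

theorem mainTheorem6
    -- the manifold `M` with base point `x₀`
    {E : Type*} [NormedAddCommGroup E] [NormedSpace ℝ E] [FiniteDimensional ℝ E]
    {M : Type*} [TopologicalSpace M] [T2Space M] [SecondCountableTopology M]
    [ChartedSpace E M] [IsManifold 𝓘(ℝ, E) ∞ M] (x₀ : M)
    -- the Lie group `G`
    {F : Type*} [NormedAddCommGroup F] [NormedSpace ℝ F] [FiniteDimensional ℝ F]
    {G : Type*} [TopologicalSpace G] [T2Space G] [ChartedSpace F G] [Group G]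
    [LieGroup 𝓘(ℝ, F) ∞ G]
    (n : ℕ) (hn : 1 ≤ n) :
    -- a connection `A` on a principal bundle `π : P → M` and an adjoint `(n+1)`-form `B`
    -- define a connection on `Ωⁿ(M, x₀)`
    (∀ (Q : Type*) [NormedAddCommGroup Q] [NormedSpace ℝ Q] [FiniteDimensional ℝ Q]
      (P : Type*) [TopologicalSpace P] [T2Space P] [ChartedSpace Q P] [IsManifold 𝓘(ℝ, Q) ∞ P]
      (π : HigherLoop.PrincipalBundle E M F G Q P)
      (A : π.Connection) (B : π.AdjointForm (n + 1)) (p₀ : P), π.proj p₀ = x₀ →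
        (A.loopForm B p₀ x₀).IsConnection) ∧
    -- every flat connection on `Ωⁿ(M, x₀)`, in particular every flat one of that form, has an
    -- abelian holonomy group, and its holonomy is a representation of `π_{n+1}(M, x₀)`
    (∀ 𝒜 : HigherLoop.FormData E M x₀ n F, 𝒜.IsConnection → 𝒜.IsFlat G →
      (∀ α : GenLoop (Fin (n + 1)) M x₀, HigherLoop.IsSmoothLoop E α →
        ∃! h : G, 𝒜.IsHolonomy α h) ∧
      (𝒜.holonomyGroup G : Set G) = 𝒜.holonomies G ∧
      (∀ a ∈ 𝒜.holonomyGroup G, ∀ b ∈ 𝒜.holonomyGroup G, a * b = b * a) ∧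
      ∃! ρ : HomotopyGroup.Pi (n + 1) M x₀ →* 𝒜.holonomyGroup G,
        ∀ α : GenLoop (Fin (n + 1)) M x₀, HigherLoop.IsSmoothLoop E α →
          𝒜.IsHolonomy α (ρ (Quotient.mk _ α) : G)) := by
  have : CompleteSpace F := FiniteDimensional.complete ℝ F
  refine ⟨?_, fun 𝒜 h𝒜 hF => ⟨fun α hα => h𝒜.existsUnique_isHolonomy hα,
    hF.holonomy_representation hn h𝒜⟩⟩
  -- Properness provides the second countability of `F` that `isConnection_loopForm` asks for.
  have : ProperSpace F := FiniteDimensional.proper ℝ F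
  intro Q _ _ _ P _ _ _ _ π A B p₀ hp₀
  exact A.isConnection_loopForm hn B hp₀
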